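/- Let $V,W$ be finite-dimensional complex vector spaces, $G=\mathrm{GL}(V\oplus W)$ and $H=\mathrm{GL}(V)\times\mathrm{GL}(W)\subset G$ (block diagonal matrices), with the trace forms $(X,Y)=\mathrm{Tr}(XY)$ on $\mathfrak g=\mathrm{End}(V\oplus W)$ and $\mathfrak h=\mathrm{End}(V)\oplus\mathrm{End}(W)$. Let $U_+,U_-\subset G$ be the groups of block upper, respectively block lower, triangular matrices with identity diagonal blocks. Write $\theta=g^{-1}dg$, $\bar\theta=(dg)g^{-1}$ for the Maurer–Cartan forms; for Lie algebra valued one-forms put $(\alpha,\beta)(u,v)=(\alpha(u),\beta(v))-(\alpha(v),\beta(u))$, and $(\theta^3)=(\theta,[\theta,\theta])/2$. A complex quasi-Hamiltonian $K$-space is a complex manifold $M$ with a holomorphic action of $K$, a holomorphic map $\mu:M\to K$ that is equivariant for conjugation, and a $K$-invariant holomorphic two-form $\omega$ such that $d\omega=\mu^*(\theta^3)/6$; $\omega(v_X,\cdot)=\tfrac12\mu^*(\theta+\bar\theta,X)$ for all $X\in\mathrm{Lie}(K)$, where $(v_X)_m=-\frac{d}{dt}(e^{tX}\cdot m)|_{t=0}$;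 and $\ker\omega_m\cap\ker d\mu_m=0$ for all $m\in M$. An isomorphism of such spaces is an equivariant biholomorphism that matches the moment maps and the two-forms. Let $\mathcal A^2(V,W)=G\times(U_+\times U_-)^2\times H$, with points $(C,S_1,S_2,S_3,S_4,h)$ ($S_1,S_3\in U_+$, $S_2,S_4\in U_-$), with the action $(g,k)\cdot(C,S_i,h)=(kCg^{-1},kS_ik^{-1},khk^{-1})$ of $G\times H$, with moment map $(\mu_G,\mu_H)=(C^{-1}hS_4S_3S_2S_1C,\ h^{-1})$, and with the two-form $\omega_{\mathcal A}$ given by $$2\omega_{\mathcal A}=(\bar\gamma,\mathrm{Ad}_b\bar\gamma)+(\bar\gamma,\bar\beta)+(\bar\gamma_4,\eta)-\sum_{i=1}^4(\gamma_i,\gamma_{i-1}),$$ where $b=hS_4S_3S_2S_1$, $C_i=S_i\cdots S_1C$ (so $C_0=C$), $\gamma_i=C_i^*\theta$, $\bar\gamma_i=C_i^*\bar\theta$, $\bar\gamma=\bar\gamma_0$, $\bar\beta=b^*\bar\theta$, $\eta=h^*\theta$. Let $\mathcal B(V,W)=\{(a,b)\in\mathrm{Hom}(W,V)\oplus\mathrm{Hom}(V,W):\det(1+ab)\neq0\}$,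 with the action $(k,l)\cdot(a,b)=(kal^{-1},lbk^{-1})$ of $H$, the moment map $(a,b)\mapsto((1+ab)^{-1},1+ba)$ and the two-form $$\omega_{\mathcal B}=\tfrac12\left(\mathrm{Tr}_V\,(1+ab)^{-1}da\wedge db-\mathrm{Tr}_W\,(1+ba)^{-1}db\wedge da\right).$$ Theorem. $\mathcal B(V,W)$ is a complex quasi-Hamiltonian $H$-space. The level set $\mu_G^{-1}(1)$ is an embedded complex submanifold of $\mathcal A^2(V,W)$; the quotient $\mathcal A^2(V,W)/\!\!/G:=\mu_G^{-1}(1)/G$ is a complex manifold such that the projection from $\mu_G^{-1}(1)$ is a holomorphic submersion; the restriction of $\omega_{\mathcal A}$ to $\mu_G^{-1}(1)$ descends to this quotient; and with the descended two-form, the induced action of $H$ and the moment map induced by $\mu_H$, the quotient is a complex quasi-Hamiltonian $H$-space. The map $$\mathcal A^2(V,W)/\!\!/G\to\mathcal B(V,W),\qquad [(C,S_1,S_2,S_3,S_4,h)]\mapsto(a,b),$$ where $a$ is the upper right block of $S_1$ and $b$ is the lower left block of $S_2$, is well defined and is an isomorphism of quasi-Hamiltonian $H$-spaces. -/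

import Mathlib

open scoped Manifold ContDiff

noncomputable section

set_option linter.unusedSectionVars false

namespace QuasiHamiltonian

/-! ## Two-forms on complex manifolds -/

section Forms

variable {E E' : Type*} [NormedAddCommGroup E] [NormedSpace ℂ E]
  [NormedAddCommGroup E'] [NormedSpace ℂ E']
  {M N : Type*} [TopologicalSpace M] [ChartedSpace E M] [TopologicalSpace N] [ChartedSpace E' N]

/-- A (not necessarily holomorphic) field of complex alternating two-forms on the tangent spaces of
a manifold `M` modelled on `E`. (The tangent space of `M` at a point is `E` by definition.) -/
abbrev TwoForm (E M : Type*) [NormedAddCommGroup E] [NormedSpace ℂ E] : Type _ :=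
  M → E [⋀^Fin 2]→L[ℂ] ℂ

/-- The pullback `f^*Ω` of a two-form. -/
def pullbackForm (f : M → N) (Ω : TwoForm E' N) : TwoForm E M :=
  fun m => (Ω (f m)).compContinuousLinearMap (mfderiv 𝓘(ℂ, E) 𝓘(ℂ, E') f m : E →L[ℂ] E')

/-- The expression of a two-form in the chart around `m₀`; meaningful on the target of the chart. -/
def localForm (Ω : TwoForm E M) (m₀ : M) : E → E [⋀^Fin 2]→L[ℂ] ℂ :=
  pullbackForm (M := E) (chartAt E m₀).symm Ω

/-- A two-form is holomorphic if it is so in charts. -/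
def IsHolomorphicForm (Ω : TwoForm E M) : Prop :=
  ∀ m₀ : M, ContDiffOn ℂ ω (localForm Ω m₀) (chartAt E m₀).target

/-- The exterior derivative of a two-form on a manifold, computed at `m` in the chart around `m`. -/
def dForm (Ω : TwoForm E M) (m : M) : E [⋀^Fin 3]→L[ℂ] ℂ :=
  (extDeriv (localForm Ω m) (chartAt E m m)).compContinuousLinearMap
    (mfderiv 𝓘(ℂ, E) 𝓘(ℂ, E) (chartAt E m) m : E →L[ℂ] E)

/-- The two-form `(α, β)`, obtained by wedging the form parts of two vector-valued one-forms
and pairing the values: `(α, β)(u, v) = κ (α u) (β v) - κ (α v) (β u)`. -/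
def wedgePair {F F' : Type*} [NormedAddCommGroup F] [NormedSpace ℂ F] [NormedAddCommGroup F']
    [NormedSpace ℂ F'] (κ : F →L[ℂ] F' →L[ℂ] ℂ) (α : E →L[ℂ] F) (β : E →L[ℂ] F') :
    E [⋀^Fin 2]→L[ℂ] ℂ where
  toFun v := κ (α (v 0)) (β (v 1)) - κ (α (v 1)) (β (v 0))
  map_update_add' := by
    intro _ v i x y
    fin_cases i <;> simp <;> ring
  map_update_smul' := by
    intro _ v i c x
    fin_cases i <;> simp <;> ring
  cont := by fun_prop
  map_eq_zero_of_eq' := by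
    intro v i j h hij
    fin_cases i <;> fin_cases j <;> simp_all

variable {A : Type*} [NormedRing A] [NormedAlgebra ℂ A]

/-- The pullback `g^*θ = g⁻¹ dg` of the left-invariant Maurer-Cartan form. -/
def leftMC (g : M → Aˣ) (m : M) : E →L[ℂ] A :=
  (ContinuousLinearMap.mul ℂ A (↑(g m)⁻¹ : A)).comp
    (mfderiv 𝓘(ℂ, E) 𝓘(ℂ, A) (fun x => (g x : A)) m : E →L[ℂ] A)

/-- The pullback `g^*θ̄ = (dg) g⁻¹` of the right-invariant Maurer-Cartan form. -/
def rightMC (g : M → Aˣ) (m : M) : E →L[ℂ] A :=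
  ((ContinuousLinearMap.mul ℂ A).flip (↑(g m)⁻¹ : A)).comp
    (mfderiv 𝓘(ℂ, E) 𝓘(ℂ, A) (fun x => (g x : A)) m : E →L[ℂ] A)

/-- `Ad_g α = g α g⁻¹` for an `A`-valued covector `α`. -/
def adForm (g : Aˣ) (α : E →L[ℂ] A) : E →L[ℂ] A :=
  ((ContinuousLinearMap.mul ℂ A (g : A)).comp
    ((ContinuousLinearMap.mul ℂ A).flip (↑g⁻¹ : A))).comp α

end Forms

/-! ## Complex quasi-Hamiltonian spaces

The group is the group of units `Aˣ` of a complex Banach algebra `A`, with Lie algebra `A` and Lie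
bracket the commutator, and `κ` is the chosen bilinear form on the Lie algebra. A product of general
linear groups is the group of units of the product of the endomorphism algebras. -/

section Spaces

variable {A : Type*} [NormedRing A] [NormedAlgebra ℂ A] [CompleteSpace A]

/-- The exponential map from the Lie algebra `A` to the group `Aˣ`. -/
def expUnit (X : A) : Aˣ :=
  letI : NormedAlgebra ℚ A := NormedAlgebra.restrictScalars ℚ ℂ A
  (NormedSpace.isUnit_exp X).unit


variable {E E' : Type*} [NormedAddCommGroup E] [NormedSpace ℂ E]
  [NormedAddCommGroup E'] [NormedSpace ℂ E']
  {M N : Type*} [TopologicalSpace M] [ChartedSpace E M] [MulAction Aˣ M]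
  [TopologicalSpace N] [ChartedSpace E' N] [MulAction Aˣ N]

/-- The fundamental vector field `v_X` at `m`: minus the tangent to the flow `t ↦ e^{tX} • m`. -/
def fundVec (E : Type*) [NormedAddCommGroup E] [NormedSpace ℂ E] [ChartedSpace E M]
    (X : A) (m : M) : E :=
  -((mfderiv 𝓘(ℂ, ℂ) 𝓘(ℂ, E) (fun t : ℂ => expUnit (t • X) • m) 0 : ℂ →L[ℂ] E) (1 : ℂ))

/-- `M`, with its action of `Aˣ`, moment map `μ` and two-form `Ω`, is a complex quasi-Hamiltonian
`Aˣ`-space. -/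
structure IsQuasiHamiltonian (κ : A →L[ℂ] A →L[ℂ] ℂ) (μ : M → Aˣ) (Ω : TwoForm E M) : Prop where
  t2 : T2Space M
  secondCountable : SecondCountableTopology M
  isManifold : IsManifold 𝓘(ℂ, E) ω M
  action_holomorphic :
    ContMDiff (𝓘(ℂ, A).prod 𝓘(ℂ, E)) 𝓘(ℂ, E) ω (fun p : Aˣ × M => p.1 • p.2)
  moment_holomorphic : ContMDiff 𝓘(ℂ, E) 𝓘(ℂ, A) ω μ
  moment_equivariant : ∀ (g : Aˣ) (m : M), μ (g • m) = g * μ m * g⁻¹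
  form_holomorphic : IsHolomorphicForm Ω
  form_invariant : ∀ g : Aˣ, pullbackForm (fun m : M => g • m) Ω = Ω
  /-- (QH1) `dΩ = μ^*(θ³)/6`, where `(θ³) = (θ, [θ, θ])/2`. -/
  qh1 : ∀ (m : M) (u v w : E), dForm Ω m ![u, v, w] =
    (1 / 6) * (κ (leftMC μ m u) ⁅leftMC μ m v, leftMC μ m w⁆
      + κ (leftMC μ m v) ⁅leftMC μ m w, leftMC μ m u⁆
      + κ (leftMC μ m w) ⁅leftMC μ m u, leftMC μ m v⁆)
  /-- (QH2) `Ω(v_X, ·) = (1/2) μ^*(θ + θ̄, X)`. -/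
  qh2 : ∀ (X : A) (m : M) (u : E), Ω m ![fundVec E X m, u] =
    (1 / 2) * κ (leftMC μ m u + rightMC μ m u) X
  /-- (QH3) `ker Ω ∩ ker dμ = 0`. -/
  qh3 : ∀ (m : M) (u : E), (∀ v : E, Ω m ![u, v] = 0) →
    (mfderiv 𝓘(ℂ, E) 𝓘(ℂ, A) μ m : E →L[ℂ] A) u = 0 → u = 0

/-- `f : M ≃ N` is an isomorphism of quasi-Hamiltonian spaces: a biholomorphism which is
equivariant and matches the moment maps and the two-forms. -/
structure IsQHIso (μM : M → Aˣ) (ΩM : TwoForm E M) (μN : N → Aˣ) (ΩN : TwoForm E' N)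
    (f : M ≃ N) : Prop where
  holomorphic : ContMDiff 𝓘(ℂ, E) 𝓘(ℂ, E') ω f
  holomorphic_symm : ContMDiff 𝓘(ℂ, E') 𝓘(ℂ, E) ω f.symm
  equivariant : ∀ (g : Aˣ) (m : M), f (g • m) = g • f m
  moment : ∀ m : M, μN (f m) = μM m
  form : pullbackForm f ΩN = ΩM

end Spaces

/-! ## The groups `G = GL(V ⊕ W)`, `H = GL(V) × GL(W)`, `U₊` and `U₋` -/

/-- Finite-dimensional complex normed spaces are complete. -/
instance (priority := 50) completeOfFiniteDimensional (V : Type*) [NormedAddCommGroup V]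
    [NormedSpace ℂ V] [FiniteDimensional ℂ V] : CompleteSpace V :=
  FiniteDimensional.complete ℂ V

variable (V W : Type*) [NormedAddCommGroup V] [NormedSpace ℂ V] [FiniteDimensional ℂ V]
  [NormedAddCommGroup W] [NormedSpace ℂ W] [FiniteDimensional ℂ W]

/-- The Lie algebra of `G`. -/
abbrev LieG : Type _ := (V × W) →L[ℂ] (V × W)

/-- `G = GL(V ⊕ W)`. -/
abbrev GG : Type _ := (LieG V W)ˣ

/-- The Lie algebra of `H`. -/
abbrev LieH : Type _ := (V →L[ℂ] V) × (W →L[ℂ] W)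

/-- `H = GL(V) × GL(W)`. -/
abbrev HH : Type _ := (LieH V W)ˣ

/-- The trace on `End(V)`. -/
def trL : (V →L[ℂ] V) →L[ℂ] ℂ :=
  LinearMap.toContinuousLinearMap
    ((LinearMap.trace ℂ V).comp (ContinuousLinearMap.coeLM ℂ : (V →L[ℂ] V) →ₗ[ℂ] (V →ₗ[ℂ] V)))

/-- The trace form `(X, Y) = Tr(XY)` on the Lie algebra of `G`. -/
def kappaG : LieG V W →L[ℂ] LieG V W →L[ℂ] ℂ :=
  (ContinuousLinearMap.compL ℂ (LieG V W) (LieG V W) ℂ (trL (V × W))).comp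
    (ContinuousLinearMap.mul ℂ (LieG V W))

/-- The trace form `((X, X'), (Y, Y')) = Tr_V(XY) + Tr_W(X'Y')` on the Lie algebra of `H`
(the restriction of the trace form of `G` to block diagonal matrices). -/
def kappaH : LieH V W →L[ℂ] LieH V W →L[ℂ] ℂ :=
  (ContinuousLinearMap.compL ℂ (LieH V W) (LieH V W) ℂ ((trL V).coprod (trL W))).comp
    (ContinuousLinearMap.mul ℂ (LieH V W))

variable {V W}

/-- The block matrix with rows `(p, q)` and `(r, s)`, acting on `V ⊕ W`. -/
def blockMat (p : V →L[ℂ] V) (q : W →L[ℂ] V) (r : V →L[ℂ] W) (s : W →L[ℂ] W) : LieG V W :=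
  (p.coprod q).prod (r.coprod s)

@[simp] theorem blockMat_apply (p : V →L[ℂ] V) (q : W →L[ℂ] V) (r : V →L[ℂ] W) (s : W →L[ℂ] W)
    (x : V × W) : blockMat p q r s x = (p x.1 + q x.2, r x.1 + s x.2) := rfl

theorem blockMat_mul (p p' : V →L[ℂ] V) (q q' : W →L[ℂ] V) (r r' : V →L[ℂ] W)
    (s s' : W →L[ℂ] W) : blockMat p q r s * blockMat p' q' r' s' =
      blockMat (p ∘L p' + q ∘L r') (p ∘L q' + q ∘L s') (r ∘L p' + s ∘L r') (r ∘L q' + s ∘L s') := by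
  ext x <;> simp

theorem blockMat_one : (blockMat 1 0 0 1 : LieG V W) = 1 := by
  ext x <;> simp

variable (V W)

/-- The block diagonal embedding `H → G`. -/
def blockDiag : HH V W →* GG V W :=
  Units.map
    { toFun := fun X : LieH V W => blockMat X.1 0 0 X.2
      map_one' := blockMat_one
      map_mul' := fun X Y => by
        rw [blockMat_mul]; simp [ContinuousLinearMap.mul_def] }

/-- The element of `G` with block matrix rows `(1, a)` and `(0, 1)`. -/
def upperUnit (a : W →L[ℂ] V) : GG V W where
  val := blockMat 1 a 0 1
  inv := blockMat 1 (-a) 0 1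
  val_inv := by rw [blockMat_mul]; ext x <;> simp
  inv_val := by rw [blockMat_mul]; ext x <;> simp

/-- The element of `G` with block matrix rows `(1, 0)` and `(b, 1)`. -/
def lowerUnit (b : V →L[ℂ] W) : GG V W where
  val := blockMat 1 0 b 1
  inv := blockMat 1 0 (-b) 1
  val_inv := by rw [blockMat_mul]; ext x <;> simp
  inv_val := by rw [blockMat_mul]; ext x <;> simp

/-- `U₊`: block upper triangular matrices with identity diagonal blocks. -/
def UPlus : Subgroup (GG V W) where
  carrier := {g | ∃ a : W →L[ℂ] V, (g : LieG V W) = blockMat 1 a 0 1}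
  mul_mem' := by
    rintro g g' ⟨a, ha⟩ ⟨b, hb⟩
    refine ⟨b + a, ?_⟩
    rw [Units.val_mul, ha, hb, blockMat_mul]
    ext x <;> simp
  one_mem' := ⟨0, blockMat_one.symm⟩
  inv_mem' := by
    rintro g ⟨a, ha⟩
    obtain rfl : g = upperUnit V W a := Units.ext ha
    exact ⟨-a, rfl⟩

/-- `U₋`: block lower triangular matrices with identity diagonal blocks. -/
def UMinus : Subgroup (GG V W) where
  carrier := {g | ∃ b : V →L[ℂ] W, (g : LieG V W) = blockMat 1 0 b 1}
  mul_mem' := by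
    rintro g g' ⟨a, ha⟩ ⟨b, hb⟩
    refine ⟨a + b, ?_⟩
    rw [Units.val_mul, ha, hb, blockMat_mul]
    ext x <;> simp
  one_mem' := ⟨0, blockMat_one.symm⟩
  inv_mem' := by
    rintro g ⟨a, ha⟩
    obtain rfl : g = lowerUnit V W a := Units.ext ha
    exact ⟨-a, rfl⟩

variable {V W}

/-- The upper right matrix entry, in `Hom(W, V)`. -/
def upperEntry (g : GG V W) : W →L[ℂ] V :=
  ContinuousLinearMap.fst ℂ V W ∘L (g : LieG V W) ∘L ContinuousLinearMap.inr ℂ V W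

/-- The lower left matrix entry, in `Hom(V, W)`. -/
def lowerEntry (g : GG V W) : V →L[ℂ] W :=
  ContinuousLinearMap.snd ℂ V W ∘L (g : LieG V W) ∘L ContinuousLinearMap.inl ℂ V W

theorem continuous_upperUnit : Continuous (upperUnit V W) := by
  rw [Units.isOpenEmbedding_val.isInducing.continuous_iff]
  change Continuous fun a : W →L[ℂ] V => (blockMat 1 a 0 1 : LieG V W)
  have : (fun a : W →L[ℂ] V => (blockMat 1 a 0 1 : LieG V W)) = fun a =>
      1 + ContinuousLinearMap.inl ℂ V W ∘L a ∘L ContinuousLinearMap.snd ℂ V W := by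
    funext a; ext x <;> simp
  rw [this]
  fun_prop

theorem continuous_lowerUnit : Continuous (lowerUnit V W) := by
  rw [Units.isOpenEmbedding_val.isInducing.continuous_iff]
  change Continuous fun b : V →L[ℂ] W => (blockMat 1 0 b 1 : LieG V W)
  have : (fun b : V →L[ℂ] W => (blockMat 1 0 b 1 : LieG V W)) = fun b =>
      1 + ContinuousLinearMap.inr ℂ V W ∘L b ∘L ContinuousLinearMap.fst ℂ V W := by
    funext a; ext x <;> simp
  rw [this]
  fun_prop

variable (V W)

/-- `U₊ ≃ Hom(W, V)`, by the upper right entry. -/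
def upperHomeo : UPlus V W ≃ₜ (W →L[ℂ] V) where
  toFun S := upperEntry (S : GG V W)
  invFun a := ⟨upperUnit V W a, a, rfl⟩
  left_inv := by
    rintro ⟨g, a, ha⟩
    apply Subtype.ext
    apply Units.ext
    change (blockMat 1 (upperEntry g) 0 1 : LieG V W) = g
    rw [ha]
    ext x <;> simp [upperEntry, ha]
  right_inv := by
    intro a
    ext x
    simp [upperEntry, upperUnit]
  continuous_toFun := by
    have h : Continuous fun S : UPlus V W => ((S : GG V W) : LieG V W) :=
      Units.continuous_val.comp continuous_subtype_val
    unfold upperEntry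
    fun_prop
  continuous_invFun := continuous_upperUnit.subtype_mk _

/-- `U₋ ≃ Hom(V, W)`, by the lower left entry. -/
def lowerHomeo : UMinus V W ≃ₜ (V →L[ℂ] W) where
  toFun S := lowerEntry (S : GG V W)
  invFun b := ⟨lowerUnit V W b, b, rfl⟩
  left_inv := by
    rintro ⟨g, a, ha⟩
    apply Subtype.ext
    apply Units.ext
    change (blockMat 1 0 (lowerEntry g) 1 : LieG V W) = g
    rw [ha]
    ext x <;> simp [lowerEntry, ha]
  right_inv := by
    intro a
    ext x
    simp [lowerEntry, lowerUnit]
  continuous_toFun := by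
    have h : Continuous fun S : UMinus V W => ((S : GG V W) : LieG V W) :=
      Units.continuous_val.comp continuous_subtype_val
    unfold lowerEntry
    fun_prop
  continuous_invFun := continuous_lowerUnit.subtype_mk _

variable {V W}

/-- `H` acts on `U₊` by conjugation. -/
def conjPlus (k : HH V W) (S : UPlus V W) : UPlus V W :=
  ⟨blockDiag V W k * S * (blockDiag V W k)⁻¹, by
    obtain ⟨g, a, ha⟩ := S
    refine ⟨(k : LieH V W).1 ∘L a ∘L (↑k⁻¹ : LieH V W).2, ?_⟩
    have h1 : (k : LieH V W).1 * (↑k⁻¹ : LieH V W).1 = 1 := congrArg Prod.fst k.mul_inv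
    have h2 : (k : LieH V W).2 * (↑k⁻¹ : LieH V W).2 = 1 := congrArg Prod.snd k.mul_inv
    rw [← map_inv]
    change (blockMat (k : LieH V W).1 0 0 (k : LieH V W).2 * (g : LieG V W)) *
      blockMat (↑k⁻¹ : LieH V W).1 0 0 (↑k⁻¹ : LieH V W).2 = _
    have h1' : ∀ v : V, (k : LieH V W).1 ((↑k⁻¹ : LieH V W).1 v) = v := fun v =>
      DFunLike.congr_fun h1 v
    have h2' : ∀ w : W, (k : LieH V W).2 ((↑k⁻¹ : LieH V W).2 w) = w := fun w =>
      DFunLike.congr_fun h2 w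
    rw [ha, blockMat_mul, blockMat_mul]
    ext x <;> simp [h1', h2']⟩

/-- `H` acts on `U₋` by conjugation. -/
def conjMinus (k : HH V W) (S : UMinus V W) : UMinus V W :=
  ⟨blockDiag V W k * S * (blockDiag V W k)⁻¹, by
    obtain ⟨g, a, ha⟩ := S
    refine ⟨(k : LieH V W).2 ∘L a ∘L (↑k⁻¹ : LieH V W).1, ?_⟩
    have h1 : (k : LieH V W).1 * (↑k⁻¹ : LieH V W).1 = 1 := congrArg Prod.fst k.mul_inv
    have h2 : (k : LieH V W).2 * (↑k⁻¹ : LieH V W).2 = 1 := congrArg Prod.snd k.mul_inv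
    rw [← map_inv]
    change (blockMat (k : LieH V W).1 0 0 (k : LieH V W).2 * (g : LieG V W)) *
      blockMat (↑k⁻¹ : LieH V W).1 0 0 (↑k⁻¹ : LieH V W).2 = _
    have h1' : ∀ v : V, (k : LieH V W).1 ((↑k⁻¹ : LieH V W).1 v) = v := fun v =>
      DFunLike.congr_fun h1 v
    have h2' : ∀ w : W, (k : LieH V W).2 ((↑k⁻¹ : LieH V W).2 w) = w := fun w =>
      DFunLike.congr_fun h2 w
    rw [ha, blockMat_mul, blockMat_mul]
    ext x <;> simp [h1', h2']⟩

/-! ## The higher fission space `𝒜²(V, W)` -/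

variable (V W)

/-- `𝒜²(V, W) = G × (U₊ × U₋)² × H`, with points `(C, S₁, S₂, S₃, S₄, h)`. -/
def Fission : Type _ :=
  GG V W × (UPlus V W × UMinus V W × UPlus V W × UMinus V W) × HH V W

instance : TopologicalSpace (Fission V W) :=
  inferInstanceAs (TopologicalSpace
    (GG V W × (UPlus V W × UMinus V W × UPlus V W × UMinus V W) × HH V W))

namespace Fission

variable {V W}

def C (p : Fission V W) : GG V W := p.1
def S₁ (p : Fission V W) : UPlus V W := p.2.1.1
def S₂ (p : Fission V W) : UMinus V W := p.2.1.2.1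
def S₃ (p : Fission V W) : UPlus V W := p.2.1.2.2.1
def S₄ (p : Fission V W) : UMinus V W := p.2.1.2.2.2
def h (p : Fission V W) : HH V W := p.2.2

@[ext] theorem ext {p q : Fission V W} (hC : p.C = q.C) (h₁ : p.S₁ = q.S₁) (h₂ : p.S₂ = q.S₂)
    (h₃ : p.S₃ = q.S₃) (h₄ : p.S₄ = q.S₄) (hh : p.h = q.h) : p = q :=
  Prod.ext hC (Prod.ext (Prod.ext h₁ (Prod.ext h₂ (Prod.ext h₃ h₄))) hh)

variable (V W)

/-- The vector space on which `𝒜²(V, W)` is modelled. -/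
abbrev Model : Type _ :=
  LieG V W × ((W →L[ℂ] V) × (V →L[ℂ] W) × (W →L[ℂ] V) × (V →L[ℂ] W)) × LieH V W

/-- The global coordinates: `C` and `h` as linear maps, and the nontrivial entries of the `Sᵢ`. -/
def coords (p : Fission V W) : Model V W :=
  ((p.C : LieG V W),
    (upperEntry p.S₁.1, lowerEntry p.S₂.1, upperEntry p.S₃.1, lowerEntry p.S₄.1),
    (p.h : LieH V W))

theorem isOpenEmbedding_coords : Topology.IsOpenEmbedding (coords V W) :=
  Units.isOpenEmbedding_val.prodMap
    (((upperHomeo V W).isOpenEmbedding.prodMap ((lowerHomeo V W).isOpenEmbedding.prodMap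
      ((upperHomeo V W).isOpenEmbedding.prodMap (lowerHomeo V W).isOpenEmbedding))).prodMap
        Units.isOpenEmbedding_val)

instance : Nonempty (Fission V W) := ⟨((1 : GG V W), (1, 1, 1, 1), (1 : HH V W))⟩

/-- The complex manifold structure of `𝒜²(V, W)`, given by the global coordinates. -/
instance : ChartedSpace (Model V W) (Fission V W) :=
  (isOpenEmbedding_coords V W).singletonChartedSpace

variable {V W}

/-- `g · (C, S, h) = (C g⁻¹, S, h)` for `g ∈ G`. -/
instance : MulAction (GG V W) (Fission V W) where
  smul g p := (p.C * g⁻¹, (p.S₁, p.S₂, p.S₃, p.S₄), p.h)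
  one_smul p := Fission.ext (by change p.C * 1⁻¹ = p.C; simp) rfl rfl rfl rfl rfl
  mul_smul g g' p := Fission.ext (by
    change p.C * (g * g')⁻¹ = p.C * g'⁻¹ * g⁻¹; group) rfl rfl rfl rfl rfl

/-- `k · (C, S, h) = (k C, k S k⁻¹, k h k⁻¹)` for `k ∈ H`. -/
instance : MulAction (HH V W) (Fission V W) where
  smul k p := (blockDiag V W k * p.C,
    (conjPlus k p.S₁, conjMinus k p.S₂, conjPlus k p.S₃, conjMinus k p.S₄), k * p.h * k⁻¹)
  one_smul p := by
    refine Fission.ext ?_ (Subtype.ext ?_) (Subtype.ext ?_) (Subtype.ext ?_) (Subtype.ext ?_) ?_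
    · change blockDiag V W 1 * p.C = p.C; simp
    · change blockDiag V W 1 * p.S₁.1 * (blockDiag V W 1)⁻¹ = p.S₁.1; simp
    · change blockDiag V W 1 * p.S₂.1 * (blockDiag V W 1)⁻¹ = p.S₂.1; simp
    · change blockDiag V W 1 * p.S₃.1 * (blockDiag V W 1)⁻¹ = p.S₃.1; simp
    · change blockDiag V W 1 * p.S₄.1 * (blockDiag V W 1)⁻¹ = p.S₄.1; simp
    · change 1 * p.h * 1⁻¹ = p.h; simp
  mul_smul k l p := by
    refine Fission.ext ?_ (Subtype.ext ?_) (Subtype.ext ?_) (Subtype.ext ?_) (Subtype.ext ?_) ?_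
    · change blockDiag V W (k * l) * p.C = blockDiag V W k * (blockDiag V W l * p.C)
      simp [mul_assoc]
    · change blockDiag V W (k * l) * p.S₁.1 * (blockDiag V W (k * l))⁻¹ = blockDiag V W k *
        (blockDiag V W l * p.S₁.1 * (blockDiag V W l)⁻¹) * (blockDiag V W k)⁻¹
      simp [mul_assoc]
    · change blockDiag V W (k * l) * p.S₂.1 * (blockDiag V W (k * l))⁻¹ = blockDiag V W k *
        (blockDiag V W l * p.S₂.1 * (blockDiag V W l)⁻¹) * (blockDiag V W k)⁻¹
      simp [mul_assoc]
    · change blockDiag V W (k * l) * p.S₃.1 * (blockDiag V W (k * l))⁻¹ = blockDiag V W k *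
        (blockDiag V W l * p.S₃.1 * (blockDiag V W l)⁻¹) * (blockDiag V W k)⁻¹
      simp [mul_assoc]
    · change blockDiag V W (k * l) * p.S₄.1 * (blockDiag V W (k * l))⁻¹ = blockDiag V W k *
        (blockDiag V W l * p.S₄.1 * (blockDiag V W l)⁻¹) * (blockDiag V W k)⁻¹
      simp [mul_assoc]
    · change k * l * p.h * (k * l)⁻¹ = k * (l * p.h * l⁻¹) * k⁻¹
      group

/-- `C₁ = S₁ C`. -/
def C₁ (p : Fission V W) : GG V W := p.S₁ * p.C
/-- `C₂ = S₂ S₁ C`. -/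
def C₂ (p : Fission V W) : GG V W := p.S₂ * p.C₁
/-- `C₃ = S₃ S₂ S₁ C`. -/
def C₃ (p : Fission V W) : GG V W := p.S₃ * p.C₂
/-- `C₄ = S₄ S₃ S₂ S₁ C`. -/
def C₄ (p : Fission V W) : GG V W := p.S₄ * p.C₃

/-- `b = h S₄ S₃ S₂ S₁`. -/
def b (p : Fission V W) : GG V W := blockDiag V W p.h * p.S₄ * p.S₃ * p.S₂ * p.S₁

/-- The `G`-component `C⁻¹ h S₄ S₃ S₂ S₁ C` of the moment map. -/
def momentG (p : Fission V W) : GG V W := p.C⁻¹ * p.b * p.C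

/-- The `H`-component `h⁻¹` of the moment map. -/
def momentH (p : Fission V W) : HH V W := p.h⁻¹

variable (V W)

/-- The two-form on `𝒜²(V, W)`, given by
`2 Ω = (γ̄, Ad_b γ̄) + (γ̄, β̄) + (γ̄₄, η) - ∑ᵢ (γᵢ, γᵢ₋₁)`
where `γᵢ = Cᵢ^*θ`, `γ̄ᵢ = Cᵢ^*θ̄`, `γ̄ = γ̄₀`, `β̄ = b^*θ̄`, `η = h^*θ` and `C₀ = C`. -/
def form : TwoForm (Model V W) (Fission V W) := fun p =>
  (1 / 2 : ℂ) • (wedgePair (kappaG V W) (rightMC C p) (adForm p.b (rightMC C p))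
    + wedgePair (kappaG V W) (rightMC C p) (rightMC b p)
    + wedgePair (kappaG V W) (rightMC C₄ p) (leftMC (fun q : Fission V W => blockDiag V W q.h) p)
    - (wedgePair (kappaG V W) (leftMC C₁ p) (leftMC C p)
      + wedgePair (kappaG V W) (leftMC C₂ p) (leftMC C₁ p)
      + wedgePair (kappaG V W) (leftMC C₃ p) (leftMC C₂ p)
      + wedgePair (kappaG V W) (leftMC C₄ p) (leftMC C₃ p)))

variable {V W}

theorem momentG_smul (g : GG V W) (p : Fission V W) :
    momentG (g • p) = g * momentG p * g⁻¹ := by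
  change (p.C * g⁻¹)⁻¹ * p.b * (p.C * g⁻¹) = g * (p.C⁻¹ * p.b * p.C) * g⁻¹
  group

theorem momentG_smulH (k : HH V W) (p : Fission V W) : momentG (k • p) = momentG p := by
  change (blockDiag V W k * p.C)⁻¹ * (blockDiag V W (k * p.h * k⁻¹) *
    (blockDiag V W k * p.S₄ * (blockDiag V W k)⁻¹) *
    (blockDiag V W k * p.S₃ * (blockDiag V W k)⁻¹) *
    (blockDiag V W k * p.S₂ * (blockDiag V W k)⁻¹) *
    (blockDiag V W k * p.S₁ * (blockDiag V W k)⁻¹)) * (blockDiag V W k * p.C) =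
    p.C⁻¹ * (blockDiag V W p.h * p.S₄ * p.S₃ * p.S₂ * p.S₁) * p.C
  simp only [map_mul, map_inv]
  group

theorem smul_smul_comm (g : GG V W) (k : HH V W) (p : Fission V W) :
    k • g • p = g • k • p :=
  Fission.ext (by
    change blockDiag V W k * (p.C * g⁻¹) = blockDiag V W k * p.C * g⁻¹; group) rfl rfl rfl rfl rfl

end Fission

/-! ## The quasi-Hamiltonian reduction `𝒜²(V, W) // G = μ_G⁻¹(1) / G` -/

/-- The level set `μ_G⁻¹(1)`. -/
def LevelSet : Type _ := {p : Fission V W // p.momentG = 1}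

instance : TopologicalSpace (LevelSet V W) :=
  inferInstanceAs (TopologicalSpace {p : Fission V W // p.momentG = 1})

variable {V W}

instance : MulAction (GG V W) (LevelSet V W) where
  smul g z := ⟨g • z.1, by rw [Fission.momentG_smul, z.2]; group⟩
  one_smul z := Subtype.ext (one_smul _ z.1)
  mul_smul g g' z := Subtype.ext (mul_smul g g' z.1)

instance : MulAction (HH V W) (LevelSet V W) where
  smul k z := ⟨k • z.1, by rw [Fission.momentG_smulH, z.2]⟩
  one_smul z := Subtype.ext (one_smul _ z.1)
  mul_smul g g' z := Subtype.ext (mul_smul g g' z.1)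

variable (V W)

/-- The reduced space `μ_G⁻¹(1) / G`, with the quotient topology. -/
def Reduced : Type _ := Quotient (MulAction.orbitRel (GG V W) (LevelSet V W))

instance : TopologicalSpace (Reduced V W) :=
  inferInstanceAs (TopologicalSpace (Quotient (MulAction.orbitRel (GG V W) (LevelSet V W))))

variable {V W}

/-- The inclusion `μ_G⁻¹(1) → 𝒜²(V, W)`. -/
def LevelSet.incl (z : LevelSet V W) : Fission V W := z.1

/-- The projection `μ_G⁻¹(1) → 𝒜²(V, W) // G`. -/
def LevelSet.proj (z : LevelSet V W) : Reduced V W := Quotient.mk _ z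

/-- The induced action of `H` on the reduced space. -/
instance : MulAction (HH V W) (Reduced V W) where
  smul k := Quotient.map (fun z => k • z) (by
    rintro z _ ⟨g, rfl⟩
    exact ⟨g, Subtype.ext (Fission.smul_smul_comm g k _).symm⟩)
  one_smul := by rintro ⟨z⟩; exact congrArg LevelSet.proj (one_smul _ z)
  mul_smul k l := by rintro ⟨z⟩; exact congrArg LevelSet.proj (mul_smul k l z)

/-- The moment map induced on the reduced space by the `H`-component of the moment map. -/
def Reduced.moment : Reduced V W → HH V W :=
  Quotient.lift (fun z => z.incl.momentH) (by rintro z _ ⟨g, rfl⟩; rfl)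

/-- The given manifold structures on `μ_G⁻¹(1)` and on `μ_G⁻¹(1) / G`, and the two-form `Ω` on the
latter, are those of the quasi-Hamiltonian reduction: the level set is an embedded complex
submanifold of `𝒜²(V, W)` (it carries the subspace topology), the projection to the quotient is a
holomorphic submersion, and the pullback of `Ω` to the level set is the restriction of the
two-form of `𝒜²(V, W)`. These conditions determine both complex structures and `Ω`. -/
structure IsReduction {EZ EQ : Type*} [NormedAddCommGroup EZ] [NormedSpace ℂ EZ]
    [NormedAddCommGroup EQ] [NormedSpace ℂ EQ] [ChartedSpace EZ (LevelSet V W)]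
    [ChartedSpace EQ (Reduced V W)] (Ω : TwoForm EQ (Reduced V W)) : Prop where
  levelSet_isManifold : IsManifold 𝓘(ℂ, EZ) ω (LevelSet V W)
  incl_holomorphic : ContMDiff 𝓘(ℂ, EZ) 𝓘(ℂ, Fission.Model V W) ω
    (LevelSet.incl : LevelSet V W → Fission V W)
  incl_immersion : ∀ z : LevelSet V W, Function.Injective
    (mfderiv 𝓘(ℂ, EZ) 𝓘(ℂ, Fission.Model V W) (LevelSet.incl : LevelSet V W → Fission V W) z)
  reduced_isManifold : IsManifold 𝓘(ℂ, EQ) ω (Reduced V W)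
  proj_holomorphic : ContMDiff 𝓘(ℂ, EZ) 𝓘(ℂ, EQ) ω (LevelSet.proj : LevelSet V W → Reduced V W)
  proj_submersion : ∀ z : LevelSet V W, Function.Surjective
    (mfderiv 𝓘(ℂ, EZ) 𝓘(ℂ, EQ) (LevelSet.proj : LevelSet V W → Reduced V W) z)
  form_descends : pullbackForm (E := EZ) (LevelSet.proj : LevelSet V W → Reduced V W) Ω =
    pullbackForm LevelSet.incl (Fission.form V W)

/-! ## Van den Bergh's space `ℬ(V, W)` -/

variable (V W)

/-- `Hom(W, V) ⊕ Hom(V, W)`. -/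
abbrev HomPair : Type _ := (W →L[ℂ] V) × (V →L[ℂ] W)

/-- The set `{(a, b) | det (1 + a b) ≠ 0}` is open in `Hom(W, V) ⊕ Hom(V, W)`. -/
def vdbOpens : TopologicalSpace.Opens (HomPair V W) where
  carrier := {p | (1 + p.1 ∘L p.2 : V →L[ℂ] V).det ≠ 0}
  is_open' := by
    refine isOpen_ne.preimage (ContinuousLinearMap.continuous_det.comp ?_)
    fun_prop

/-- `ℬ(V, W) = {(a, b) | det (1 + a b) ≠ 0}`, with its structure of complex manifold as an open
subset of `Hom(W, V) ⊕ Hom(V, W)`. -/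
abbrev VdB : Type _ := vdbOpens V W

variable {V W}

theorem mem_vdbOpens_iff (p : HomPair V W) :
    p ∈ vdbOpens V W ↔ IsUnit (1 + p.1 ∘L p.2 : V →L[ℂ] V) := by
  change (1 + p.1 ∘L p.2 : V →L[ℂ] V).det ≠ 0 ↔ _
  constructor
  · intro h
    exact ⟨ContinuousLinearEquiv.toUnit
      ((1 + p.1 ∘L p.2 : V →L[ℂ] V).toContinuousLinearEquivOfDetNeZero h), by ext; rfl⟩
  · rintro ⟨u, hu⟩
    rw [← hu]
    have h : LinearMap.det (((u : V →L[ℂ] V) : V →ₗ[ℂ] V) ∘ₗ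
        (((↑u⁻¹ : V →L[ℂ] V)) : V →ₗ[ℂ] V)) = 1 := by
      rw [show ((u : V →L[ℂ] V) : V →ₗ[ℂ] V) ∘ₗ (((↑u⁻¹ : V →L[ℂ] V)) : V →ₗ[ℂ] V) =
        LinearMap.id from congrArg ContinuousLinearMap.toLinearMap u.mul_inv]
      exact LinearMap.det_id
    rw [LinearMap.det_comp] at h
    exact left_ne_zero_of_mul_eq_one h

namespace VdB

/-- `a ∈ Hom(W, V)`. -/
def a (p : VdB V W) : W →L[ℂ] V := p.1.1

/-- `b ∈ Hom(V, W)`. -/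
def b (p : VdB V W) : V →L[ℂ] W := p.1.2

/-- `1 + a b ∈ GL(V)`. -/
def onePlusAB (p : VdB V W) : (V →L[ℂ] V)ˣ := ((mem_vdbOpens_iff p.1).mp p.2).unit

theorem val_onePlusAB (p : VdB V W) : (p.onePlusAB : V →L[ℂ] V) = 1 + p.a ∘L p.b := rfl

/-- `1 + b a ∈ GL(W)`, with inverse `1 - b (1 + a b)⁻¹ a`. -/
def onePlusBA (p : VdB V W) : (W →L[ℂ] W)ˣ where
  val := 1 + p.b ∘L p.a
  inv := 1 - p.b ∘L (↑p.onePlusAB⁻¹ : V →L[ℂ] V) ∘L p.a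
  val_inv := by
    have h : ∀ v : V, (↑p.onePlusAB⁻¹ : V →L[ℂ] V) v +
        p.a (p.b ((↑p.onePlusAB⁻¹ : V →L[ℂ] V) v)) = v := fun v =>
      DFunLike.congr_fun p.onePlusAB.mul_inv v
    ext w
    have := congrArg p.b (h (p.a w))
    simp only [map_add] at this
    simp
    rw [← sub_eq_zero] at this ⊢
    refine Eq.trans ?_ (neg_eq_zero.mpr this)
    abel
  inv_val := by
    have h : ∀ v : V, (↑p.onePlusAB⁻¹ : V →L[ℂ] V) v +
        (↑p.onePlusAB⁻¹ : V →L[ℂ] V) (p.a (p.b v)) = v := fun v => by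
      rw [← map_add]
      exact DFunLike.congr_fun p.onePlusAB.inv_mul v
    ext w
    have := congrArg p.b (h (p.a w))
    simp only [map_add] at this
    simp
    rw [← sub_eq_zero] at this ⊢
    refine Eq.trans ?_ (neg_eq_zero.mpr this)
    abel

theorem conj_mem (k : HH V W) (p : VdB V W) :
    ((k : LieH V W).1 ∘L p.a ∘L (↑k⁻¹ : LieH V W).2,
      (k : LieH V W).2 ∘L p.b ∘L (↑k⁻¹ : LieH V W).1) ∈ vdbOpens V W := by
  rw [mem_vdbOpens_iff]
  have h1 : ∀ v : V, (k : LieH V W).1 ((↑k⁻¹ : LieH V W).1 v) = v := fun v =>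
    DFunLike.congr_fun (congrArg Prod.fst k.mul_inv) v
  have h2 : ∀ w : W, (↑k⁻¹ : LieH V W).2 ((k : LieH V W).2 w) = w := fun w =>
    DFunLike.congr_fun (congrArg Prod.snd k.inv_mul) w
  let k₁ : (V →L[ℂ] V)ˣ := (MulEquiv.prodUnits k).1
  refine ⟨k₁ * p.onePlusAB * k₁⁻¹, ?_⟩
  ext v
  change (k : LieH V W).1 ((↑k⁻¹ : LieH V W).1 v + p.a (p.b ((↑k⁻¹ : LieH V W).1 v))) = _
  simp [h1, h2]

/-- `(k, l) · (a, b) = (k a l⁻¹, l b k⁻¹)` for `(k, l) ∈ H`. -/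
instance : MulAction (HH V W) (VdB V W) where
  smul k p := ⟨_, conj_mem k p⟩
  one_smul p := rfl
  mul_smul k l p := by
    refine Subtype.ext (Prod.ext ?_ ?_)
    · change ((k * l : HH V W) : LieH V W).1 ∘L p.a ∘L (↑(k * l)⁻¹ : LieH V W).2 =
        (k : LieH V W).1 ∘L ((l : LieH V W).1 ∘L p.a ∘L (↑l⁻¹ : LieH V W).2) ∘L
          (↑k⁻¹ : LieH V W).2
      rw [mul_inv_rev]
      rfl
    · change ((k * l : HH V W) : LieH V W).2 ∘L p.b ∘L (↑(k * l)⁻¹ : LieH V W).1 =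
        (k : LieH V W).2 ∘L ((l : LieH V W).2 ∘L p.b ∘L (↑l⁻¹ : LieH V W).1) ∘L
          (↑k⁻¹ : LieH V W).1
      rw [mul_inv_rev]
      rfl

/-- The moment map `(a, b) ↦ ((1 + a b)⁻¹, 1 + b a)`. -/
def moment (p : VdB V W) : HH V W := MulEquiv.prodUnits.symm (p.onePlusAB⁻¹, p.onePlusBA)

/-- The bilinear form `(s, t) ↦ Tr (x s t)` on `Hom(F', F) × Hom(F, F')`, for `x ∈ End(F)`. -/
def trForm {F F' : Type*} [NormedAddCommGroup F] [NormedSpace ℂ F] [FiniteDimensional ℂ F]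
    [NormedAddCommGroup F'] [NormedSpace ℂ F'] (x : F →L[ℂ] F) :
    (F' →L[ℂ] F) →L[ℂ] (F →L[ℂ] F') →L[ℂ] ℂ :=
  (ContinuousLinearMap.compL ℂ (F →L[ℂ] F') (F →L[ℂ] F) ℂ
    ((trL F).comp (ContinuousLinearMap.mul ℂ (F →L[ℂ] F) x))).comp
    (ContinuousLinearMap.compL ℂ F F' F)

variable (V W)

/-- The two-form `(1/2) (Tr_V (1 + a b)⁻¹ da ∧ db - Tr_W (1 + b a)⁻¹ db ∧ da)`. -/
def form : TwoForm (HomPair V W) (VdB V W) := fun p =>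
  let da : HomPair V W →L[ℂ] (W →L[ℂ] V) := mfderiv 𝓘(ℂ, HomPair V W) 𝓘(ℂ, W →L[ℂ] V) a p
  let db : HomPair V W →L[ℂ] (V →L[ℂ] W) := mfderiv 𝓘(ℂ, HomPair V W) 𝓘(ℂ, V →L[ℂ] W) b p
  (1 / 2 : ℂ) • (wedgePair (trForm (↑p.onePlusAB⁻¹ : V →L[ℂ] V)) da db
    - wedgePair (trForm (↑p.onePlusBA⁻¹ : W →L[ℂ] W)) db da)

end VdB

end QuasiHamiltonian

end

open QuasiHamiltonian

set_option linter.unusedSectionVars false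

namespace QuasiHamiltonian

/-! ## Manifolds with a global chart -/

/-! Every manifold involved has one chart that is an open embedding into a finite-dimensional vector
space, so tangent spaces are the model space, the differential of the chart is the identity, and all
conditions become calculus and algebra in End(V ⊕ W).

For ℬ(V, W), regard V ⊕ W as a super vector space and put X = `offDiag (a, b)`, an odd operator.
Then P = 1 + X² is block diagonal with blocks 1 + ab and 1 + ba. With R = P⁻¹ the two-form is u, v ↦
½ str(R(uv - vu)) (`VdB.formL_apply`). The moment map is P⁻¹ on V and P on W; these opposite
exponents turn the sum of the traces on V and W into a supertrace. The three axioms follow from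
str(yX) = -str(Xy), XR = RX and RX² = 1 - R: see `superTrace_cubic` for QH1, `superTrace_moment` for
QH2 and `superTrace_kernel` for QH3.

For the reduction, μ_G = 1 says S₄S₃ = h⁻¹S₁⁻¹S₂⁻¹, which does not involve C. Comparing blocks, a
and b determine h, S₃ and S₄, with h⁻¹ = ((1 + ab)⁻¹, 1 + ba), and 1 + ab is invertible. So the
level set is G × ℬ(V, W) (`LevelSet.homeo`). Since G acts by right translation on the first factor,
the quotient is ℬ(V, W) (`Reduced.homeo`). Charts and two-form on the quotient are transported along
this homeomorphism, so its quasi-Hamiltonian axioms come from the same `VdB.isQuasiHamiltonian`.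

What remains is that the transported form pulls back to the restriction of ω_𝒜
(`LevelSet.form_descends_apply`). On the level set b = hS₄S₃S₂S₁ = 1, which kills the first two
terms of ω_𝒜. Writing Cᵢ = DᵢC with D₄ = h⁻¹, the contributions of C telescope and cancel against
the η term (`trace_framing_cancel`). The pairing of D₄ with D₃ vanishes because D₃ = S₄⁻¹D₄ with S₄
unipotent lower triangular. The pairings of D₂ with D₁ and of D₃ with D₂ give the two-form of ℬ(V,
W) by `trace_stokes` and `trace_reduced`. -/

/-- All preferred charts of `M` are given by the open embedding `ι` of `M` in the model space. -/
structure IsGlobalChart {E M : Type*} [NormedAddCommGroup E] [TopologicalSpace M]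
    [ChartedSpace E M] (ι : M → E) : Prop where
  isOpenEmbedding : Topology.IsOpenEmbedding ι
  chartAt_apply : ∀ m x : M, chartAt E m x = ι x
  chartAt_source : ∀ m : M, (chartAt E m).source = Set.univ

section GlobalChart

variable {E E' : Type*} [NormedAddCommGroup E] [NormedSpace ℂ E]
  [NormedAddCommGroup E'] [NormedSpace ℂ E']
  {M N : Type*} [TopologicalSpace M] [ChartedSpace E M] [TopologicalSpace N] [ChartedSpace E' N]
  {H : Type*} [TopologicalSpace H] {F : Type*} [NormedAddCommGroup F] [NormedSpace ℂ F]
  {I : ModelWithCorners ℂ F H} {L : Type*} [TopologicalSpace L] [ChartedSpace H L]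

theorem isGlobalChart_singletonChartedSpace {X : Type*} [TopologicalSpace X] [Nonempty X]
    {ι : X → E} (h : Topology.IsOpenEmbedding ι) :
    @IsGlobalChart E X _ _ h.singletonChartedSpace ι := by
  let _ := h.singletonChartedSpace
  exact ⟨h, fun _ _ => rfl, fun _ => rfl⟩

theorem isGlobalChart_units {A : Type*} [NormedRing A] [CompleteSpace A] :
    IsGlobalChart (E := A) (Units.val : Aˣ → A) :=
  ⟨Units.isOpenEmbedding_val, fun _ _ => rfl, fun _ => rfl⟩

theorem isGlobalChart_opens (U : TopologicalSpace.Opens E) :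
    IsGlobalChart (E := E) (Subtype.val : U → E) := by
  refine ⟨U.isOpen.isOpenEmbedding_subtypeVal, fun _ _ => rfl, fun m => ?_⟩
  rw [TopologicalSpace.Opens.chartAt_eq, OpenPartialHomeomorph.subtypeRestr_source]
  simp [chartAt_self_eq]

namespace IsGlobalChart

variable {ι : M → E} {κ : N → E'}

theorem chartAt_symm_apply (hι : IsGlobalChart ι) (m x : M) : (chartAt E m).symm (ι x) = x := by
  rw [← hι.chartAt_apply m x]
  exact (chartAt E m).left_inv (by rw [hι.chartAt_source]; trivial)

theorem apply_chartAt_symm (hι : IsGlobalChart ι) (m : M) {x : E}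
    (hx : x ∈ (chartAt E m).target) : ι ((chartAt E m).symm x) = x := by
  rw [← hι.chartAt_apply m]
  exact (chartAt E m).right_inv hx

theorem contMDiffAt (hι : IsGlobalChart ι) (m : M) : ContMDiffAt 𝓘(ℂ, E) 𝓘(ℂ, E) ω ι m := by
  rw [contMDiffAt_iff]
  refine ⟨hι.isOpenEmbedding.continuous.continuousAt, ?_⟩
  refine contDiffWithinAt_id.congr_of_eventuallyEq ?_ ?_
  · have h : (chartAt E m).target ∈ nhds (chartAt E m m) :=
      (chartAt E m).open_target.mem_nhds (mem_chart_target E m)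
    filter_upwards [mem_nhdsWithin_of_mem_nhds h] with x hx
    simpa [chartAt_self_eq] using hι.apply_chartAt_symm m hx
  · simp [chartAt_self_eq, hι.chartAt_apply, hι.chartAt_symm_apply]

theorem contMDiff (hι : IsGlobalChart ι) : ContMDiff 𝓘(ℂ, E) 𝓘(ℂ, E) ω ι := hι.contMDiffAt

/-- The chart of M is ι and that of E is the identity, so f and ι ∘ f have the same expression in
charts; only continuity has to be carried back along the embedding. The same reason gives
`hasMFDerivAt_of_comp`, with an unchanged differential. -/
theorem contMDiffAt_of_comp (hι : IsGlobalChart ι) {f : L → M} {l : L}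
    (h : ContMDiffAt I 𝓘(ℂ, E) ω (ι ∘ f) l) : ContMDiffAt I 𝓘(ℂ, E) ω f l := by
  rw [contMDiffAt_iff] at h ⊢
  refine ⟨hι.isOpenEmbedding.isInducing.continuousAt_iff.2 h.1, ?_⟩
  convert! h.2 using 1
  funext x
  simp [chartAt_self_eq, hι.chartAt_apply]

theorem contMDiff_of_comp (hι : IsGlobalChart ι) {f : L → M}
    (h : ContMDiff I 𝓘(ℂ, E) ω (ι ∘ f)) : ContMDiff I 𝓘(ℂ, E) ω f :=
  fun l => hι.contMDiffAt_of_comp (h l)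

theorem hasMFDerivAt_of_comp (hι : IsGlobalChart ι) {f : L → M} {l : L} {f' : F →L[ℂ] E}
    (h : HasMFDerivAt I 𝓘(ℂ, E) (fun x => ι (f x)) l f') : HasMFDerivAt I 𝓘(ℂ, E) f l f' := by
  have e : writtenInExtChartAt I 𝓘(ℂ, E) l f =
      writtenInExtChartAt I 𝓘(ℂ, E) l (fun x => ι (f x)) := by
    funext x
    simp [writtenInExtChartAt, chartAt_self_eq, hι.chartAt_apply]
  refine ⟨hι.isOpenEmbedding.isInducing.continuousAt_iff.2 h.1, ?_⟩
  rw [e]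
  exact h.2

/-- The differential of a global chart is the identity, since tangent spaces are identified with
the model space by means of the preferred charts. -/
theorem hasMFDerivAt (hι : IsGlobalChart ι) (m : M) :
    HasMFDerivAt 𝓘(ℂ, E) 𝓘(ℂ, E) ι m (ContinuousLinearMap.id ℂ E) := by
  refine ⟨hι.isOpenEmbedding.continuous.continuousAt, ?_⟩
  have h : (chartAt E m).target ∈ nhds (chartAt E m m) :=
    (chartAt E m).open_target.mem_nhds (mem_chart_target E m)
  refine ((hasFDerivAt_id _).congr_of_eventuallyEq ?_).hasFDerivWithinAt
  filter_upwards [h] with x hx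
  simpa [writtenInExtChartAt, chartAt_self_eq] using hι.apply_chartAt_symm m hx

/-- A map that is given in a global chart by a differentiable map between vector spaces. -/
theorem hasMFDerivAt_comp (hι : IsGlobalChart ι) {f : E → E'} {f' : E →L[ℂ] E'} {m : M}
    (h : HasFDerivAt f f' (ι m)) :
    HasMFDerivAt 𝓘(ℂ, E) 𝓘(ℂ, E') (fun x => f (ι x)) m f' := by
  have := h.hasMFDerivAt.comp m (hι.hasMFDerivAt m)
  exact this

theorem contMDiffAt_comp (hι : IsGlobalChart ι) {f : E → E'} {m : M}
    (h : ContDiffAt ℂ ω f (ι m)) : ContMDiffAt 𝓘(ℂ, E) 𝓘(ℂ, E') ω (fun x => f (ι x)) m :=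
  h.contMDiffAt.comp m (hι.contMDiffAt m)

/-- Composed with ι the inverse chart is the identity near x. Consequently the local expression of a
two-form involves no change of basis. -/
theorem hasMFDerivAt_chartAt_symm (hι : IsGlobalChart ι) (m : M) {x : E}
    (hx : x ∈ (chartAt E m).target) :
    HasMFDerivAt 𝓘(ℂ, E) 𝓘(ℂ, E) (chartAt E m).symm x (ContinuousLinearMap.id ℂ E) := by
  refine hι.hasMFDerivAt_of_comp ((hasMFDerivAt_id x).congr_of_eventuallyEq ?_)
  filter_upwards [(chartAt E m).open_target.mem_nhds hx] with y hy
  exact hι.apply_chartAt_symm m hy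

theorem localForm_eq (hι : IsGlobalChart ι) (Ω : TwoForm E M) (m : M) {x : E}
    (hx : x ∈ (chartAt E m).target) : localForm Ω m x = Ω ((chartAt E m).symm x) := by
  unfold localForm pullbackForm
  rw [(hι.hasMFDerivAt_chartAt_symm m hx).mfderiv]
  rfl

theorem localForm_eq_of_comp (hι : IsGlobalChart ι) {Ω : TwoForm E M}
    {Ω' : E → E [⋀^Fin 2]→L[ℂ] ℂ} (h : ∀ m, Ω m = Ω' (ι m)) (m : M) {x : E}
    (hx : x ∈ (chartAt E m).target) : localForm Ω m x = Ω' x := by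
  rw [hι.localForm_eq Ω m hx, h, hι.apply_chartAt_symm m hx]

theorem isHolomorphicForm (hι : IsGlobalChart ι) {Ω : TwoForm E M}
    {Ω' : E → E [⋀^Fin 2]→L[ℂ] ℂ} (h : ∀ m, Ω m = Ω' (ι m))
    (hΩ : ∀ m, ContDiffAt ℂ ω Ω' (ι m)) : IsHolomorphicForm Ω := by
  intro m
  refine ContDiffOn.congr (f := Ω') (fun x hx => ?_) fun x hx => hι.localForm_eq_of_comp h m hx
  rw [← hι.apply_chartAt_symm m hx]
  exact (hΩ _).contDiffWithinAt

/-- The exterior derivative depends only on the germ of the local expression, which is that of Ω',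
and the chart contributes the identity differential. Thus QH1 may be checked in the vector space. -/
theorem dForm_apply (hι : IsGlobalChart ι) {Ω : TwoForm E M}
    {Ω' : E → E [⋀^Fin 2]→L[ℂ] ℂ} (h : ∀ m, Ω m = Ω' (ι m)) (m : M) (v : Fin 3 → E) :
    dForm Ω m v = extDeriv Ω' (ι m) v := by
  have h1 : localForm Ω m =ᶠ[nhds (ι m)] Ω' := by
    have : (chartAt E m).target ∈ nhds (ι m) := by
      rw [← hι.chartAt_apply m]
      exact (chartAt E m).open_target.mem_nhds (mem_chart_target E m)
    filter_upwards [this] with x hx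
    exact hι.localForm_eq_of_comp h m hx
  have h2 : (chartAt E m : M → E) = ι := funext (hι.chartAt_apply m)
  unfold dForm
  rw [h2, h1.extDeriv_eq, (hι.hasMFDerivAt m).mfderiv]
  rfl

end IsGlobalChart

end GlobalChart

/-! ## Supertrace identities -/

section SuperTrace

variable {A : Type*} [Ring A] {s : A →+ ℂ} {X R : A}

/-- The expansion behind the identity for the exterior derivative of the two-form of `ℬ(V, W)`;
here `X` is odd for the supertrace `s` and `R = (1 + X²)⁻¹`. -/
theorem superTrace_triple (hX : ∀ y, s (y * X) = -s (X * y)) (hXR : X * R = R * X)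
    (hR : R * (X * X) = 1 - R) (x y z : A) :
    s ((x * X + X * x) * R * ((y * X + X * y) * R) * ((z * X + X * z) * R)) =
      s (x * y * R * z * (R * X)) - s (x * R * y * z * (R * X)) + s (x * y * (R * X) * z * R)
      - s (x * R * y * (R * X) * z) + s (x * (R * X) * y * z * R) - s (x * (R * X) * y * R * z) := by
  have h0 : (x * X + X * x) * R * ((y * X + X * y) * R) * ((z * X + X * z) * R) =
      x * X * R * y * X * R * z * X * R + x * X * R * y * X * R * X * z * R
      + x * X * R * X * y * R * z * X * R + x * X * R * X * y * R * X * z * R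
      + X * (x * R * y * X * R * z * X * R) + X * (x * R * y * X * R * X * z * R)
      + X * (x * R * X * y * R * z * X * R) + X * (x * R * X * y * R * X * z * R) := by
    noncomm_ring
  -- The four words that begin with X are turned cyclically, each at the cost of a sign. Every X²
  -- then meets an R and collapses by R X² = 1 - R.
  have h1 := hX (x * R * y * X * R * z * X * R)
  have h2 := hX (x * R * y * X * R * X * z * R)
  have h3 := hX (x * R * X * y * R * z * X * R)
  have h4 := hX (x * R * X * y * R * X * z * R)
  rw [h0]
  simp only [map_add]
  simp only [mul_assoc, hXR, hR, mul_sub, sub_mul, map_sub, mul_one] at h1 h2 h3 h4 ⊢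
  linear_combination h1 + h2 + h3 + h4

/-- This is QH1 for odd directions x, y, z. The derivative of 1 + X² along x is xX + Xx, that of R
is -R(xX + Xx)R, so the left side is -2 times the exterior derivative, and the right side is the
cubic form of the moment map. Both sides expand into words with one factor R X and two further
factors made of R, or with fewer, and these agree up to super-cyclic rotation. -/
theorem superTrace_cubic (hX : ∀ y, s (y * X) = -s (X * y)) (hRs : ∀ y, s (y * R) = s (R * y))
    (hXR : X * R = R * X) (hR : R * (X * X) = 1 - R) {x y z : A}
    (hx : ∀ a, s (a * x) = -s (x * a)) (hy : ∀ a, s (a * y) = -s (y * a))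
    (hz : ∀ a, s (a * z) = -s (z * a)) :
    s (R * (x * X + X * x) * R * (y * z - z * y)) + s (R * (y * X + X * y) * R * (z * x - x * z))
      + s (R * (z * X + X * z) * R * (x * y - y * x)) =
    s ((x * X + X * x) * R * ((y * X + X * y) * R) * ((z * X + X * z) * R))
      - s ((x * X + X * x) * R * ((z * X + X * z) * R) * ((y * X + X * y) * R)) := by
  rw [superTrace_triple hX hXR hR, superTrace_triple hX hXR hR]
  have hT : ∀ a, s (a * (R * X)) = -s (R * X * a) := fun a => by
    rw [← mul_assoc, hX, ← mul_assoc, hRs, ← mul_assoc]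
  have aux : ∀ {p q r : A}, (∀ a, s (a * p) = -s (p * a)) → (∀ a, s (a * q) = -s (q * a)) →
      (∀ a, s (a * r) = -s (r * a)) → s (R * (p * X + X * p) * R * (q * r)) =
      s (p * (R * X) * q * r * R) - s (p * R * q * r * (R * X)) := by
    intro p q r hp hq hr
    have h1 := hRs (p * (R * X) * q * r)
    have h2 := hT (p * R * q * r)
    simp only [mul_add, add_mul, map_add, mul_assoc, hXR] at h1 h2 ⊢
    simp only [← mul_assoc] at h1 h2 ⊢
    linear_combination -h1 + h2
  -- For odd p the product p R is odd and p R X is even: hence a sign in `rot1` and none in `rot2`.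
  have rot1 : ∀ {p : A}, (∀ a, s (a * p) = -s (p * a)) → ∀ a, s (a * p * R) = -s (p * R * a) :=
    fun hp a => by rw [hRs, ← mul_assoc, hp, mul_assoc]
  have rot2 : ∀ {p : A}, (∀ a, s (a * p) = -s (p * a)) →
      ∀ a, s (a * p * (R * X)) = s (p * (R * X) * a) :=
    fun hp a => by rw [hT, ← mul_assoc, hp]; simp only [mul_assoc, neg_neg]
  simp only [mul_sub, map_sub]
  rw [aux hx hy hz, aux hx hz hy, aux hy hz hx, aux hy hx hz, aux hz hx hy, aux hz hy hx]
  have a1 := rot1 hx (y * (R * X) * z)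
  have a2 := rot2 hx (y * R * z)
  have a3 := rot2 hz (x * y * R)
  have a4 := rot1 hz (x * y * (R * X))
  have b1 := rot1 hx (z * (R * X) * y)
  have b2 := rot2 hx (z * R * y)
  have b3 := rot2 hy (x * z * R)
  have b4 := rot1 hy (x * z * (R * X))
  simp only [mul_assoc] at a1 a2 a3 a4 b1 b2 b3 b4 ⊢
  linear_combination a1 - a2 - a3 - a4 - b1 + b2 + b3 + b4

/-- The identity behind the moment map condition for `ℬ(V, W)`. -/
theorem superTrace_moment (hX : ∀ y, s (y * X) = -s (X * y)) (hXR : X * R = R * X) {x ξ : A}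
    (hx : ∀ a, s (a * x) = -s (x * a)) :
    s (R * ((ξ * X - X * ξ) * x - x * (ξ * X - X * ξ))) =
      s (((x * X + X * x) * R + R * (x * X + X * x)) * ξ) := by
  have h1 := hx (R * ξ * X)
  have h2 := hx (R * X * ξ)
  have h3 := hX (R * x * ξ)
  have h4 := hX (x * R * ξ)
  simp only [mul_add, add_mul, mul_sub, sub_mul, map_add, map_sub, mul_assoc] at h1 h2 h3 h4 ⊢
  simp only [← mul_assoc, hXR] at h1 h2 h3 h4 ⊢
  simp only [mul_assoc] at h1 h2 h3 h4 ⊢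
  linear_combination h1 - h2 - h3 - h4

/-- The identity behind the nondegeneracy of the two-form of `ℬ(V, W)`. -/
theorem superTrace_kernel (hX : R * (1 + X * X) = 1) (hX' : (1 + X * X) * R = 1) {x y : A}
    (hx : x * X + X * x = 0) (hxs : ∀ a, s (a * x) = -s (x * a))
    (h : s (R * (x * y - y * x)) = 0) : s (R * x * y) + s (R * x * y) = 0 := by
  have h0 : x * X = -(X * x) := eq_neg_of_add_eq_zero_left hx
  -- As x anticommutes with X it commutes with X², hence with R. Oddness of x then gives s(R y x) =
  -- -s(R x y), so the two halves of the form add up instead of cancelling.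
  have h1 : x * (1 + X * X) = (1 + X * X) * x := by
    have : x * (X * X) = X * X * x := by
      rw [← mul_assoc, h0, neg_mul, mul_assoc, h0]
      simp [mul_assoc]
    rw [mul_add, add_mul, this, mul_one, one_mul]
  have h2 : R * x = x * R := by
    calc R * x = R * (x * (1 + X * X)) * R := by rw [mul_assoc, mul_assoc, hX', mul_one]
      _ = x * R := by rw [h1, ← mul_assoc, hX, one_mul]
  have h3 := hxs (R * y)
  rw [← mul_assoc, ← h2] at h3
  simp only [mul_sub, map_sub, ← mul_assoc] at h
  linear_combination h + h3

end SuperTrace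

/-! ## Pullbacks of two-forms -/

section Pullback

variable {E E' : Type*} [NormedAddCommGroup E] [NormedSpace ℂ E]
  [NormedAddCommGroup E'] [NormedSpace ℂ E']
  {M N : Type*} [TopologicalSpace M] [ChartedSpace E M] [TopologicalSpace N] [ChartedSpace E' N]

/-- The differential of a map between manifolds, as a map between the model spaces. -/
noncomputable def tangentMapAt (f : M → N) (m : M) : E →L[ℂ] E' :=
  mfderiv 𝓘(ℂ, E) 𝓘(ℂ, E') f m

theorem tangentMapAt_eq {f : M → N} {m : M} {f' : E →L[ℂ] E'}
    (h : HasMFDerivAt 𝓘(ℂ, E) 𝓘(ℂ, E') f m f') : tangentMapAt f m = f' := h.mfderiv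

theorem twoForm_ext {α β : E [⋀^Fin 2]→L[ℂ] ℂ} (h : ∀ u v, α ![u, v] = β ![u, v]) : α = β := by
  ext v
  have hv : v = ![v 0, v 1] := by ext i; fin_cases i <;> rfl
  rw [hv]
  exact h _ _

theorem compContinuousLinearMap_pair (α : E' [⋀^Fin 2]→L[ℂ] ℂ) (f : E →L[ℂ] E')
    (u v : E) : α.compContinuousLinearMap f ![u, v] = α ![f u, f v] := by
  rw [ContinuousAlternatingMap.compContinuousLinearMap_apply]
  congr 1
  ext i
  fin_cases i <;> rfl

theorem pullbackForm_apply (f : M → N) (Ω : TwoForm E' N) (m : M) (u v : E) :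
    pullbackForm f Ω m ![u, v] = Ω (f m) ![(tangentMapAt f m u : E'), tangentMapAt f m v] :=
  compContinuousLinearMap_pair _ (tangentMapAt f m) u v

end Pullback

/-! ## Maurer-Cartan forms of products and inverses -/

section MaurerCartan

variable {E E' : Type*} [NormedAddCommGroup E] [NormedSpace ℂ E]
  [NormedAddCommGroup E'] [NormedSpace ℂ E']
  {M N : Type*} [TopologicalSpace M] [ChartedSpace E M] [TopologicalSpace N] [ChartedSpace E' N]
  {A : Type*} [NormedRing A] [NormedAlgebra ℂ A]

variable (E) in
/-- Differentiability of a group-valued map at a point, as a map to the ambient algebra. -/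
abbrev UnitMDifferentiableAt (f : M → Aˣ) (m : M) : Prop :=
  MDifferentiableAt 𝓘(ℂ, E) 𝓘(ℂ, A) (fun x => (f x : A)) m

theorem leftMC_apply (f : M → Aˣ) (m : M) (u : E) :
    leftMC f m u = (↑(f m)⁻¹ : A) * tangentMapAt (fun x => (f x : A)) m u := rfl

theorem rightMC_apply (f : M → Aˣ) (m : M) (u : E) :
    rightMC f m u = tangentMapAt (fun x => (f x : A)) m u * (↑(f m)⁻¹ : A) := rfl

theorem rightMC_eq_conj (f : M → Aˣ) (m : M) (u : E) :
    rightMC f m u = f m * leftMC f m u * (↑(f m)⁻¹ : A) := by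
  rw [rightMC_apply, leftMC_apply, Units.mul_inv_cancel_left]

theorem rightMC_eq_zero_of_const {f : M → Aˣ} {c : Aˣ} (hf : ∀ m, f m = c) (m : M) :
    (rightMC f m : E →L[ℂ] A) = 0 := by
  obtain rfl : f = fun _ => c := funext hf
  ext u
  rw [rightMC_apply, tangentMapAt_eq (hasMFDerivAt_const _ _)]
  exact zero_mul _

theorem UnitMDifferentiableAt.mul {f g : M → Aˣ} {m : M} (hf : UnitMDifferentiableAt E f m)
    (hg : UnitMDifferentiableAt E g m) : UnitMDifferentiableAt E (fun x => f x * g x) m :=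
  MDifferentiableAt.mul hf hg

theorem leftMC_mul {f g : M → Aˣ} {m : M} (hf : UnitMDifferentiableAt E f m)
    (hg : UnitMDifferentiableAt E g m) (u : E) :
    leftMC (fun x => f x * g x) m u =
      (↑(g m)⁻¹ : A) * leftMC f m u * g m + leftMC g m u := by
  have h : tangentMapAt (fun x => ((f x * g x : Aˣ) : A)) m u =
      (f m : A) * tangentMapAt (fun x => (g x : A)) m u +
      tangentMapAt (fun x => (f x : A)) m u * (g m : A) :=
    DFunLike.congr_fun (tangentMapAt_eq (hf.hasMFDerivAt.mul' hg.hasMFDerivAt)) u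
  rw [leftMC_apply, h, leftMC_apply, leftMC_apply, mul_inv_rev, Units.val_mul, mul_add, add_comm]
  simp only [mul_assoc, Units.inv_mul_cancel_left]

theorem leftMC_comp {f : N → Aˣ} {g : M → N} {m : M} (hf : UnitMDifferentiableAt E' f (g m))
    (hg : MDifferentiableAt 𝓘(ℂ, E) 𝓘(ℂ, E') g m) (u : E) :
    leftMC f (g m) (tangentMapAt g m u : E') = leftMC (fun x => f (g x)) m u := by
  rw [leftMC_apply, leftMC_apply]
  congr 1
  exact (DFunLike.congr_fun (mfderiv_comp m hf hg) u).symm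

theorem rightMC_comp {f : N → Aˣ} {g : M → N} {m : M} (hf : UnitMDifferentiableAt E' f (g m))
    (hg : MDifferentiableAt 𝓘(ℂ, E) 𝓘(ℂ, E') g m) (u : E) :
    rightMC f (g m) (tangentMapAt g m u : E') = rightMC (fun x => f (g x)) m u := by
  rw [rightMC_eq_conj, rightMC_eq_conj, leftMC_comp hf hg]

variable [CompleteSpace A]

theorem hasMFDerivAt_inv {f : M → Aˣ} {m : M} (hf : UnitMDifferentiableAt E f m) :
    HasMFDerivAt 𝓘(ℂ, E) 𝓘(ℂ, A) (fun x => (↑(f x)⁻¹ : A)) m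
      ((-ContinuousLinearMap.mulLeftRight ℂ A (↑(f m)⁻¹ : A) (↑(f m)⁻¹ : A)).comp
        (tangentMapAt (fun x => (f x : A)) m : E →L[ℂ] A)) := by
  have h := (hasFDerivAt_ringInverse (𝕜 := ℂ) (f m)).hasMFDerivAt.comp m hf.hasMFDerivAt
  have e : (fun x => (↑(f x)⁻¹ : A)) = Ring.inverse ∘ fun x => (f x : A) := by
    funext x; simp
  rw [e]
  exact h

theorem UnitMDifferentiableAt.inv {f : M → Aˣ} {m : M} (hf : UnitMDifferentiableAt E f m) :
    UnitMDifferentiableAt E (fun x => (f x)⁻¹) m :=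
  (hasMFDerivAt_inv hf).mdifferentiableAt

theorem leftMC_inv {f : M → Aˣ} {m : M} (hf : UnitMDifferentiableAt E f m) (u : E) :
    leftMC (fun x => (f x)⁻¹) m u = -rightMC f m u := by
  rw [leftMC_apply, tangentMapAt_eq (hasMFDerivAt_inv hf), rightMC_apply]
  change (↑((f m)⁻¹)⁻¹ : A) * -((↑(f m)⁻¹ : A) * _ * (↑(f m)⁻¹ : A)) = _
  rw [inv_inv, mul_neg, mul_assoc, Units.mul_inv_cancel_left]
  rfl

end MaurerCartan

/-! ## Block matrices and traces -/

section Blocks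

variable {V W : Type*} [NormedAddCommGroup V] [NormedSpace ℂ V] [FiniteDimensional ℂ V]
  [NormedAddCommGroup W] [NormedSpace ℂ W] [FiniteDimensional ℂ W]

theorem trL_mul_comm (f g : V →L[ℂ] V) : trL V (f * g) = trL V (g * f) :=
  LinearMap.trace_mul_comm ℂ (f : V →ₗ[ℂ] V) (g : V →ₗ[ℂ] V)

theorem trL_comp_comm (f : V →L[ℂ] W) (g : W →L[ℂ] V) : trL V (g ∘L f) = trL W (f ∘L g) :=
  LinearMap.trace_comp_comm' (f : V →ₗ[ℂ] W) (g : W →ₗ[ℂ] V)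

theorem blockMat_add (p p' : V →L[ℂ] V) (q q' : W →L[ℂ] V) (r r' : V →L[ℂ] W)
    (s s' : W →L[ℂ] W) : blockMat p q r s + blockMat p' q' r' s' =
      blockMat (p + p') (q + q') (r + r') (s + s') := by
  ext x <;> simp

theorem blockMat_sub (p p' : V →L[ℂ] V) (q q' : W →L[ℂ] V) (r r' : V →L[ℂ] W)
    (s s' : W →L[ℂ] W) : blockMat p q r s - blockMat p' q' r' s' =
      blockMat (p - p') (q - q') (r - r') (s - s') := by
  ext x <;> simp

theorem blockMat_neg (p : V →L[ℂ] V) (q : W →L[ℂ] V) (r : V →L[ℂ] W) (s : W →L[ℂ] W) :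
    -blockMat p q r s = blockMat (-p) (-q) (-r) (-s) := by
  ext x <;> simp

theorem blockMat_smul (c : ℂ) (p : V →L[ℂ] V) (q : W →L[ℂ] V) (r : V →L[ℂ] W) (s : W →L[ℂ] W) :
    c • blockMat p q r s = blockMat (c • p) (c • q) (c • r) (c • s) := by
  ext x <;> simp

theorem blockMat_zero : (blockMat 0 0 0 0 : LieG V W) = 0 := by
  ext x <;> simp

theorem blockMat_inj {p p' : V →L[ℂ] V} {q q' : W →L[ℂ] V} {r r' : V →L[ℂ] W}
    {s s' : W →L[ℂ] W} :
    blockMat p q r s = blockMat p' q' r' s' ↔ p = p' ∧ q = q' ∧ r = r' ∧ s = s' := by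
  refine ⟨fun h => ⟨?_, ?_, ?_, ?_⟩, by rintro ⟨rfl, rfl, rfl, rfl⟩; rfl⟩
  · ext v; simpa using congrArg Prod.fst (DFunLike.congr_fun h (v, 0))
  · ext w; simpa using congrArg Prod.fst (DFunLike.congr_fun h (0, w))
  · ext v; simpa using congrArg Prod.snd (DFunLike.congr_fun h (v, 0))
  · ext w; simpa using congrArg Prod.snd (DFunLike.congr_fun h (0, w))

/-- Each block is an inclusion composed with a map through a projection. Cyclicity of the trace
brings projection and inclusion together, where they give the identity or zero. -/
theorem trL_blockMat (p : V →L[ℂ] V) (q : W →L[ℂ] V) (r : V →L[ℂ] W) (s : W →L[ℂ] W) :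
    trL (V × W) (blockMat p q r s) = trL V p + trL W s := by
  have h : blockMat p q r s = ContinuousLinearMap.inl ℂ V W ∘L (p ∘L ContinuousLinearMap.fst ℂ V W)
      + ContinuousLinearMap.inl ℂ V W ∘L (q ∘L ContinuousLinearMap.snd ℂ V W)
      + ContinuousLinearMap.inr ℂ V W ∘L (r ∘L ContinuousLinearMap.fst ℂ V W)
      + ContinuousLinearMap.inr ℂ V W ∘L (s ∘L ContinuousLinearMap.snd ℂ V W) := by
    ext x <;> simp
  rw [h]
  simp only [map_add]
  rw [trL_comp_comm (p ∘L _), trL_comp_comm (q ∘L _), trL_comp_comm (r ∘L _),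
    trL_comp_comm (s ∘L _)]
  have h1 : (p ∘L ContinuousLinearMap.fst ℂ V W) ∘L ContinuousLinearMap.inl ℂ V W = p := by
    ext; simp
  have h2 : (q ∘L ContinuousLinearMap.snd ℂ V W) ∘L ContinuousLinearMap.inl ℂ V W = 0 := by
    ext; simp
  have h3 : (r ∘L ContinuousLinearMap.fst ℂ V W) ∘L ContinuousLinearMap.inr ℂ V W = 0 := by
    ext; simp
  have h4 : (s ∘L ContinuousLinearMap.snd ℂ V W) ∘L ContinuousLinearMap.inr ℂ V W = s := by
    ext; simp
  rw [h1, h2, h3, h4]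
  simp

/-- The grading operator on `V ⊕ W`. -/
noncomputable def grading (V W : Type*) [NormedAddCommGroup V] [NormedSpace ℂ V]
    [NormedAddCommGroup W] [NormedSpace ℂ W] [FiniteDimensional ℂ V] [FiniteDimensional ℂ W] :
    LieG V W := blockMat 1 0 0 (-1)

/-- The supertrace on `End(V ⊕ W)`. -/
noncomputable def superTrace (V W : Type*) [NormedAddCommGroup V] [NormedSpace ℂ V]
    [NormedAddCommGroup W] [NormedSpace ℂ W] [FiniteDimensional ℂ V] [FiniteDimensional ℂ W] :
    LieG V W →+ ℂ :=
  (trL (V × W) : LieG V W →+ ℂ).comp (AddMonoidHom.mulLeft (grading V W))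

theorem superTrace_blockMat (p : V →L[ℂ] V) (q : W →L[ℂ] V) (r : V →L[ℂ] W) (s : W →L[ℂ] W) :
    superTrace V W (blockMat p q r s) = trL V p - trL W s := by
  change trL (V × W) (blockMat 1 0 0 (-1) * blockMat p q r s) = _
  rw [blockMat_mul, trL_blockMat, sub_eq_add_neg, ← map_neg]
  congr 2
  · ext; simp
  · ext; simp

/-- The block diagonal matrix, as a function of the blocks. -/
noncomputable def diagL (X : LieH V W) : LieG V W := blockMat X.1 0 0 X.2

/-- The block off-diagonal matrix, as a linear function of the blocks. -/
noncomputable def offDiag : HomPair V W →ₗ[ℂ] LieG V W where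
  toFun x := blockMat 0 x.1 x.2 0
  map_add' x y := by rw [blockMat_add]; simp
  map_smul' c x := by rw [blockMat_smul]; simp

theorem offDiag_apply (x : HomPair V W) : offDiag x = blockMat 0 x.1 x.2 0 := rfl

/-- Cyclicity of the ordinary trace; the sign arises because the grading operator anticommutes with
block off-diagonal matrices. It commutes with block diagonal ones, whence `superTrace_mul_diagL`. -/
theorem superTrace_mul_offDiag (x : HomPair V W) (Y : LieG V W) :
    superTrace V W (Y * offDiag x) = -superTrace V W (offDiag x * Y) := by
  change trL (V × W) (grading V W * (Y * offDiag x)) = -trL (V × W) (grading V W * (offDiag x * Y))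
  rw [← mul_assoc, trL_mul_comm, ← mul_assoc, ← mul_assoc, ← map_neg, ← neg_mul]
  congr 2
  rw [grading, offDiag_apply, blockMat_mul, blockMat_mul, blockMat_neg, blockMat_inj]
  refine ⟨?_, ?_, ?_, ?_⟩ <;> ext <;> simp

theorem superTrace_mul_diagL (x : LieH V W) (Y : LieG V W) :
    superTrace V W (Y * diagL x) = superTrace V W (diagL x * Y) := by
  change trL (V × W) (grading V W * (Y * diagL x)) = trL (V × W) (grading V W * (diagL x * Y))
  rw [← mul_assoc, trL_mul_comm, ← mul_assoc, ← mul_assoc]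
  congr 2
  rw [grading, diagL, blockMat_mul, blockMat_mul, blockMat_inj]
  refine ⟨?_, ?_, ?_, ?_⟩ <;> ext <;> simp

/-- Testing on the rank-one map g = φ(·)v gives the trace φ(f v), and functionals separate points.
-/
theorem eq_zero_of_trL_comp_eq_zero {f : V →L[ℂ] W} (h : ∀ g : W →L[ℂ] V, trL V (g ∘L f) = 0) :
    f = 0 := by
  ext v
  refine SeparatingDual.eq_zero_of_forall_dual_eq_zero (R := ℂ) fun φ => ?_
  exact (LinearMap.trace_smulRight ((φ ∘L f : V →L[ℂ] ℂ) : V →ₗ[ℂ] ℂ) v).symm.trans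
    (h (φ.smulRight v))

theorem diagL_mul (X Y : LieH V W) : diagL (X * Y) = diagL X * diagL Y := by
  rw [diagL, diagL, diagL, blockMat_mul, blockMat_inj]
  refine ⟨?_, ?_, ?_, ?_⟩ <;> ext <;> simp

theorem diagL_one : diagL (1 : LieH V W) = 1 := blockMat_one

theorem diagL_add (X Y : LieH V W) : diagL (X + Y) = diagL X + diagL Y := by
  rw [diagL, diagL, diagL, blockMat_add, add_zero, add_zero]; rfl

theorem diagL_sub (X Y : LieH V W) : diagL (X - Y) = diagL X - diagL Y := by
  rw [diagL, diagL, diagL, blockMat_sub, sub_zero, sub_zero]; rfl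

theorem diagL_neg (X : LieH V W) : diagL (-X) = -diagL X := by
  rw [diagL, diagL, blockMat_neg, neg_zero, neg_zero]; rfl

theorem diagL_injective : Function.Injective (diagL : LieH V W → LieG V W) := fun X Y h => by
  obtain ⟨h1, -, -, h2⟩ := blockMat_inj.1 h
  exact Prod.ext h1 h2

theorem superTrace_diagL (X : LieH V W) : superTrace V W (diagL X) = trL V X.1 - trL W X.2 :=
  superTrace_blockMat _ _ _ _

theorem kappaH_apply (X Y : LieH V W) : kappaH V W X Y = trL V (X.1 * Y.1) + trL W (X.2 * Y.2) :=
  rfl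

theorem offDiag_mul_offDiag (x y : HomPair V W) :
    offDiag x * offDiag y = diagL (x.1 ∘L y.2, x.2 ∘L y.1) := by
  rw [offDiag_apply, offDiag_apply, diagL, blockMat_mul, blockMat_inj]
  refine ⟨?_, ?_, ?_, ?_⟩ <;> ext <;> simp

theorem diagL_mul_offDiag (X : LieH V W) (x : HomPair V W) :
    diagL X * offDiag x = offDiag (X.1 ∘L x.1, X.2 ∘L x.2) := by
  rw [offDiag_apply, offDiag_apply, diagL, blockMat_mul, blockMat_inj]
  refine ⟨?_, ?_, ?_, ?_⟩ <;> ext <;> simp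

theorem offDiag_mul_diagL (X : LieH V W) (x : HomPair V W) :
    offDiag x * diagL X = offDiag (x.1 ∘L X.2, x.2 ∘L X.1) := by
  rw [offDiag_apply, offDiag_apply, diagL, blockMat_mul, blockMat_inj]
  refine ⟨?_, ?_, ?_, ?_⟩ <;> ext <;> simp

theorem offDiag_injective : Function.Injective (offDiag : HomPair V W → LieG V W) :=
  fun x y h => by
    obtain ⟨-, h1, h2, -⟩ := blockMat_inj.1 h
    exact Prod.ext h1 h2

/-- The supertrace pairing is nondegenerate on block off-diagonal matrices. -/
theorem offDiag_eq_zero_of_superTrace {x : HomPair V W}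
    (h : ∀ y : HomPair V W, superTrace V W (offDiag x * offDiag y) = 0) : x = 0 := by
  have h' : ∀ y : HomPair V W, trL V (x.1 ∘L y.2) - trL W (x.2 ∘L y.1) = 0 := fun y => by
    have := h y
    rwa [offDiag_mul_offDiag, superTrace_diagL] at this
  refine Prod.ext (eq_zero_of_trL_comp_eq_zero fun g => ?_)
    (eq_zero_of_trL_comp_eq_zero fun g => ?_)
  · rw [trL_comp_comm]
    simpa using h' (0, g)
  · rw [trL_comp_comm]
    simpa using h' (g, 0)

end Blocks

/-! ## The quasi-Hamiltonian structure of `ℬ(V, W)` -/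

section VanDenBergh

variable {V W : Type*} [NormedAddCommGroup V] [NormedSpace ℂ V] [FiniteDimensional ℂ V]
  [NormedAddCommGroup W] [NormedSpace ℂ W] [FiniteDimensional ℂ W]

namespace VdB

/-- `(1 + a b, 1 + b a)` as an element of `H`. -/
noncomputable def onePlus (p : VdB V W) : HH V W :=
  MulEquiv.prodUnits.symm (p.onePlusAB, p.onePlusBA)

/-- The opposite exponents on the two factors are the source of the relative sign between V and W,
that is, of the supertrace in `kappaH_cubic`. -/
theorem val_moment (p : VdB V W) :
    (p.moment : LieH V W) = ((↑p.onePlus⁻¹ : LieH V W).1, (p.onePlus : LieH V W).2) := rfl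

theorem val_inv_moment (p : VdB V W) :
    (↑p.moment⁻¹ : LieH V W) = ((p.onePlus : LieH V W).1, (↑p.onePlus⁻¹ : LieH V W).2) := rfl

theorem diagL_onePlus (p : VdB V W) :
    diagL (p.onePlus : LieH V W) = 1 + offDiag p.1 * offDiag p.1 := by
  rw [offDiag_mul_offDiag, ← diagL_one, ← diagL_add]
  rfl

local instance : SMul (HH V W) (VdB V W) := SemigroupAction.toSMul

theorem smul_val (k : HH V W) (p : VdB V W) : (k • p).1 =
    ((k : LieH V W).1 ∘L p.1.1 ∘L (↑k⁻¹ : LieH V W).2,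
      (k : LieH V W).2 ∘L p.1.2 ∘L (↑k⁻¹ : LieH V W).1) := rfl

theorem offDiag_smul (k : HH V W) (p : VdB V W) :
    offDiag (k • p).1 = diagL (k : LieH V W) * offDiag p.1 * diagL (↑k⁻¹ : LieH V W) := by
  rw [diagL_mul_offDiag, offDiag_mul_diagL]
  rfl

theorem onePlus_smul (k : HH V W) (p : VdB V W) : (k • p).onePlus = k * p.onePlus * k⁻¹ := by
  refine Units.ext (diagL_injective ?_)
  have h1 : diagL (k : LieH V W) * diagL (↑k⁻¹ : LieH V W) = 1 := by
    rw [← diagL_mul, k.mul_inv, diagL_one]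
  have h2 : diagL (↑k⁻¹ : LieH V W) * diagL (k : LieH V W) = 1 := by
    rw [← diagL_mul, k.inv_mul, diagL_one]
  rw [Units.val_mul, Units.val_mul, diagL_mul, diagL_mul, diagL_onePlus, diagL_onePlus,
    offDiag_smul, mul_add, add_mul, mul_one, h1]
  congr 1
  calc _ = diagL (k : LieH V W) * offDiag p.1 * (diagL (↑k⁻¹ : LieH V W) * diagL (k : LieH V W)) *
        offDiag p.1 * diagL (↑k⁻¹ : LieH V W) := by simp only [mul_assoc]
    _ = _ := by rw [h2, mul_one]; simp only [mul_assoc]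

theorem moment_smul (k : HH V W) (p : VdB V W) : (k • p).moment = k * p.moment * k⁻¹ := by
  refine Units.ext ?_
  rw [val_moment, onePlus_smul, mul_inv_rev, mul_inv_rev, inv_inv, ← mul_assoc]
  rfl

/-- `((1 + a b)⁻¹, (1 + b a)⁻¹)` as a function on the ambient vector space. -/
noncomputable def resolvent (x : HomPair V W) : LieH V W :=
  (Ring.inverse (1 + x.1 ∘L x.2), Ring.inverse (1 + x.2 ∘L x.1))

theorem resolvent_eq (p : VdB V W) : resolvent p.1 = (↑p.onePlus⁻¹ : LieH V W) :=
  Prod.ext (Ring.inverse_unit p.onePlusAB) (Ring.inverse_unit p.onePlusBA)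

theorem resolvent_mul (p : VdB V W) :
    diagL (resolvent p.1) * (1 + offDiag p.1 * offDiag p.1) = 1 := by
  rw [← diagL_onePlus, ← diagL_mul, resolvent_eq, Units.inv_mul, diagL_one]

theorem mul_resolvent (p : VdB V W) :
    (1 + offDiag p.1 * offDiag p.1) * diagL (resolvent p.1) = 1 := by
  rw [← diagL_onePlus, ← diagL_mul, resolvent_eq, Units.mul_inv, diagL_one]

theorem resolvent_mul_sq (p : VdB V W) :
    diagL (resolvent p.1) * (offDiag p.1 * offDiag p.1) = 1 - diagL (resolvent p.1) := by
  rw [eq_sub_iff_add_eq', ← resolvent_mul p, mul_add, mul_one]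

theorem offDiag_mul_resolvent (p : VdB V W) :
    offDiag p.1 * diagL (resolvent p.1) = diagL (resolvent p.1) * offDiag p.1 := by
  have h : offDiag p.1 * (1 + offDiag p.1 * offDiag p.1) =
      (1 + offDiag p.1 * offDiag p.1) * offDiag p.1 := by noncomm_ring
  calc offDiag p.1 * diagL (resolvent p.1)
      = diagL (resolvent p.1) * ((1 + offDiag p.1 * offDiag p.1) * offDiag p.1) *
          diagL (resolvent p.1) := by rw [← mul_assoc, resolvent_mul, one_mul]
    _ = _ := by rw [← h, mul_assoc, mul_assoc, mul_resolvent, mul_one]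

theorem contDiffAt_resolvent (p : VdB V W) : ContDiffAt ℂ ω resolvent p.1 := by
  have h1 : ContDiff ℂ ω (fun x : HomPair V W => (1 + x.1 ∘L x.2 : V →L[ℂ] V)) :=
    contDiff_const.add (contDiff_fst.clm_comp contDiff_snd)
  have h2 : ContDiff ℂ ω (fun x : HomPair V W => (1 + x.2 ∘L x.1 : W →L[ℂ] W)) :=
    contDiff_const.add (contDiff_snd.clm_comp contDiff_fst)
  exact ContDiffAt.prodMk
    (ContDiffAt.comp (g := Ring.inverse) p.1 (contDiffAt_ringInverse ℂ p.onePlusAB) h1.contDiffAt)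
    (ContDiffAt.comp (g := Ring.inverse) p.1 (contDiffAt_ringInverse ℂ p.onePlusBA) h2.contDiffAt)

/-- The differential of `(1 + a b, 1 + b a)`. -/
noncomputable def dOnePlus (x : HomPair V W) : HomPair V W →ₗ[ℂ] LieH V W where
  toFun u := (u.1 ∘L x.2 + x.1 ∘L u.2, u.2 ∘L x.1 + x.2 ∘L u.1)
  map_add' u v := by
    refine Prod.ext ?_ ?_ <;> ext <;> simp <;> abel
  map_smul' c u := by
    refine Prod.ext ?_ ?_ <;> ext <;> simp

theorem dOnePlus_apply (x u : HomPair V W) :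
    dOnePlus x u = (u.1 ∘L x.2 + x.1 ∘L u.2, u.2 ∘L x.1 + x.2 ∘L u.1) := rfl

theorem diagL_dOnePlus (x u : HomPair V W) :
    diagL (dOnePlus x u) = offDiag u * offDiag x + offDiag x * offDiag u := by
  rw [offDiag_mul_offDiag, offDiag_mul_offDiag, ← diagL_add]
  rfl

theorem hasFDerivAt_onePlus (x : HomPair V W) :
    HasFDerivAt (fun x : HomPair V W => ((1 + x.1 ∘L x.2, 1 + x.2 ∘L x.1) : LieH V W))
      (LinearMap.toContinuousLinearMap (dOnePlus x)) x := by
  have h1 := ((hasFDerivAt_fst (𝕜 := ℂ) (p := x)).clm_comp (hasFDerivAt_snd (p := x))).const_add 1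
  have h2 := ((hasFDerivAt_snd (𝕜 := ℂ) (p := x)).clm_comp (hasFDerivAt_fst (p := x))).const_add 1
  refine (h1.prodMk h2).congr_fderiv ?_
  ext u <;> simp [dOnePlus_apply, add_comm]

theorem hasFDerivAt_resolvent (p : VdB V W) : ∃ f' : HomPair V W →L[ℂ] LieH V W,
    HasFDerivAt resolvent f' p.1 ∧
      ∀ u, f' u = -(resolvent p.1 * dOnePlus p.1 u * resolvent p.1) := by
  have h0 := hasFDerivAt_onePlus p.1
  have h1 := (hasFDerivAt_ringInverse (𝕜 := ℂ) p.onePlus).comp p.1 h0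
  refine ⟨_, h1.congr_of_eventuallyEq ?_, fun u => ?_⟩
  -- The pair of inverses is the inverse of the pair in the product algebra wherever both blocks are
  -- units, which holds near p.
  · filter_upwards [(vdbOpens V W).isOpen.mem_nhds p.2] with x hx
    rw [Function.comp_apply, resolvent_eq ⟨x, hx⟩]
    exact (Ring.inverse_unit (VdB.onePlus ⟨x, hx⟩)).symm
  · rw [resolvent_eq]
    rfl

/-- The two-form of `ℬ(V, W)` as a linear function of `((1 + a b)⁻¹, (1 + b a)⁻¹)`. -/
noncomputable def formL : LieH V W →ₗ[ℂ] (HomPair V W [⋀^Fin 2]→L[ℂ] ℂ) where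
  toFun X := (1 / 2 : ℂ) • (wedgePair (trForm X.1) (.fst ℂ _ _) (.snd ℂ _ _)
    - wedgePair (trForm X.2) (.snd ℂ _ _) (.fst ℂ _ _))
  map_add' X Y := by
    ext v
    change (1 / 2) * (trL V ((X.1 + Y.1) * _) - trL V ((X.1 + Y.1) * _) -
        (trL W ((X.2 + Y.2) * _) - trL W ((X.2 + Y.2) * _))) =
      (1 / 2) * (trL V (X.1 * _) - trL V (X.1 * _) - (trL W (X.2 * _) - trL W (X.2 * _))) +
      (1 / 2) * (trL V (Y.1 * _) - trL V (Y.1 * _) - (trL W (Y.2 * _) - trL W (Y.2 * _)))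
    simp only [add_mul, map_add]
    ring
  map_smul' c X := by
    ext v
    change (1 / 2) * (trL V ((c • X.1) * _) - trL V ((c • X.1) * _) -
        (trL W ((c • X.2) * _) - trL W ((c • X.2) * _))) =
      c * ((1 / 2) * (trL V (X.1 * _) - trL V (X.1 * _) - (trL W (X.2 * _) - trL W (X.2 * _))))
    simp only [smul_mul_assoc, map_smul, smul_eq_mul]
    ring

/-- Products of two off-diagonal matrices are block diagonal with both composites as blocks, so the
difference of traces on V and W is a single supertrace. -/
theorem formL_apply (X : LieH V W) (u v : HomPair V W) : formL X ![u, v] =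
    (1 / 2) * superTrace V W (diagL X * (offDiag u * offDiag v - offDiag v * offDiag u)) := by
  rw [offDiag_mul_offDiag, offDiag_mul_offDiag, ← diagL_sub, ← diagL_mul, superTrace_diagL]
  change (1 / 2) * ((trL V (X.1 * (u.1 ∘L v.2)) - trL V (X.1 * (v.1 ∘L u.2))) -
    (trL W (X.2 * (u.2 ∘L v.1)) - trL W (X.2 * (v.2 ∘L u.1)))) = (1 / 2) *
    (trL V (X.1 * (u.1 ∘L v.2 - v.1 ∘L u.2)) - trL W (X.2 * (u.2 ∘L v.1 - v.2 ∘L u.1)))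
  rw [mul_sub X.1, mul_sub X.2, map_sub, map_sub]

theorem form_eq (p : VdB V W) : VdB.form V W p = formL (resolvent p.1) := by
  have ha : @Eq (HomPair V W →L[ℂ] (W →L[ℂ] V))
      (mfderiv 𝓘(ℂ, HomPair V W) 𝓘(ℂ, W →L[ℂ] V) VdB.a p) (ContinuousLinearMap.fst ℂ _ _) :=
    ((isGlobalChart_opens (vdbOpens V W)).hasMFDerivAt_comp hasFDerivAt_fst).mfderiv
  have hb : @Eq (HomPair V W →L[ℂ] (V →L[ℂ] W))
      (mfderiv 𝓘(ℂ, HomPair V W) 𝓘(ℂ, V →L[ℂ] W) VdB.b p) (ContinuousLinearMap.snd ℂ _ _) :=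
    ((isGlobalChart_opens (vdbOpens V W)).hasMFDerivAt_comp hasFDerivAt_snd).mfderiv
  unfold VdB.form
  dsimp only
  rw [ha, hb, resolvent_eq]
  ext v
  rfl

end VdB

end VanDenBergh

/-! ## The exponential map, the action and invariance -/

section Exponential

variable {A : Type*} [NormedRing A] [NormedAlgebra ℂ A] [CompleteSpace A]

theorem expUnit_zero (X : A) : expUnit ((0 : ℂ) • X) = 1 := by
  let _ : NormedAlgebra ℚ A := NormedAlgebra.restrictScalars ℚ ℂ A
  refine Units.ext ?_
  change NormedSpace.exp ((0 : ℂ) • X) = 1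
  rw [zero_smul, NormedSpace.exp_zero]

theorem hasDerivAt_expUnit (X : A) :
    HasDerivAt (fun t : ℂ => (expUnit (t • X) : A)) X 0 := by
  have h := hasDerivAt_exp_smul_const (𝕂 := ℂ) X 0
  rw [zero_smul, NormedSpace.exp_zero, one_mul] at h
  exact h

theorem hasDerivAt_expUnit_inv (X : A) :
    HasDerivAt (fun t : ℂ => (↑(expUnit (t • X))⁻¹ : A)) (-X) 0 := by
  have h := (hasFDerivAt_ringInverse (𝕜 := ℂ) (expUnit ((0 : ℂ) • X))).comp_hasDerivAt (0 : ℂ)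
    (hasDerivAt_expUnit X)
  rw [expUnit_zero] at h
  refine (h.congr_deriv ?_).congr_of_eventuallyEq (.of_forall fun t => ?_)
  · simp
  · exact (Ring.inverse_unit _).symm

end Exponential

/-! ### Holomorphic maps from and to groups of units -/

section UnitMaps

variable {A : Type*} [NormedRing A] [NormedAlgebra ℂ A] [CompleteSpace A]
  {E E' : Type*} [NormedAddCommGroup E] [NormedSpace ℂ E]
  [NormedAddCommGroup E'] [NormedSpace ℂ E']
  {M : Type*} [TopologicalSpace M] [ChartedSpace E M] {ι : M → E}

/-- The inverse is passed to f as a separate argument, so that conjugation actions come from a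
polynomial f. -/
theorem IsGlobalChart.contMDiff_units_prod (hι : IsGlobalChart ι) {f : A × A × E → E'}
    (hf : ContDiff ℂ ω f) : ContMDiff (𝓘(ℂ, A).prod 𝓘(ℂ, E)) 𝓘(ℂ, E') ω
      (fun p : Aˣ × M => f ((p.1 : A), (↑p.1⁻¹ : A), ι p.2)) := by
  have h1 : ContMDiff (𝓘(ℂ, A).prod 𝓘(ℂ, E)) 𝓘(ℂ, A) ω (fun p : Aˣ × M => (p.1 : A)) :=
    Units.contMDiff_val.comp contMDiff_fst
  have h2 : ContMDiff (𝓘(ℂ, A).prod 𝓘(ℂ, E)) 𝓘(ℂ, A) ω (fun p : Aˣ × M => (↑p.1⁻¹ : A)) :=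
    Units.contMDiff_val.comp ((contMDiff_inv 𝓘(ℂ, A) ω).comp contMDiff_fst)
  have h3 : ContMDiff (𝓘(ℂ, A).prod 𝓘(ℂ, E)) 𝓘(ℂ, E) ω (fun p : Aˣ × M => ι p.2) :=
    hι.contMDiff.comp contMDiff_snd
  exact hf.contMDiff.comp (h1.prodMk_space (h2.prodMk_space h3))

theorem IsGlobalChart.contMDiff_units (hι : IsGlobalChart ι) {μ : M → Aˣ} {f : E → A}
    (h : ∀ m, (μ m : A) = f (ι m)) (hf : ∀ m, ContDiffAt ℂ ω f (ι m)) :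
    ContMDiff 𝓘(ℂ, E) 𝓘(ℂ, A) ω μ := by
  refine isGlobalChart_units.contMDiff_of_comp fun m => ?_
  rw [show Units.val ∘ μ = fun m => f (ι m) from funext h]
  exact hι.contMDiffAt_comp (hf m)

end UnitMaps

/-! ### Action, moment map and two-form for a space charted by ℬ(V, W) -/

namespace VdB

section

variable {V W : Type*} [NormedAddCommGroup V] [NormedSpace ℂ V] [FiniteDimensional ℂ V]
  [NormedAddCommGroup W] [NormedSpace ℂ W] [FiniteDimensional ℂ W]
  {M : Type*} [TopologicalSpace M] [ChartedSpace (HomPair V W) M] [MulAction (HH V W) M]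
  {j : M → VdB V W}

variable (V W) in
/-- `formL` as a continuous linear map. -/
noncomputable def formCL : LieH V W →L[ℂ] (HomPair V W [⋀^Fin 2]→L[ℂ] ℂ) :=
  LinearMap.toContinuousLinearMap (formL (V := V) (W := W))

theorem contDiff_formCL : ContDiff ℂ ω (fun X : LieH V W => formCL V W X) :=
  ContinuousLinearMap.contDiff (𝕜 := ℂ) (n := ω) (E := LieH V W)
    (F := HomPair V W [⋀^Fin 2]→L[ℂ] ℂ) (formCL V W)

local instance : SMul (HH V W) (VdB V W) := SemigroupAction.toSMul

theorem contMDiff_smul (hι : IsGlobalChart (fun m => (j m).1))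
    (hj : ∀ (k : HH V W) m, j (k • m) = k • j m) :
    ContMDiff (𝓘(ℂ, LieH V W).prod 𝓘(ℂ, HomPair V W)) 𝓘(ℂ, HomPair V W) ω
      (fun p : HH V W × M => p.1 • p.2) := by
  refine hι.contMDiff_of_comp ?_
  have hF : ContDiff ℂ ω (fun q : LieH V W × LieH V W × HomPair V W =>
      ((q.1.1 ∘L q.2.2.1 ∘L q.2.1.2, q.1.2 ∘L q.2.2.2 ∘L q.2.1.1) : HomPair V W)) :=
    (contDiff_fst.fst.clm_comp (contDiff_snd.snd.fst.clm_comp contDiff_snd.fst.snd)).prodMk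
      (contDiff_fst.snd.clm_comp (contDiff_snd.snd.snd.clm_comp contDiff_snd.fst.fst))
  have e : (fun m => (j m).1) ∘ (fun p : HH V W × M => p.1 • p.2) = fun p =>
      (((p.1 : LieH V W).1 ∘L (j p.2).1.1 ∘L ((p.1⁻¹ : HH V W) : LieH V W).2,
        (p.1 : LieH V W).2 ∘L (j p.2).1.2 ∘L ((p.1⁻¹ : HH V W) : LieH V W).1) : HomPair V W) := by
    funext p
    rw [Function.comp_apply, hj, smul_val]
  rw [e]
  exact hι.contMDiff_units_prod (A := LieH V W) (f := fun q => ((q.1.1 ∘L q.2.2.1 ∘L q.2.1.2,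
    q.1.2 ∘L q.2.2.2 ∘L q.2.1.1) : HomPair V W)) hF

theorem contMDiff_moment (hι : IsGlobalChart (fun m => (j m).1)) :
    ContMDiff 𝓘(ℂ, HomPair V W) 𝓘(ℂ, LieH V W) ω (fun m => (j m).moment) := by
  have h1 : ContDiff ℂ ω (fun x : HomPair V W => (1 + x.2 ∘L x.1 : W →L[ℂ] W)) :=
    contDiff_const.add (contDiff_snd.clm_comp contDiff_fst)
  refine hι.contMDiff_units (f := fun x => ((resolvent x).1, 1 + x.2 ∘L x.1)) (fun m => ?_)
    fun m => (contDiffAt_resolvent (j m)).fst.prodMk h1.contDiffAt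
  rw [val_moment, resolvent_eq]
  rfl

theorem isHolomorphicForm (hι : IsGlobalChart (fun m => (j m).1)) :
    IsHolomorphicForm (fun m => VdB.form V W (j m) : TwoForm (HomPair V W) M) :=
  hι.isHolomorphicForm (Ω' := fun x => formCL V W (resolvent x)) (fun m => form_eq (j m)) fun m =>
    contDiff_formCL.contDiffAt.comp _ (contDiffAt_resolvent (j m))

theorem hasMFDerivAt_smul (hι : IsGlobalChart (fun m => (j m).1))
    (hj : ∀ (k : HH V W) m, j (k • m) = k • j m) (k : HH V W) (m : M) :
    ∃ f' : HomPair V W →L[ℂ] HomPair V W,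
      HasMFDerivAt 𝓘(ℂ, HomPair V W) 𝓘(ℂ, HomPair V W) (fun m : M => k • m) m f' ∧
      ∀ u, offDiag (f' u) = diagL (k : LieH V W) * offDiag u * diagL (↑k⁻¹ : LieH V W) := by
  let f' : HomPair V W →ₗ[ℂ] HomPair V W :=
    { toFun := fun u => ((k : LieH V W).1 ∘L u.1 ∘L (↑k⁻¹ : LieH V W).2,
        (k : LieH V W).2 ∘L u.2 ∘L (↑k⁻¹ : LieH V W).1)
      map_add' := fun u v => by refine Prod.ext ?_ ?_ <;> ext <;> simp
      map_smul' := fun c u => by refine Prod.ext ?_ ?_ <;> ext <;> simp }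
  refine ⟨LinearMap.toContinuousLinearMap f', hι.hasMFDerivAt_of_comp ?_, fun u => ?_⟩
  · have e : (fun m : M => (j (k • m)).1) =
        fun m => LinearMap.toContinuousLinearMap f' (j m).1 := by
      funext m
      rw [hj]
      rfl
    rw [e]
    exact hι.hasMFDerivAt_comp (LinearMap.toContinuousLinearMap f').hasFDerivAt
  · rw [diagL_mul_offDiag, offDiag_mul_diagL]
    rfl

/-- All factors of the supertrace are conjugated by the same block diagonal element, which is even
and so cancels by cyclicity. -/
theorem form_smul (k : HH V W) (p : VdB V W) {f' : HomPair V W →L[ℂ] HomPair V W}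
    (hf' : ∀ u, offDiag (f' u) = diagL (k : LieH V W) * offDiag u * diagL (↑k⁻¹ : LieH V W))
    (u v : HomPair V W) :
    (VdB.form V W (k • p)) ![f' u, f' v] = VdB.form V W p ![u, v] := by
  have h2 : ∀ Y, diagL (↑k⁻¹ : LieH V W) * (diagL (k : LieH V W) * Y) = Y := fun Y => by
    rw [← mul_assoc, ← diagL_mul, k.inv_mul, diagL_one, one_mul]
  rw [form_eq, form_eq, formL_apply, formL_apply, hf', hf', resolvent_eq, resolvent_eq,
    onePlus_smul, mul_inv_rev, mul_inv_rev, inv_inv, Units.val_mul, Units.val_mul, diagL_mul,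
    diagL_mul]
  congr 1
  simp only [mul_assoc, h2, ← mul_sub]
  rw [← superTrace_mul_diagL]
  simp only [sub_mul, mul_sub, mul_assoc]
  simp only [← diagL_mul, k.inv_mul, diagL_one, mul_one]

theorem form_invariant (hι : IsGlobalChart (fun m => (j m).1))
    (hj : ∀ (k : HH V W) m, j (k • m) = k • j m) (k : HH V W) :
    pullbackForm (fun m : M => k • m) (fun m => VdB.form V W (j m) : TwoForm (HomPair V W) M) =
      fun m => VdB.form V W (j m) := by
  funext m
  obtain ⟨f', hf, hf'⟩ := hasMFDerivAt_smul hι hj k m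
  unfold pullbackForm
  rw [hf.mfderiv]
  refine twoForm_ext fun u v => ?_
  rw [compContinuousLinearMap_pair]
  change VdB.form V W (j (k • m)) _ = _
  rw [hj]
  exact form_smul k (j m) hf' u v

end

end VdB

/-! ### Fundamental vector fields and the differential of the moment map -/

namespace VdB
section

variable {V W : Type*} [NormedAddCommGroup V] [NormedSpace ℂ V] [FiniteDimensional ℂ V]
  [NormedAddCommGroup W] [NormedSpace ℂ W] [FiniteDimensional ℂ W]
  {M : Type*} [TopologicalSpace M] [ChartedSpace (HomPair V W) M] [MulAction (HH V W) M]
  {j : M → VdB V W}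

local instance : SMul (HH V W) (VdB V W) := SemigroupAction.toSMul

theorem hasDerivAt_expUnit_smul (X : LieH V W) (p : VdB V W) :
    HasDerivAt (fun t : ℂ => (expUnit (t • X) • p).1)
      ((X.1 ∘L p.1.1 - p.1.1 ∘L X.2, X.2 ∘L p.1.2 - p.1.2 ∘L X.1) : HomPair V W) 0 := by
  have h1 := hasDerivAt_expUnit X
  have h2 := hasDerivAt_expUnit_inv X
  have h1f : HasDerivAt (fun t : ℂ => (expUnit (t • X) : LieH V W).1) X.1 0 := by
    simpa using h1.hasFDerivAt.fst.hasDerivAt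
  have h1s : HasDerivAt (fun t : ℂ => (expUnit (t • X) : LieH V W).2) X.2 0 := by
    simpa using h1.hasFDerivAt.snd.hasDerivAt
  have h2f : HasDerivAt (fun t : ℂ => (((expUnit (t • X))⁻¹ : HH V W) : LieH V W).1) (-X).1 0 := by
    simpa using h2.hasFDerivAt.fst.hasDerivAt
  have h2s : HasDerivAt (fun t : ℂ => (((expUnit (t • X))⁻¹ : HH V W) : LieH V W).2) (-X).2 0 := by
    simpa using h2.hasFDerivAt.snd.hasDerivAt
  have ha := h1f.clm_comp ((hasDerivAt_const (0 : ℂ) p.1.1).clm_comp h2s)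
  have hb := h1s.clm_comp ((hasDerivAt_const (0 : ℂ) p.1.2).clm_comp h2f)
  refine (ha.prodMk hb).congr_deriv ?_
  rw [expUnit_zero]
  refine Prod.ext ?_ ?_ <;> ext <;> simp [sub_eq_add_neg]

/-- H acts on X by conjugation, so the infinitesimal action is a commutator; the sign is that of the
convention for v_X. -/
theorem offDiag_fundVec (hι : IsGlobalChart (fun m => (j m).1))
    (hj : ∀ (k : HH V W) m, j (k • m) = k • j m) (X : LieH V W) (m : M) :
    offDiag (fundVec (HomPair V W) X m) =
      -(diagL X * offDiag (j m).1 - offDiag (j m).1 * diagL X) := by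
  have h := (hasDerivAt_expUnit_smul X (j m)).hasFDerivAt
  have h' := hι.hasMFDerivAt_of_comp (f := fun t : ℂ => expUnit (t • X) • m) (l := (0 : ℂ))
    (I := 𝓘(ℂ, ℂ)) (by
      rw [show (fun t : ℂ => (j (expUnit (t • X) • m)).1) = fun t => (expUnit (t • X) • j m).1 from
        funext fun t => by rw [hj]]
      exact h.hasMFDerivAt)
  have e : fundVec (HomPair V W) X m = -((X.1 ∘L (j m).1.1 - (j m).1.1 ∘L X.2,
      X.2 ∘L (j m).1.2 - (j m).1.2 ∘L X.1) : HomPair V W) := by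
    unfold fundVec
    rw [h'.mfderiv]
    exact congrArg Neg.neg (one_smul ℂ _)
  rw [e, map_neg, diagL_mul_offDiag, offDiag_mul_diagL, ← map_sub]
  rfl

theorem tangentMapAt_moment (hι : IsGlobalChart (fun m => (j m).1)) (m : M) (u : HomPair V W) :
    tangentMapAt (fun x => ((j x).moment : LieH V W)) m u =
      (-(resolvent (j m).1 * dOnePlus (j m).1 u * resolvent (j m).1).1,
        (dOnePlus (j m).1 u).2) := by
  obtain ⟨f', hf, hf'⟩ := hasFDerivAt_resolvent (j m)
  have h := hι.hasMFDerivAt_comp (hf.fst.prodMk (hasFDerivAt_onePlus (j m).1).snd)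
  have e : (fun x => ((j x).moment : LieH V W)) = fun x =>
      (((resolvent (j x).1).1, 1 + (j x).1.2 ∘L (j x).1.1) : LieH V W) := by
    funext x
    rw [val_moment, resolvent_eq]
    rfl
  rw [e, tangentMapAt_eq h]
  refine Prod.ext ?_ rfl
  have h1 := congrArg Prod.fst (hf' u)
  exact h1

end
end VdB

section

variable {V W : Type*} [NormedAddCommGroup V] [NormedSpace ℂ V] [FiniteDimensional ℂ V]
  [NormedAddCommGroup W] [NormedSpace ℂ W] [FiniteDimensional ℂ W]

theorem lieG_neg_mul (x y : LieG V W) : -x * y = -(x * y) := neg_mul x y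

theorem lieG_mul_neg (x y : LieG V W) : x * -y = -(x * y) := mul_neg x y

theorem lieG_neg_sub_neg (x y : LieG V W) : -x - -y = -(x - y) :=
  (neg_sub_neg x y).trans (neg_sub x y).symm

theorem superTrace_neg (x : LieG V W) : superTrace V W (-x) = -superTrace V W x := map_neg _ x

end

/-! ### The three quasi-Hamiltonian axioms for ℬ(V, W) -/

namespace VdB
section

variable {V W : Type*} [NormedAddCommGroup V] [NormedSpace ℂ V] [FiniteDimensional ℂ V]
  [NormedAddCommGroup W] [NormedSpace ℂ W] [FiniteDimensional ℂ W]
  {M : Type*} [TopologicalSpace M] [ChartedSpace (HomPair V W) M] [MulAction (HH V W) M]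
  {j : M → VdB V W}

local instance : SMul (HH V W) (VdB V W) := SemigroupAction.toSMul

/-- Write P = (1 + ab, 1 + ba). On W the form is P⁻¹dP; on V the moment map is P⁻¹, and inversion
turns the left Maurer-Cartan form into minus the right one, -(dP)P⁻¹. In `rightMC_moment` the two
orders are exchanged. -/
theorem leftMC_moment (hι : IsGlobalChart (fun m => (j m).1)) (m : M) (u : HomPair V W) :
    leftMC (fun x => (j x).moment) m u =
      (-(dOnePlus (j m).1 u * resolvent (j m).1).1,
        (resolvent (j m).1 * dOnePlus (j m).1 u).2) := by
  rw [leftMC_apply, tangentMapAt_moment hι, val_inv_moment, resolvent_eq]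
  have h : ((j m).onePlus : LieH V W) * -((↑(j m).onePlus⁻¹ : LieH V W) * dOnePlus (j m).1 u *
      (↑(j m).onePlus⁻¹ : LieH V W)) = -(dOnePlus (j m).1 u * (↑(j m).onePlus⁻¹ : LieH V W)) := by
    rw [mul_neg, mul_assoc, Units.mul_inv_cancel_left]
  have h' := congrArg Prod.fst h
  exact Prod.ext h' rfl

theorem rightMC_moment (hι : IsGlobalChart (fun m => (j m).1)) (m : M) (u : HomPair V W) :
    rightMC (fun x => (j x).moment) m u =
      (-(resolvent (j m).1 * dOnePlus (j m).1 u).1,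
        (dOnePlus (j m).1 u * resolvent (j m).1).2) := by
  rw [rightMC_apply, tangentMapAt_moment hι, val_inv_moment, resolvent_eq]
  have h : -((↑(j m).onePlus⁻¹ : LieH V W) * dOnePlus (j m).1 u *
      (↑(j m).onePlus⁻¹ : LieH V W)) * ((j m).onePlus : LieH V W) =
        -((↑(j m).onePlus⁻¹ : LieH V W) * dOnePlus (j m).1 u) := by
    rw [neg_mul, Units.inv_mul_cancel_right]
  have h' := congrArg Prod.fst h
  exact Prod.ext h' rfl

/-- The cubic form on `H` evaluated on the Maurer-Cartan form of the moment map. -/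
theorem kappaH_cubic (R D D' D'' : LieH V W) :
    kappaH V W (-(D * R).1, (R * D).2)
      ⁅((-(D' * R).1, (R * D').2) : LieH V W), ((-(D'' * R).1, (R * D'').2) : LieH V W)⁆ =
    superTrace V W (diagL D * diagL R * (diagL D'' * diagL R) * (diagL D' * diagL R))
      - superTrace V W (diagL D * diagL R * (diagL D' * diagL R) * (diagL D'' * diagL R)) := by
  simp only [← diagL_mul, superTrace_diagL]
  rw [Ring.lie_def, kappaH_apply]
  -- On W the words are in R D rather than D R, which cyclicity repairs. On V the three minus signs
  -- leave one, the relative sign of the supertrace.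
  have h1 : ∀ a b c r : W →L[ℂ] W, trL W (a * r * (b * r) * (c * r)) =
      trL W (r * a * (r * b * (r * c))) := fun a b c r => by
    rw [← mul_assoc, trL_mul_comm]; simp only [mul_assoc]
  change trL V (-(D.1 * R.1) * (-(D'.1 * R.1) * -(D''.1 * R.1) - -(D''.1 * R.1) * -(D'.1 * R.1))) +
    trL W (R.2 * D.2 * (R.2 * D'.2 * (R.2 * D''.2) - R.2 * D''.2 * (R.2 * D'.2))) =
    trL V (D.1 * R.1 * (D''.1 * R.1) * (D'.1 * R.1)) -
      trL W (D.2 * R.2 * (D''.2 * R.2) * (D'.2 * R.2)) -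
    (trL V (D.1 * R.1 * (D'.1 * R.1) * (D''.1 * R.1)) -
      trL W (D.2 * R.2 * (D'.2 * R.2) * (D''.2 * R.2)))
  rw [h1, h1, mul_sub, mul_sub, map_sub, map_sub]
  simp only [neg_mul, mul_neg, neg_neg, map_neg, mul_assoc]
  ring

theorem superTrace_cyclic (X Y Z : LieH V W) :
    superTrace V W (diagL X * diagL Y * diagL Z) = superTrace V W (diagL Z * diagL X * diagL Y) := by
  rw [superTrace_mul_diagL, ← mul_assoc]

/-- The form depends linearly on R, and R has derivative -R D R. Exchanging the arguments u and w in
the middle term of the alternating sum absorbs its sign and leaves a cyclic sum. -/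
theorem extDeriv_formCL_resolvent (p : VdB V W) (u v w : HomPair V W) :
    extDeriv (fun x => formCL V W (resolvent x)) p.1 ![u, v, w] =
      -(1 / 2) * (superTrace V W (diagL (resolvent p.1) * diagL (dOnePlus p.1 u) *
          diagL (resolvent p.1) * (offDiag v * offDiag w - offDiag w * offDiag v)) +
        superTrace V W (diagL (resolvent p.1) * diagL (dOnePlus p.1 v) *
          diagL (resolvent p.1) * (offDiag w * offDiag u - offDiag u * offDiag w)) +
        superTrace V W (diagL (resolvent p.1) * diagL (dOnePlus p.1 w) *
          diagL (resolvent p.1) * (offDiag u * offDiag v - offDiag v * offDiag u))) := by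
  obtain ⟨f', hf, hf'⟩ := hasFDerivAt_resolvent p
  have h : HasFDerivAt (fun x => formCL V W (resolvent x)) ((formCL V W).comp f') p.1 :=
    HasFDerivAt.comp (g := formCL V W) p.1 (formCL V W).hasFDerivAt hf
  have h2 : ∀ a b c : HomPair V W, ((formCL V W).comp f') a ![b, c] =
      -(1 / 2) * superTrace V W (diagL (resolvent p.1) * diagL (dOnePlus p.1 a) *
          diagL (resolvent p.1) * (offDiag b * offDiag c - offDiag c * offDiag b)) := by
    intro a b c
    change formL (f' a) ![b, c] = _
    rw [formL_apply, hf', diagL_neg, diagL_mul, diagL_mul, lieG_neg_mul, superTrace_neg]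
    ring
  unfold extDeriv
  rw [h.fderiv, ContinuousAlternatingMap.alternatizeUncurryFin_apply, Fin.sum_univ_three]
  have r0 : Fin.removeNth 0 ![u, v, w] = ![v, w] := by ext i <;> fin_cases i <;> rfl
  have r1 : Fin.removeNth 1 ![u, v, w] = ![u, w] := by ext i <;> fin_cases i <;> rfl
  have r2 : Fin.removeNth 2 ![u, v, w] = ![u, v] := by ext i <;> fin_cases i <;> rfl
  rw [r0, r1, r2]
  change (-1 : ℤ) ^ 0 • ((formCL V W).comp f') u ![v, w] +
    (-1 : ℤ) ^ 1 • ((formCL V W).comp f') v ![u, w] +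
    (-1 : ℤ) ^ 2 • ((formCL V W).comp f') w ![u, v] = _
  have h3 : offDiag u * offDiag w - offDiag w * offDiag u =
      -(offDiag w * offDiag u - offDiag u * offDiag w) := (neg_sub _ _).symm
  rw [h2, h2, h2, h3, lieG_mul_neg, superTrace_neg]
  simp only [pow_zero, pow_one, one_smul, neg_smul, neg_one_sq]
  ring

theorem dForm_form (hι : IsGlobalChart (fun m => (j m).1)) (m : M) (u v w : HomPair V W) :
    dForm (fun m => VdB.form V W (j m) : TwoForm (HomPair V W) M) m ![u, v, w] =
    (1 / 6) * (kappaH V W (leftMC (fun x => (j x).moment) m u)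
        ⁅leftMC (fun x => (j x).moment) m v, leftMC (fun x => (j x).moment) m w⁆
      + kappaH V W (leftMC (fun x => (j x).moment) m v)
        ⁅leftMC (fun x => (j x).moment) m w, leftMC (fun x => (j x).moment) m u⁆
      + kappaH V W (leftMC (fun x => (j x).moment) m w)
        ⁅leftMC (fun x => (j x).moment) m u, leftMC (fun x => (j x).moment) m v⁆) := by
  rw [hι.dForm_apply (Ω' := fun x => formCL V W (resolvent x)) (fun m => form_eq (j m)),
    extDeriv_formCL_resolvent, leftMC_moment hι, leftMC_moment hι, leftMC_moment hι,
    kappaH_cubic, kappaH_cubic, kappaH_cubic]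
  have c : ∀ a b c : LieH V W, superTrace V W (diagL a * diagL (resolvent (j m).1) *
      (diagL b * diagL (resolvent (j m).1)) * (diagL c * diagL (resolvent (j m).1))) =
      superTrace V W (diagL c * diagL (resolvent (j m).1) *
      (diagL a * diagL (resolvent (j m).1)) * (diagL b * diagL (resolvent (j m).1))) := by
    intro a b c
    simp only [← diagL_mul _ (resolvent _)]
    exact superTrace_cyclic _ _ _
  have h := superTrace_cubic (s := superTrace V W) (X := offDiag (j m).1)
    (R := diagL (resolvent (j m).1)) (superTrace_mul_offDiag _) (superTrace_mul_diagL _)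
    (offDiag_mul_resolvent _) (resolvent_mul_sq _) (superTrace_mul_offDiag u)
    (superTrace_mul_offDiag v) (superTrace_mul_offDiag w)
  simp only [← diagL_dOnePlus] at h
  rw [h]
  have c1 := c (dOnePlus (j m).1 u) (dOnePlus (j m).1 v) (dOnePlus (j m).1 w)
  have c2 := c (dOnePlus (j m).1 w) (dOnePlus (j m).1 u) (dOnePlus (j m).1 v)
  have c3 := c (dOnePlus (j m).1 u) (dOnePlus (j m).1 w) (dOnePlus (j m).1 v)
  have c4 := c (dOnePlus (j m).1 v) (dOnePlus (j m).1 u) (dOnePlus (j m).1 w)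
  -- By cyclicity the three cubic terms are equal, so one sixth of their sum matches the factor ½ of
  -- the exterior derivative; the coefficients rotate all words to common ones.
  linear_combination -(1 / 3) * c1 - (1 / 6) * c2 + (1 / 3) * c3 + (1 / 6) * c4

theorem form_fundVec (hι : IsGlobalChart (fun m => (j m).1))
    (hj : ∀ (k : HH V W) m, j (k • m) = k • j m) (X : LieH V W) (m : M) (u : HomPair V W) :
    VdB.form V W (j m) ![fundVec (HomPair V W) X m, u] =
    (1 / 2) * kappaH V W (leftMC (fun x => (j x).moment) m u
      + rightMC (fun x => (j x).moment) m u) X := by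
  have h := superTrace_moment (s := superTrace V W) (X := offDiag (j m).1)
    (R := diagL (resolvent (j m).1)) (superTrace_mul_offDiag _) (offDiag_mul_resolvent _)
    (ξ := diagL X) (superTrace_mul_offDiag u)
  rw [← diagL_dOnePlus, ← diagL_mul, ← diagL_mul, ← diagL_add, ← diagL_mul, superTrace_diagL] at h
  have h' : diagL (resolvent (j m).1) * (-(diagL X * offDiag (j m).1 - offDiag (j m).1 * diagL X) *
      offDiag u - offDiag u * -(diagL X * offDiag (j m).1 - offDiag (j m).1 * diagL X)) =
      -(diagL (resolvent (j m).1) * ((diagL X * offDiag (j m).1 - offDiag (j m).1 * diagL X) *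
      offDiag u - offDiag u * (diagL X * offDiag (j m).1 - offDiag (j m).1 * diagL X))) := by
    rw [lieG_neg_mul, lieG_mul_neg, lieG_neg_sub_neg, lieG_mul_neg]
  rw [form_eq, formL_apply, offDiag_fundVec hι hj, leftMC_moment hι, rightMC_moment hι, h',
    superTrace_neg, h, kappaH_apply]
  change 1 / 2 * -(trL V ((dOnePlus (j m).1 u * resolvent (j m).1 +
      resolvent (j m).1 * dOnePlus (j m).1 u).1 * X.1) -
    trL W (((dOnePlus (j m).1 u * resolvent (j m).1).2 +
      (resolvent (j m).1 * dOnePlus (j m).1 u).2) * X.2)) =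
    1 / 2 * (trL V ((-(dOnePlus (j m).1 u * resolvent (j m).1).1 +
      -(resolvent (j m).1 * dOnePlus (j m).1 u).1) * X.1) +
    trL W (((resolvent (j m).1 * dOnePlus (j m).1 u).2 +
      (dOnePlus (j m).1 u * resolvent (j m).1).2) * X.2))
  rw [← neg_add, neg_mul, map_neg, add_comm (dOnePlus (j m).1 u * resolvent (j m).1).2]
  change 1 / 2 * -(trL V (((dOnePlus (j m).1 u * resolvent (j m).1).1 +
      (resolvent (j m).1 * dOnePlus (j m).1 u).1) * X.1) - _) = _
  ring

/-- The differential of the moment map vanishes on u exactly when uX + Xu = 0. By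
`superTrace_kernel` the form then becomes a multiple of str(R u v), which is nondegenerate in v;
hence R u = 0, and R is invertible. -/
theorem eq_zero_of_mem_ker (hι : IsGlobalChart (fun m => (j m).1)) (m : M) (u : HomPair V W)
    (h : ∀ v, VdB.form V W (j m) ![u, v] = 0)
    (hu : tangentMapAt (E := HomPair V W) (E' := LieH V W) (fun x => ((j x).moment : LieH V W)) m u
      = 0) : u = 0 := by
  rw [tangentMapAt_moment hι] at hu
  have h2 : (dOnePlus (j m).1 u).2 = 0 := congrArg Prod.snd hu
  have h1 : (dOnePlus (j m).1 u).1 = 0 := by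
    have h3 : (resolvent (j m).1 * dOnePlus (j m).1 u * resolvent (j m).1).1 = 0 :=
      neg_eq_zero.1 (congrArg Prod.fst hu)
    have h4 : ((j m).onePlus : LieH V W) * (resolvent (j m).1 * dOnePlus (j m).1 u *
        resolvent (j m).1) * ((j m).onePlus : LieH V W) = dOnePlus (j m).1 u := by
      rw [resolvent_eq, mul_assoc (↑(j m).onePlus⁻¹ : LieH V W), Units.mul_inv_cancel_left,
        Units.inv_mul_cancel_right]
    rw [← h4]
    change ((j m).onePlus : LieH V W).1 * (resolvent (j m).1 * dOnePlus (j m).1 u *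
        resolvent (j m).1).1 * ((j m).onePlus : LieH V W).1 = 0
    rw [h3, mul_zero, zero_mul]
  have hD : dOnePlus (j m).1 u = 0 := Prod.ext h1 h2
  have hX : offDiag u * offDiag (j m).1 + offDiag (j m).1 * offDiag u = 0 := by
    rw [← diagL_dOnePlus, hD]
    exact blockMat_zero
  have h5 : ∀ v : HomPair V W,
      superTrace V W (diagL (resolvent (j m).1) * offDiag u * offDiag v) = 0 := by
    intro v
    have h6 := h v
    rw [form_eq, formL_apply] at h6
    have h7 := superTrace_kernel (s := superTrace V W) (resolvent_mul (j m)) (mul_resolvent (j m))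
      hX (superTrace_mul_offDiag u) (y := offDiag v) (by simpa using h6)
    simpa using h7
  have h8 : ((resolvent (j m).1).1 ∘L u.1, (resolvent (j m).1).2 ∘L u.2) = (0 : HomPair V W) :=
    offDiag_eq_zero_of_superTrace fun v => by
      rw [← diagL_mul_offDiag]
      exact h5 v
  have h9 : diagL (resolvent (j m).1) * offDiag u = 0 := by
    rw [diagL_mul_offDiag, h8, map_zero]
  apply offDiag_injective
  rw [map_zero, ← one_mul (offDiag u), ← mul_resolvent (j m), mul_assoc, h9, mul_zero]

/-- The map j serves two cases: the identity of ℬ(V, W), and the homeomorphism from the reduced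
space. -/
theorem isQuasiHamiltonian [IsManifold 𝓘(ℂ, HomPair V W) ω M]
    (hι : IsGlobalChart (fun m => (j m).1)) (hj : ∀ (k : HH V W) m, j (k • m) = k • j m) :
    IsQuasiHamiltonian (kappaH V W) (fun m => (j m).moment)
      (fun m => VdB.form V W (j m) : TwoForm (HomPair V W) M) where
  t2 := hι.isOpenEmbedding.isEmbedding.t2Space
  secondCountable := by
    have := FiniteDimensional.proper ℂ (HomPair V W)
    exact hι.isOpenEmbedding.isEmbedding.secondCountableTopology
  isManifold := inferInstance
  action_holomorphic := contMDiff_smul hι hj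
  moment_holomorphic := contMDiff_moment hι
  moment_equivariant k m := by rw [hj, moment_smul]
  form_holomorphic := isHolomorphicForm hι
  form_invariant := form_invariant hι hj
  qh1 := dForm_form hι
  qh2 := form_fundVec hι hj
  qh3 m u h hu := eq_zero_of_mem_ker hι m u h <| by
    -- The chart of the group of units is the inclusion in the algebra, so the differential of the
    -- moment map is that of its algebra-valued version.
    have hd := (contMDiff_moment hι m).mdifferentiableAt (by simp)
    have h' := isGlobalChart_units.hasMFDerivAt_of_comp (f := fun x => (j x).moment)
      ((isGlobalChart_units.contMDiff _).mdifferentiableAt (by simp) |>.comp m hd).hasMFDerivAt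
    exact (DFunLike.congr_fun h'.mfderiv u).symm.trans hu

end
end VdB

/-! ## The level set and the reduced space -/

section Level

variable {V W : Type*} [NormedAddCommGroup V] [NormedSpace ℂ V] [FiniteDimensional ℂ V]
  [NormedAddCommGroup W] [NormedSpace ℂ W] [FiniteDimensional ℂ W]

theorem upperUnit_upperEntry (S : UPlus V W) : upperUnit V W (upperEntry S.1) = S.1 :=
  congrArg Subtype.val ((upperHomeo V W).symm_apply_apply S)

theorem lowerUnit_lowerEntry (S : UMinus V W) : lowerUnit V W (lowerEntry S.1) = S.1 :=
  congrArg Subtype.val ((lowerHomeo V W).symm_apply_apply S)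

theorem upperEntry_upperUnit (x : W →L[ℂ] V) : upperEntry (upperUnit V W x) = x :=
  (upperHomeo V W).apply_symm_apply x

theorem lowerEntry_lowerUnit (x : V →L[ℂ] W) : lowerEntry (lowerUnit V W x) = x :=
  (lowerHomeo V W).apply_symm_apply x

theorem val_blockDiag (k : HH V W) : (blockDiag V W k : LieG V W) = diagL (k : LieH V W) := rfl

theorem upperEntry_conj (k : HH V W) (g : GG V W) :
    upperEntry (blockDiag V W k * g * (blockDiag V W k)⁻¹) =
      (k : LieH V W).1 ∘L upperEntry g ∘L (↑k⁻¹ : LieH V W).2 := by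
  have h : ((blockDiag V W k * g * (blockDiag V W k)⁻¹ : GG V W) : LieG V W) =
      diagL (k : LieH V W) * (g : LieG V W) * diagL (↑k⁻¹ : LieH V W) := rfl
  unfold upperEntry
  rw [h]
  ext w
  simp [diagL]

theorem lowerEntry_conj (k : HH V W) (g : GG V W) :
    lowerEntry (blockDiag V W k * g * (blockDiag V W k)⁻¹) =
      (k : LieH V W).2 ∘L lowerEntry g ∘L (↑k⁻¹ : LieH V W).1 := by
  have h : ((blockDiag V W k * g * (blockDiag V W k)⁻¹ : GG V W) : LieG V W) =
      diagL (k : LieH V W) * (g : LieG V W) * diagL (↑k⁻¹ : LieH V W) := rfl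
  unfold lowerEntry
  rw [h]
  ext w
  simp [diagL]

/-- One-sided inverses are two-sided in finite dimension. This is what places the pair (a, b) of a
point of the level set in ℬ(V, W). -/
theorem isUnit_of_mul_eq_one_fin {x y : V →L[ℂ] V} (h : x * y = 1) : IsUnit y := by
  have h1 : (x : V →ₗ[ℂ] V) * (y : V →ₗ[ℂ] V) = 1 := congrArg ContinuousLinearMap.toLinearMap h
  have h2 : (y : V →ₗ[ℂ] V) * (x : V →ₗ[ℂ] V) = 1 := mul_eq_one_comm.1 h1
  exact ⟨⟨y, x, ContinuousLinearMap.coe_injective h2, h⟩, rfl⟩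

/-- C drops out because it only conjugates. Distributing the factors in this way makes the blocks on
both sides short: neither side contains more than one product of Stokes entries. -/
theorem Fission.momentG_eq_one_iff (p : Fission V W) : p.momentG = 1 ↔
    (p.S₄ : GG V W) * p.S₃ = blockDiag V W p.h⁻¹ * (p.S₁ : GG V W)⁻¹ * (p.S₂ : GG V W)⁻¹ := by
  have h : p.momentG = p.C⁻¹ * (blockDiag V W p.h * ((p.S₄ : GG V W) * p.S₃) * p.S₂ * p.S₁) *
      p.C := by
    simp only [Fission.momentG, Fission.b, mul_assoc]
  rw [h]
  constructor
  · intro h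
    have h1 : blockDiag V W p.h * ((p.S₄ : GG V W) * p.S₃) * p.S₂ * p.S₁ = 1 := by
      rwa [mul_eq_one_iff_eq_inv, mul_eq_left] at h
    rw [map_inv, mul_assoc, eq_inv_mul_iff_mul_eq, ← mul_inv_rev, eq_inv_iff_mul_eq_one, ← h1]
    simp only [mul_assoc]
  · intro h
    rw [h, map_inv]
    group

/-- The equations of the level set in terms of matrix entries. -/
theorem Fission.momentG_eq_one_iff_entries (p : Fission V W) : p.momentG = 1 ↔
    (1 : V →L[ℂ] V) = (↑p.h⁻¹ : LieH V W).1 ∘L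
      (1 + upperEntry p.S₁.1 ∘L lowerEntry p.S₂.1) ∧
    upperEntry p.S₃.1 = -((↑p.h⁻¹ : LieH V W).1 ∘L upperEntry p.S₁.1) ∧
    lowerEntry p.S₄.1 = -((↑p.h⁻¹ : LieH V W).2 ∘L lowerEntry p.S₂.1) ∧
    1 + lowerEntry p.S₄.1 ∘L upperEntry p.S₃.1 = (↑p.h⁻¹ : LieH V W).2 := by
  have h1 : (((p.S₄ : GG V W) * p.S₃ : GG V W) : LieG V W) =
      blockMat 1 (upperEntry p.S₃.1) (lowerEntry p.S₄.1)
        (1 + lowerEntry p.S₄.1 ∘L upperEntry p.S₃.1) := by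
    rw [← upperUnit_upperEntry p.S₃, ← lowerUnit_lowerEntry p.S₄, upperEntry_upperUnit,
      lowerEntry_lowerUnit]
    change blockMat _ _ _ _ * blockMat _ _ _ _ = _
    rw [blockMat_mul, blockMat_inj]
    refine ⟨?_, ?_, ?_, ?_⟩ <;> ext <;> simp [add_comm]
  have h2 : ((blockDiag V W p.h⁻¹ * (p.S₁ : GG V W)⁻¹ * (p.S₂ : GG V W)⁻¹ : GG V W) : LieG V W) =
      blockMat ((↑p.h⁻¹ : LieH V W).1 ∘L (1 + upperEntry p.S₁.1 ∘L lowerEntry p.S₂.1))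
        (-((↑p.h⁻¹ : LieH V W).1 ∘L upperEntry p.S₁.1))
        (-((↑p.h⁻¹ : LieH V W).2 ∘L lowerEntry p.S₂.1)) (↑p.h⁻¹ : LieH V W).2 := by
    rw [← upperUnit_upperEntry p.S₁, ← lowerUnit_lowerEntry p.S₂, upperEntry_upperUnit,
      lowerEntry_lowerUnit]
    change blockMat _ _ _ _ * blockMat _ _ _ _ * blockMat _ _ _ _ = _
    rw [blockMat_mul, blockMat_mul, blockMat_inj]
    refine ⟨?_, ?_, ?_, ?_⟩ <;> ext <;> simp
  rw [Fission.momentG_eq_one_iff, ← Units.val_inj, h1, h2, blockMat_inj]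

namespace LevelSet

theorem entries (z : LevelSet V W) :
    (1 : V →L[ℂ] V) = (↑z.1.h⁻¹ : LieH V W).1 ∘L
      (1 + upperEntry z.1.S₁.1 ∘L lowerEntry z.1.S₂.1) ∧
    upperEntry z.1.S₃.1 = -((↑z.1.h⁻¹ : LieH V W).1 ∘L upperEntry z.1.S₁.1) ∧
    lowerEntry z.1.S₄.1 = -((↑z.1.h⁻¹ : LieH V W).2 ∘L lowerEntry z.1.S₂.1) ∧
    1 + lowerEntry z.1.S₄.1 ∘L upperEntry z.1.S₃.1 = (↑z.1.h⁻¹ : LieH V W).2 :=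
  (Fission.momentG_eq_one_iff_entries z.1).1 z.2

/-- The map `(C, S, h) ↦ (a, b)` from the level set to `ℬ(V, W)`. -/
def toVdB (z : LevelSet V W) : VdB V W :=
  ⟨(upperEntry z.1.S₁.1, lowerEntry z.1.S₂.1),
    (mem_vdbOpens_iff _).2 (isUnit_of_mul_eq_one_fin z.entries.1.symm)⟩

/-- The upper left block of the level equation says that the V-part of h⁻¹ inverts 1 + ab. Inserting
the entries of S₃ and S₄ into the lower right block gives h_W⁻¹(1 - b(1 + ab)⁻¹a) = 1, and the
second factor is the inverse of 1 + ba. -/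
theorem moment_toVdB (z : LevelSet V W) : z.toVdB.moment = z.1.h⁻¹ := by
  obtain ⟨h1, h3, h4, h5⟩ := z.entries
  have e1 : (↑z.1.h⁻¹ : LieH V W).1 = (↑z.toVdB.onePlusAB⁻¹ : V →L[ℂ] V) :=
    Units.eq_inv_of_mul_eq_one_right (u := z.toVdB.onePlusAB) h1.symm
  have e2 : (↑z.1.h⁻¹ : LieH V W).2 * (↑z.toVdB.onePlusBA⁻¹ : W →L[ℂ] W) = 1 := by
    change (↑z.1.h⁻¹ : LieH V W).2 * (1 - lowerEntry z.1.S₂.1 ∘L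
      (↑z.toVdB.onePlusAB⁻¹ : V →L[ℂ] V) ∘L upperEntry z.1.S₁.1) = 1
    rw [← e1, mul_sub, mul_one, sub_eq_iff_eq_add]
    conv_lhs => rw [← h5]
    rw [h3, h4]
    ext w
    simp
  refine Units.ext (Prod.ext e1.symm ?_)
  rw [Units.mul_inv_eq_one] at e2
  exact e2.symm

/-- The pair (a, b) determines h through the moment map, and then S₃ and S₄ through the off-diagonal
blocks of the level equation; only C is free. -/
theorem ext_of_toVdB {z z' : LevelSet V W} (hC : z.1.C = z'.1.C) (h : z.toVdB = z'.toVdB) :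
    z = z' := by
  have h1 : upperEntry z.1.S₁.1 = upperEntry z'.1.S₁.1 := congrArg (fun p => p.1.1) h
  have h2 : lowerEntry z.1.S₂.1 = lowerEntry z'.1.S₂.1 := congrArg (fun p => p.1.2) h
  have hh : z.1.h⁻¹ = z'.1.h⁻¹ := by rw [← moment_toVdB, ← moment_toVdB, h]
  refine Subtype.ext (Fission.ext hC ((upperHomeo V W).injective h1)
    ((lowerHomeo V W).injective h2) ((upperHomeo V W).injective ?_)
    ((lowerHomeo V W).injective ?_) (inv_injective hh))
  · refine z.entries.2.1.trans (Eq.trans ?_ z'.entries.2.1.symm)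
    rw [h1, hh]
  · refine z.entries.2.2.1.trans (Eq.trans ?_ z'.entries.2.2.1.symm)
    rw [h2, hh]

/-- The point of the level set with given `C`, `a` and `b`, as a point of `𝒜²(V, W)`. -/
noncomputable def point (g : GG V W) (p : VdB V W) : Fission V W :=
  (g, ((upperHomeo V W).symm p.1.1, (lowerHomeo V W).symm p.1.2,
    (upperHomeo V W).symm (-((p.moment : LieH V W).1 ∘L p.1.1)),
    (lowerHomeo V W).symm (-((p.moment : LieH V W).2 ∘L p.1.2))), p.moment⁻¹)

/-- The point of the level set with given `C`, `a` and `b`. -/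
noncomputable def mk (g : GG V W) (p : VdB V W) : LevelSet V W :=
  ⟨point g p, by
    rw [Fission.momentG_eq_one_iff_entries]
    change (1 : V →L[ℂ] V) = (↑p.moment⁻¹⁻¹ : LieH V W).1 ∘L
        (1 + upperEntry (upperUnit V W p.1.1) ∘L lowerEntry (lowerUnit V W p.1.2)) ∧
      upperEntry (upperUnit V W (-((p.moment : LieH V W).1 ∘L p.1.1))) =
        -((↑p.moment⁻¹⁻¹ : LieH V W).1 ∘L upperEntry (upperUnit V W p.1.1)) ∧
      lowerEntry (lowerUnit V W (-((p.moment : LieH V W).2 ∘L p.1.2))) =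
        -((↑p.moment⁻¹⁻¹ : LieH V W).2 ∘L lowerEntry (lowerUnit V W p.1.2)) ∧
      1 + lowerEntry (lowerUnit V W (-((p.moment : LieH V W).2 ∘L p.1.2))) ∘L
        upperEntry (upperUnit V W (-((p.moment : LieH V W).1 ∘L p.1.1))) =
        (↑p.moment⁻¹⁻¹ : LieH V W).2
    simp only [upperEntry_upperUnit, lowerEntry_lowerUnit, inv_inv, true_and]
    refine ⟨p.onePlusAB.inv_mul.symm, ?_⟩
    -- This uses the explicit inverse 1 - b(1 + ab)⁻¹a of 1 + ba, the computation of `moment_toVdB`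
    -- read backwards.
    have h : (p.moment : LieH V W).2 * (1 - p.1.2 ∘L (p.moment : LieH V W).1 ∘L p.1.1) = 1 :=
      p.onePlusBA.mul_inv
    rw [mul_sub, mul_one, sub_eq_iff_eq_add] at h
    refine Eq.trans ?_ h.symm
    ext w
    simp⟩

theorem toVdB_mk (g : GG V W) (p : VdB V W) : (mk g p).toVdB = p :=
  Subtype.ext (Prod.ext (upperEntry_upperUnit _) (lowerEntry_lowerUnit _))

/-- The coordinates `(C, (a, b))` on the level set. -/
noncomputable def coords (z : LevelSet V W) : LieG V W × HomPair V W :=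
  ((z.1.C : LieG V W), z.toVdB.1)

theorem continuous_coords : Continuous (coords : LevelSet V W → _) := by
  have h : Continuous fun z : LevelSet V W => Fission.coords V W z.1 :=
    (Fission.isOpenEmbedding_coords V W).continuous.comp continuous_subtype_val
  exact h.fst.prodMk (h.snd.fst.fst.prodMk h.snd.fst.snd.fst)

theorem continuous_moment : Continuous (VdB.moment : VdB V W → HH V W) :=
  (VdB.contMDiff_moment (j := id) (isGlobalChart_opens (vdbOpens V W))).continuous

theorem continuous_mk : Continuous fun q : GG V W × VdB V W => mk q.1 q.2 := by
  have hm : Continuous fun q : GG V W × VdB V W => q.2.moment :=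
    continuous_moment.comp continuous_snd
  have hv : Continuous fun q : GG V W × VdB V W => (q.2.moment : LieH V W) :=
    Units.continuous_val.comp hm
  have hp : Continuous fun q : GG V W × VdB V W => (q.2.1 : HomPair V W) :=
    continuous_subtype_val.comp continuous_snd
  refine Continuous.subtype_mk (Continuous.prodMk continuous_fst (Continuous.prodMk
    (Continuous.prodMk ?_ (Continuous.prodMk ?_ (Continuous.prodMk ?_ ?_))) hm.inv)) _
  · exact (upperHomeo V W).symm.continuous.comp hp.fst
  · exact (lowerHomeo V W).symm.continuous.comp hp.snd
  · exact (upperHomeo V W).symm.continuous.comp (hv.fst.clm_comp hp.fst).neg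
  · exact (lowerHomeo V W).symm.continuous.comp (hv.snd.clm_comp hp.snd).neg

/-- The level set is the product of `G` and `ℬ(V, W)`. -/
noncomputable def homeo : LevelSet V W ≃ₜ GG V W × VdB V W where
  toFun z := (z.1.C, z.toVdB)
  invFun q := mk q.1 q.2
  left_inv z := ext_of_toVdB rfl (toVdB_mk _ _)
  right_inv q := Prod.ext rfl (toVdB_mk _ _)
  continuous_toFun := by
    refine Continuous.prodMk ?_ ?_
    · exact continuous_fst.comp continuous_subtype_val
    · exact continuous_coords.snd.subtype_mk _
  continuous_invFun := continuous_mk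

theorem isOpenEmbedding_coords : Topology.IsOpenEmbedding (coords : LevelSet V W → _) := by
  have h : Topology.IsOpenEmbedding (Prod.map (Units.val : GG V W → LieG V W)
      (Subtype.val : VdB V W → HomPair V W)) :=
    Units.isOpenEmbedding_val.prodMap (vdbOpens V W).isOpen.isOpenEmbedding_subtypeVal
  exact Topology.IsOpenEmbedding.comp h (homeo (V := V) (W := W)).isOpenEmbedding

local instance : SMul (HH V W) (VdB V W) := SemigroupAction.toSMul

theorem toVdB_smul (k : HH V W) (z : LevelSet V W) : (k • z).toVdB = k • z.toVdB :=
  Subtype.ext (Prod.ext (upperEntry_conj k _) (lowerEntry_conj k _))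

end LevelSet

namespace Reduced

/-- The reduced space is homeomorphic to `ℬ(V, W)`. -/
noncomputable def homeo : Reduced V W ≃ₜ VdB V W where
  toFun := Quotient.lift LevelSet.toVdB (by rintro z _ ⟨g, rfl⟩; rfl)
  invFun p := (LevelSet.mk 1 p).proj
  left_inv := by
    rintro ⟨z⟩
    -- The group element C itself moves z to the representative of its orbit with C = 1.
    refine Quotient.sound ⟨z.1.C, LevelSet.ext_of_toVdB ?_ (LevelSet.toVdB_mk _ _).symm⟩
    exact mul_inv_cancel _
  right_inv p := LevelSet.toVdB_mk _ _
  continuous_toFun :=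
    Continuous.quotient_lift (LevelSet.continuous_coords.snd.subtype_mk _) _
  continuous_invFun :=
    continuous_quotient_mk'.comp (LevelSet.continuous_mk.comp (Continuous.prodMk_right 1))

theorem moment_eq (r : Reduced V W) : r.moment = (homeo r).moment := by
  obtain ⟨z⟩ := r
  exact z.moment_toVdB.symm

local instance : SMul (HH V W) (VdB V W) := SemigroupAction.toSMul

theorem homeo_smul (k : HH V W) (r : Reduced V W) : homeo (k • r) = k • homeo r := by
  obtain ⟨z⟩ := r
  exact z.toVdB_smul k

theorem isOpenEmbedding_coords :
    Topology.IsOpenEmbedding fun r : Reduced V W => (homeo r).1 :=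
  (vdbOpens V W).isOpen.isOpenEmbedding_subtypeVal.comp homeo.isOpenEmbedding

end Reduced

end Level

/-! ### The level set as a submanifold and the projection as a submersion -/

section Smooth

variable {V W : Type*} [NormedAddCommGroup V] [NormedSpace ℂ V] [FiniteDimensional ℂ V]
  [NormedAddCommGroup W] [NormedSpace ℂ W] [FiniteDimensional ℂ W]

variable (V W) in
/-- The block strictly upper triangular matrices. -/
noncomputable def upL : (W →L[ℂ] V) →L[ℂ] LieG V W :=
  LinearMap.toContinuousLinearMap (offDiag ∘ₗ LinearMap.inl ℂ (W →L[ℂ] V) (V →L[ℂ] W))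

variable (V W) in
/-- The block strictly lower triangular matrices. -/
noncomputable def loL : (V →L[ℂ] W) →L[ℂ] LieG V W :=
  LinearMap.toContinuousLinearMap (offDiag ∘ₗ LinearMap.inr ℂ (W →L[ℂ] V) (V →L[ℂ] W))

variable (V W) in
/-- `diagL` as a continuous linear map. -/
noncomputable def diagCL : LieH V W →L[ℂ] LieG V W :=
  LinearMap.toContinuousLinearMap
    { toFun := diagL
      map_add' := diagL_add
      map_smul' := fun c X => by
        simp only [diagL, RingHom.id_apply]
        rw [blockMat_smul, smul_zero, smul_zero]
        rfl }

theorem upL_apply (x : W →L[ℂ] V) : upL V W x = blockMat 0 x 0 0 := rfl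

theorem loL_apply (y : V →L[ℂ] W) : loL V W y = blockMat 0 0 y 0 := rfl

theorem offDiag_eq (x : HomPair V W) : offDiag x = upL V W x.1 + loL V W x.2 := by
  rw [upL_apply, loL_apply, blockMat_add, offDiag_apply]
  simp

theorem upL_mul_upL (x x' : W →L[ℂ] V) : upL V W x * upL V W x' = 0 := by
  rw [upL_apply, upL_apply, blockMat_mul]
  simp [blockMat_zero]

theorem loL_mul_loL (y y' : V →L[ℂ] W) : loL V W y * loL V W y' = 0 := by
  rw [loL_apply, loL_apply, blockMat_mul]
  simp [blockMat_zero]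

theorem val_upperUnit (x : W →L[ℂ] V) : (upperUnit V W x : LieG V W) = 1 + upL V W x := by
  rw [upL_apply, ← blockMat_one, blockMat_add]
  simp [upperUnit]

theorem val_lowerUnit (y : V →L[ℂ] W) : (lowerUnit V W y : LieG V W) = 1 + loL V W y := by
  rw [loL_apply, ← blockMat_one, blockMat_add]
  simp [lowerUnit]

theorem val_inv_upperUnit (x : W →L[ℂ] V) : (↑(upperUnit V W x)⁻¹ : LieG V W) = 1 - upL V W x := by
  rw [upL_apply, ← blockMat_one, blockMat_sub]
  simp [upperUnit]

theorem val_inv_lowerUnit (y : V →L[ℂ] W) : (↑(lowerUnit V W y)⁻¹ : LieG V W) = 1 - loL V W y := by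
  rw [loL_apply, ← blockMat_one, blockMat_sub]
  simp [lowerUnit]

theorem val_UPlus (S : UPlus V W) : (S.1 : LieG V W) = 1 + upL V W (upperEntry S.1) := by
  rw [← val_upperUnit, upperUnit_upperEntry]

theorem val_UMinus (S : UMinus V W) : (S.1 : LieG V W) = 1 + loL V W (lowerEntry S.1) := by
  rw [← val_lowerUnit, lowerUnit_lowerEntry]

namespace Fission

theorem isGlobalChart_coords : IsGlobalChart (E := Model V W) (coords V W) :=
  isGlobalChart_singletonChartedSpace (isOpenEmbedding_coords V W)

/-- Each of C, Sᵢ and h is an affine function of the global coordinates of 𝒜²(V, W). -/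
theorem unitMDifferentiableAt {f : Fission V W → GG V W} {F : Model V W →L[ℂ] LieG V W}
    {c : LieG V W} (h : ∀ p, (f p : LieG V W) = c + F (coords V W p)) (p : Fission V W) :
    UnitMDifferentiableAt (Model V W) f p := by
  unfold UnitMDifferentiableAt
  rw [show (fun p => (f p : LieG V W)) = fun p => c + F (coords V W p) from funext h]
  exact (isGlobalChart_coords.hasMFDerivAt_comp
    (f := fun x => c + F x) (F.hasFDerivAt.const_add c)).mdifferentiableAt

theorem unitMDifferentiableAt_C (p : Fission V W) : UnitMDifferentiableAt (Model V W) C p :=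
  unitMDifferentiableAt (c := 0) (F := .fst ℂ _ _) (fun _ => (zero_add _).symm) p

theorem unitMDifferentiableAt_S₁ (p : Fission V W) :
    UnitMDifferentiableAt (Model V W) (fun q => (q.S₁ : GG V W)) p :=
  unitMDifferentiableAt (c := 1) (F := (upL V W).comp ((ContinuousLinearMap.fst ℂ _ _).comp
    ((ContinuousLinearMap.fst ℂ _ _).comp (ContinuousLinearMap.snd ℂ _ _))))
    (fun p => val_UPlus p.S₁) p

theorem unitMDifferentiableAt_S₂ (p : Fission V W) :
    UnitMDifferentiableAt (Model V W) (fun q => (q.S₂ : GG V W)) p :=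
  unitMDifferentiableAt (c := 1) (F := (loL V W).comp ((ContinuousLinearMap.fst ℂ _ _).comp
    ((ContinuousLinearMap.snd ℂ _ _).comp ((ContinuousLinearMap.fst ℂ _ _).comp
      (ContinuousLinearMap.snd ℂ _ _)))))
    (fun p => val_UMinus p.S₂) p

theorem unitMDifferentiableAt_S₃ (p : Fission V W) :
    UnitMDifferentiableAt (Model V W) (fun q => (q.S₃ : GG V W)) p :=
  unitMDifferentiableAt (c := 1) (F := (upL V W).comp ((ContinuousLinearMap.fst ℂ _ _).comp
    ((ContinuousLinearMap.snd ℂ _ _).comp ((ContinuousLinearMap.snd ℂ _ _).comp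
      ((ContinuousLinearMap.fst ℂ _ _).comp (ContinuousLinearMap.snd ℂ _ _))))))
    (fun p => val_UPlus p.S₃) p

theorem unitMDifferentiableAt_S₄ (p : Fission V W) :
    UnitMDifferentiableAt (Model V W) (fun q => (q.S₄ : GG V W)) p :=
  unitMDifferentiableAt (c := 1) (F := (loL V W).comp ((ContinuousLinearMap.snd ℂ _ _).comp
    ((ContinuousLinearMap.snd ℂ _ _).comp ((ContinuousLinearMap.snd ℂ _ _).comp
      ((ContinuousLinearMap.fst ℂ _ _).comp (ContinuousLinearMap.snd ℂ _ _))))))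
    (fun p => val_UMinus p.S₄) p

theorem unitMDifferentiableAt_h (p : Fission V W) :
    UnitMDifferentiableAt (Model V W) (fun q : Fission V W => blockDiag V W q.h) p :=
  unitMDifferentiableAt (c := 0) (F := (diagCL V W).comp ((ContinuousLinearMap.snd ℂ _ _).comp
    (ContinuousLinearMap.snd ℂ _ _))) (fun _ => (zero_add _).symm) p

theorem unitMDifferentiableAt_C₁ (p : Fission V W) : UnitMDifferentiableAt (Model V W) C₁ p :=
  (unitMDifferentiableAt_S₁ p).mul (unitMDifferentiableAt_C p)

theorem unitMDifferentiableAt_C₂ (p : Fission V W) : UnitMDifferentiableAt (Model V W) C₂ p :=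
  (unitMDifferentiableAt_S₂ p).mul (unitMDifferentiableAt_C₁ p)

theorem unitMDifferentiableAt_C₃ (p : Fission V W) : UnitMDifferentiableAt (Model V W) C₃ p :=
  (unitMDifferentiableAt_S₃ p).mul (unitMDifferentiableAt_C₂ p)

theorem unitMDifferentiableAt_C₄ (p : Fission V W) : UnitMDifferentiableAt (Model V W) C₄ p :=
  (unitMDifferentiableAt_S₄ p).mul (unitMDifferentiableAt_C₃ p)

theorem unitMDifferentiableAt_b (p : Fission V W) : UnitMDifferentiableAt (Model V W) b p :=
  ((((unitMDifferentiableAt_h p).mul (unitMDifferentiableAt_S₄ p)).mul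
    (unitMDifferentiableAt_S₃ p)).mul (unitMDifferentiableAt_S₂ p)).mul (unitMDifferentiableAt_S₁ p)

end Fission

namespace LevelSet

/-- The third Stokes multiplier on the level set, as a function of `a` and `b`. -/
noncomputable def entry₃ (x : HomPair V W) : W →L[ℂ] V := -((VdB.resolvent x).1 ∘L x.1)

/-- The fourth Stokes multiplier on the level set, as a function of `a` and `b`. -/
noncomputable def entry₄ (x : HomPair V W) : V →L[ℂ] W := -((1 + x.2 ∘L x.1) ∘L x.2)

/-- The inclusion of the level set in global coordinates. -/
noncomputable def inclCoords (q : LieG V W × HomPair V W) : Fission.Model V W :=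
  (q.1, (q.2.1, q.2.2, entry₃ q.2, entry₄ q.2), (1 + q.2.1 ∘L q.2.2, (VdB.resolvent q.2).2))

theorem upperEntry_S₃ (z : LevelSet V W) : upperEntry z.1.S₃.1 = entry₃ z.toVdB.1 := by
  rw [z.entries.2.1, ← moment_toVdB, VdB.val_moment, ← VdB.resolvent_eq]
  rfl

theorem lowerEntry_S₄ (z : LevelSet V W) : lowerEntry z.1.S₄.1 = entry₄ z.toVdB.1 := by
  rw [z.entries.2.2.1, ← moment_toVdB]
  rfl

theorem val_h (z : LevelSet V W) : (z.1.h : LieH V W) =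
    (1 + z.toVdB.1.1 ∘L z.toVdB.1.2, (VdB.resolvent z.toVdB.1).2) := by
  rw [← inv_inv z.1.h, ← moment_toVdB, VdB.val_inv_moment, ← VdB.resolvent_eq]
  rfl

theorem coords_incl (z : LevelSet V W) : Fission.coords V W z.incl = inclCoords z.coords :=
  Prod.ext rfl (Prod.ext (Prod.ext rfl (Prod.ext rfl (Prod.ext z.upperEntry_S₃ z.lowerEntry_S₄)))
    z.val_h)

theorem contDiffAt_entry₃ (p : VdB V W) : ContDiffAt ℂ ω entry₃ p.1 :=
  ((VdB.contDiffAt_resolvent p).fst.clm_comp contDiffAt_fst).neg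

theorem contDiff_entry₄ : ContDiff ℂ ω (entry₄ : HomPair V W → _) :=
  ((contDiff_const.add (contDiff_snd.clm_comp contDiff_fst)).clm_comp contDiff_snd).neg

theorem contDiffAt_inclCoords (z : LevelSet V W) : ContDiffAt ℂ ω inclCoords z.coords := by
  have h2 : ContDiffAt ℂ ω (fun q : LieG V W × HomPair V W => q.2) z.coords := contDiffAt_snd
  have hr : ContDiffAt ℂ ω (fun q : LieG V W × HomPair V W => VdB.resolvent q.2) z.coords :=
    ContDiffAt.comp (g := VdB.resolvent) z.coords (VdB.contDiffAt_resolvent z.toVdB) h2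
  have h3 : ContDiffAt ℂ ω (fun q : LieG V W × HomPair V W => entry₃ q.2) z.coords :=
    ContDiffAt.comp (g := entry₃) z.coords (contDiffAt_entry₃ z.toVdB) h2
  have h4 : ContDiffAt ℂ ω (fun q : LieG V W × HomPair V W => entry₄ q.2) z.coords :=
    ContDiffAt.comp (g := entry₄) z.coords contDiff_entry₄.contDiffAt h2
  exact contDiffAt_fst.prodMk ((h2.fst.prodMk (h2.snd.prodMk (h3.prodMk h4))).prodMk
    ((contDiffAt_const.add (h2.fst.clm_comp h2.snd)).prodMk hr.snd))

variable [ChartedSpace (LieG V W × HomPair V W) (LevelSet V W)]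

theorem contMDiff_incl (hζ : IsGlobalChart (LevelSet.coords : LevelSet V W → _)) :
    ContMDiff 𝓘(ℂ, LieG V W × HomPair V W) 𝓘(ℂ, Fission.Model V W) ω
      (LevelSet.incl : LevelSet V W → Fission V W) := by
  refine Fission.isGlobalChart_coords.contMDiff_of_comp fun z => ?_
  rw [show Fission.coords V W ∘ incl = fun z => inclCoords z.coords from funext coords_incl]
  exact hζ.contMDiffAt_comp (contDiffAt_inclCoords z)

theorem mfderiv_incl_injective (hζ : IsGlobalChart (LevelSet.coords : LevelSet V W → _))
    (z : LevelSet V W) : Function.Injective (mfderiv 𝓘(ℂ, LieG V W × HomPair V W)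
      𝓘(ℂ, Fission.Model V W) (LevelSet.incl : LevelSet V W → Fission V W) z) := by
  have h := ((contDiffAt_inclCoords z).differentiableAt (by simp)).hasFDerivAt
  have hi := Fission.isGlobalChart_coords.hasMFDerivAt_of_comp (f := LevelSet.incl) (l := z)
    (I := 𝓘(ℂ, LieG V W × HomPair V W)) (by
      rw [show (fun z => Fission.coords V W (incl z)) = fun z => inclCoords z.coords from
        funext coords_incl]
      exact hζ.hasMFDerivAt_comp h)
  rw [hi.mfderiv]
  -- G keeps C, a and b and forgets the dependent coordinates. It is a linear left inverse of
  -- `inclCoords`, so its composite with the differential is the identity.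
  let G : Fission.Model V W →L[ℂ] LieG V W × HomPair V W :=
    (ContinuousLinearMap.fst ℂ _ _).prod (((ContinuousLinearMap.fst ℂ _ _).prod
      ((ContinuousLinearMap.fst ℂ _ _).comp (ContinuousLinearMap.snd ℂ _ _))).comp
      ((ContinuousLinearMap.fst ℂ _ _).comp (ContinuousLinearMap.snd ℂ _ _)))
  have hG : HasFDerivAt (fun q : LieG V W × HomPair V W => q) (G.comp (fderiv ℂ inclCoords z.coords))
      z.coords := G.hasFDerivAt.comp z.coords h
  have hid := hG.unique (hasFDerivAt_id z.coords)
  exact Function.LeftInverse.injective (g := G) fun u => DFunLike.congr_fun hid u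

variable [ChartedSpace (HomPair V W) (Reduced V W)]

theorem contMDiff_proj (hζ : IsGlobalChart (LevelSet.coords : LevelSet V W → _))
    (hΦ : IsGlobalChart fun r : Reduced V W => (Reduced.homeo r).1) :
    ContMDiff 𝓘(ℂ, LieG V W × HomPair V W) 𝓘(ℂ, HomPair V W) ω
      (LevelSet.proj : LevelSet V W → Reduced V W) :=
  hΦ.contMDiff_of_comp fun _ =>
    hζ.contMDiffAt_comp (f := fun q => q.2) contDiffAt_snd

/-- The charts of source and target share the coordinates (a, b), so the projection is a linear one
in coordinates. -/
theorem hasMFDerivAt_proj (hζ : IsGlobalChart (LevelSet.coords : LevelSet V W → _))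
    (hΦ : IsGlobalChart fun r : Reduced V W => (Reduced.homeo r).1) (z : LevelSet V W) :
    HasMFDerivAt 𝓘(ℂ, LieG V W × HomPair V W) 𝓘(ℂ, HomPair V W)
      (LevelSet.proj : LevelSet V W → Reduced V W) z
      (ContinuousLinearMap.snd ℂ (LieG V W) (HomPair V W)) :=
  hΦ.hasMFDerivAt_of_comp (hζ.hasMFDerivAt_comp (f := fun q => q.2) hasFDerivAt_snd)

theorem mfderiv_proj_surjective (hζ : IsGlobalChart (LevelSet.coords : LevelSet V W → _))
    (hΦ : IsGlobalChart fun r : Reduced V W => (Reduced.homeo r).1) (z : LevelSet V W) :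
    Function.Surjective (mfderiv 𝓘(ℂ, LieG V W × HomPair V W) 𝓘(ℂ, HomPair V W)
      (LevelSet.proj : LevelSet V W → Reduced V W) z) := by
  rw [(hasMFDerivAt_proj hζ hΦ z).mfderiv]
  exact Prod.snd_surjective

end LevelSet

end Smooth

/-! ## Trace identities for the reduced two-form -/

section Trace

variable {A : Type*} [Ring A] {t : A →+ ℂ}

theorem trace_conj_mul (ht : ∀ x y, t (x * y) = t (y * x)) (c : Aˣ) (x y : A) :
    t ((↑c⁻¹ : A) * x * c * ((↑c⁻¹ : A) * y * c)) = t (x * y) := by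
  rw [show (↑c⁻¹ : A) * x * c * ((↑c⁻¹ : A) * y * c) = (↑c⁻¹ : A) * (x * y * c) by
    simp only [mul_assoc, Units.mul_inv_cancel_left], ht, mul_assoc, mul_assoc, Units.mul_inv,
    mul_one]

/-- The terms of the two-form of `𝒜²(V, W)` that involve the Maurer-Cartan form of `C` cancel on
the level set. -/
theorem trace_framing_cancel (ht : ∀ x y, t (x * y) = t (y * x)) (c h : Aˣ)
    {gu gv d₁u d₁v d₂u d₂v d₃u d₃v d₄u d₄v eu ev : A}
    (hu : d₄u = -(h * eu * (↑h⁻¹ : A))) (hv : d₄v = -(h * ev * (↑h⁻¹ : A))) :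
    t (c * gu * (↑c⁻¹ : A) * (c * gv * (↑c⁻¹ : A)))
      - t (c * gv * (↑c⁻¹ : A) * (c * gu * (↑c⁻¹ : A)))
      + (t ((↑(h⁻¹ * c) : A) * ((↑c⁻¹ : A) * d₄u * c + gu) * (↑(h⁻¹ * c)⁻¹ : A) * ev)
        - t ((↑(h⁻¹ * c) : A) * ((↑c⁻¹ : A) * d₄v * c + gv) * (↑(h⁻¹ * c)⁻¹ : A) * eu))
      - ((t (((↑c⁻¹ : A) * d₁u * c + gu) * gv) - t (((↑c⁻¹ : A) * d₁v * c + gv) * gu))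
        + (t (((↑c⁻¹ : A) * d₂u * c + gu) * ((↑c⁻¹ : A) * d₁v * c + gv))
          - t (((↑c⁻¹ : A) * d₂v * c + gv) * ((↑c⁻¹ : A) * d₁u * c + gu)))
        + (t (((↑c⁻¹ : A) * d₃u * c + gu) * ((↑c⁻¹ : A) * d₂v * c + gv))
          - t (((↑c⁻¹ : A) * d₃v * c + gv) * ((↑c⁻¹ : A) * d₂u * c + gu)))
        + (t (((↑c⁻¹ : A) * d₄u * c + gu) * ((↑c⁻¹ : A) * d₃v * c + gv))
          - t (((↑c⁻¹ : A) * d₄v * c + gv) * ((↑c⁻¹ : A) * d₃u * c + gu)))) =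
    -((t (d₂u * d₁v) - t (d₂v * d₁u)) + (t (d₃u * d₂v) - t (d₃v * d₂u))
      + (t (d₄u * d₃v) - t (d₄v * d₃u))) := by
  -- Here g, dᵢ and e stand for the left Maurer-Cartan forms of C, Dᵢ and h. As C₄ = h⁻¹C, the
  -- pairing of the right form of C₄ with e is minus that of the left form of C₄ with c⁻¹ d₄ c.
  have hY : ∀ Y e d : A, d = -(h * e * (↑h⁻¹ : A)) →
      t ((↑(h⁻¹ * c) : A) * Y * (↑(h⁻¹ * c)⁻¹ : A) * e) = -t (Y * ((↑c⁻¹ : A) * d * c)) := by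
    rintro Y e d rfl
    rw [mul_inv_rev, inv_inv, Units.val_mul, Units.val_mul, ← map_neg]
    calc _ = t ((↑h⁻¹ : A) * (c * (Y * ((↑c⁻¹ : A) * (h * e))))) := by simp only [mul_assoc]
      _ = t (c * (Y * ((↑c⁻¹ : A) * (h * e))) * (↑h⁻¹ : A)) := ht _ _
      _ = t (c * (Y * ((↑c⁻¹ : A) * (h * (e * (↑h⁻¹ : A)))))) := by simp only [mul_assoc]
      _ = t (Y * ((↑c⁻¹ : A) * (h * (e * (↑h⁻¹ : A)))) * c) := ht _ _
      _ = _ := by simp only [mul_assoc, mul_neg, neg_mul, neg_neg]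
  rw [hY _ ev _ hv, hY _ eu _ hu, ht (c * gv * (↑c⁻¹ : A)), sub_self, zero_add]
  have e1 := trace_conj_mul ht c d₂u d₁v
  have e2 := trace_conj_mul ht c d₂v d₁u
  have e3 := trace_conj_mul ht c d₃u d₂v
  have e4 := trace_conj_mul ht c d₃v d₂u
  have e5 := trace_conj_mul ht c d₄u d₃v
  have e6 := trace_conj_mul ht c d₄v d₃u
  rw [← e1, ← e2, ← e3, ← e4, ← e5, ← e6]
  generalize (↑c⁻¹ : A) * d₁u * c = x₁
  generalize (↑c⁻¹ : A) * d₁v * c = y₁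
  generalize (↑c⁻¹ : A) * d₂u * c = x₂
  generalize (↑c⁻¹ : A) * d₂v * c = y₂
  generalize (↑c⁻¹ : A) * d₃u * c = x₃
  generalize (↑c⁻¹ : A) * d₃v * c = y₃
  generalize (↑c⁻¹ : A) * d₄u * c = x₄
  generalize (↑c⁻¹ : A) * d₄v * c = y₄
  -- In the sum over i the pairings with g telescope to that of x₄ with g, which the η term cancels;
  -- self-pairings vanish by antisymmetry.
  simp only [add_mul, mul_add, map_add]
  rw [ht gu gv, ht gu y₁, ht gv x₁, ht gu y₂, ht gv x₂, ht gu y₃, ht gv x₃, ht gu y₄, ht gv x₄,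
    ht x₄ y₄]
  ring

/-- The contribution of the Stokes multipliers; `a`, `au`, `av`, `c`, `cu`, `cv` are block strictly
upper triangular and `b`, `bu`, `bv` are block strictly lower triangular. -/
theorem trace_stokes (ht : ∀ x y, t (x * y) = t (y * x)) {a b au av bu bv cu cv : A}
    {d₁u d₁v d₂u d₂v d₃u d₃v : A} (haa : a * a = 0)
    (hau : a * au = 0) (hav : a * av = 0) (hua : au * a = 0) (hva : av * a = 0)
    (hcu : cu * av = 0) (hcv : cv * au = 0) (huc : av * cu = 0) (hvc : au * cv = 0)
    (hbu : b * bu = 0) (hbv : b * bv = 0) (hub : bu * b = 0) (hvb : bv * b = 0)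
    (h₁u : d₁u = au) (h₁v : d₁v = av)
    (h₂u : d₂u = (1 - a) * bu * (1 + a) + au) (h₂v : d₂v = (1 - a) * bv * (1 + a) + av)
    (h₃u : d₃u = (1 - a) * (1 - b) * cu * ((1 + b) * (1 + a)) + d₂u)
    (h₃v : d₃v = (1 - a) * (1 - b) * cv * ((1 + b) * (1 + a)) + d₂v) :
    (t (d₂u * d₁v) - t (d₂v * d₁u)) + (t (d₃u * d₂v) - t (d₃v * d₂u)) =
      t (bu * av) - t (bv * au) + (t (cu * bv) - t (cu * b * av * b))
        - (t (cv * bu) - t (cv * b * au * b)) := by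
  -- Conjugation by S₁ = 1 + a fixes z, since a z = z a = 0; cyclicity moves the conjugation from x
  -- to z.
  have k₂ : ∀ x y z : A, a * z = 0 → z * a = 0 →
      t (((1 - a) * x * (1 + a) + y) * z) = t (x * z) + t (y * z) := by
    intro x y z h1 h2
    have h3 : (1 + a) * z * (1 - a) = z := by
      rw [add_mul, one_mul, h1, add_zero, mul_sub, mul_one, h2, sub_zero]
    rw [add_mul, map_add, mul_assoc, mul_assoc, ht (1 - a), mul_assoc, h3]
  -- Moving the conjugation by S₂S₁ to the other factor leaves t(x S₂(z + y)S₂⁻¹) with S₂ = 1 + b.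
  -- By nilpotency and cyclicity only x z and -x b y b contribute.
  have k₃ : ∀ x y z : A, a * y = 0 → y * a = 0 → b * z = 0 → z * b = 0 → x * y = 0 → y * x = 0 →
      t ((1 - a) * (1 - b) * x * ((1 + b) * (1 + a)) * ((1 - a) * z * (1 + a) + y)) =
        t (x * z) - t (x * b * y * b) := by
    intro x y z h1 h2 h3 h4 h5 h6
    have h7 : (1 + a) * ((1 - a) * z * (1 + a) + y) * (1 - a) = z + y := by
      have h8 : (1 + a) * (1 - a) = 1 := by
        rw [mul_sub, add_mul, add_mul, haa]
        noncomm_ring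
      have h9 : (1 + a) * y * (1 - a) = y := by
        rw [add_mul, one_mul, h1, add_zero, mul_sub, mul_one, h2, sub_zero]
      calc _ = ((1 + a) * (1 - a)) * z * ((1 + a) * (1 - a)) + (1 + a) * y * (1 - a) := by
            noncomm_ring
        _ = _ := by rw [h8, h9, one_mul, mul_one]
    have h10 : x * ((1 + b) * (z + y) * (1 - b)) =
        x * z + x * (b * z) - x * (z * b) - x * ((b * z) * b) + x * y + x * b * y - x * y * b
          - x * b * y * b := by noncomm_ring
    have h11 : t (x * b * y) = 0 := by rw [ht, ← mul_assoc, h6, zero_mul, map_zero]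
    calc _ = t ((1 - a) * ((1 - b) * x * ((1 + b) * (1 + a)) * ((1 - a) * z * (1 + a) + y))) := by
          simp only [mul_assoc]
      _ = t ((1 - b) * (x * (1 + b) * ((1 + a) * ((1 - a) * z * (1 + a) + y) * (1 - a)))) := by
          rw [ht]; simp only [mul_assoc]
      _ = t (x * ((1 + b) * (z + y) * (1 - b))) := by rw [h7, ht]; simp only [mul_assoc]
      _ = _ := by
          rw [h10, h3, h4, h5, zero_mul, mul_zero, sub_zero]
          simp only [map_add, map_sub, map_zero, h11]
          ring
  subst h₁u h₁v
  rw [h₃u, h₃v, add_mul _ d₂u, add_mul _ d₂v, map_add, map_add, ht d₂v d₂u]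
  rw [show t (d₂u * d₁v) = t (bu * d₁v) + t (d₁u * d₁v) by rw [h₂u, k₂ _ _ _ hav hva],
    show t (d₂v * d₁u) = t (bv * d₁u) + t (d₁v * d₁u) by rw [h₂v, k₂ _ _ _ hau hua],
    ht d₁v d₁u]
  rw [show t ((1 - a) * (1 - b) * cu * ((1 + b) * (1 + a)) * d₂v) =
      t (cu * bv) - t (cu * b * d₁v * b) by rw [h₂v, k₃ _ _ _ hav hva hbv hvb hcu huc],
    show t ((1 - a) * (1 - b) * cv * ((1 + b) * (1 + a)) * d₂u) =
      t (cv * bu) - t (cv * b * d₁u * b) by rw [h₂u, k₃ _ _ _ hau hua hbu hub hcv hvc]]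
  ring

/-- The reduced two-form is that of `ℬ(V, W)`; here `r = (1 + a b + b a)⁻¹`. -/
theorem trace_reduced (ht : ∀ x y, t (x * y) = t (y * x)) {a b r au av bu bv cu cv : A}
    (hrb : b * r = r * b) (hau : r * (a * (b * au)) = au - r * au)
    (hav : r * (a * (b * av)) = av - r * av)
    (hbu : r * (b * (a * bu)) = bu - r * bu) (hbv : r * (b * (a * bv)) = bv - r * bv)
    (hcu : cu = -(r * au) + r * (au * b + a * bu) * r * a)
    (hcv : cv = -(r * av) + r * (av * b + a * bv) * r * a) :
    t (bu * av) - t (bv * au) + (t (cu * bv) - t (cu * b * av * b))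
        - (t (cv * bu) - t (cv * b * au * b)) =
      -(t (r * (au * bv - av * bu)) - t (r * (bu * av - bv * au))) := by
  have key : ∀ {xu xv yu yv c : A}, r * (a * (b * xv)) = xv - r * xv →
      r * (b * (a * yu)) = yu - r * yu → c = -(r * xu) + r * (xu * b + a * yu) * r * a →
      t (c * yv) - t (c * b * xv * b) = -t (r * xu * yv) + t (r * xu * b * (r * a * yv))
        + t (r * a * yu * (r * a * yv)) + t (r * xu * b * (r * xv * b)) - t (yu * xv)
        + t (r * yu * xv) + t (r * a * yu * (r * xv * b)) := by
    intro xu xv yu yv c h1 h2 h3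
    have e1 : c * yv = -(r * xu * yv) + r * xu * b * (r * a * yv) + r * a * yu * (r * a * yv) := by
      rw [h3]; noncomm_ring
    have e2 : c * b * xv * b = -(r * xu * b * xv * b)
        + r * xu * b * (r * (a * (b * xv))) * b + r * a * yu * (r * (a * (b * xv))) * b := by
      rw [h3]; noncomm_ring
    have e3 : c * b * xv * b = -(r * xu * b * (r * xv * b)) + r * a * yu * xv * b
        - r * a * yu * (r * xv * b) := by
      rw [e2, h1]; noncomm_ring
    have e4 : t (r * a * yu * xv * b) = t (yu * xv) - t (r * yu * xv) := by
      rw [ht, ← map_sub]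
      congr 1
      calc _ = b * r * (a * yu) * xv := by simp only [mul_assoc]
        _ = r * (b * (a * yu)) * xv := by rw [hrb, mul_assoc r]
        _ = _ := by rw [h2, sub_mul]
    rw [e1, e3]
    simp only [map_add, map_sub, map_neg, e4]
    ring
  rw [key hav hbu hcu, key hau hbv hcv, mul_sub, mul_sub, map_sub, map_sub]
  -- The terms with two factors r are, taken together, symmetric in u and v, so they cancel in the
  -- antisymmetrization.
  rw [ht (r * av * b) (r * au * b), ht (r * a * bv) (r * a * bu),
    ht (r * av * b) (r * a * bu), ht (r * a * bv) (r * au * b)]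
  simp only [← mul_assoc]
  ring

end Trace

/-! ### Ingredients for restricting the two-form of 𝒜²(V, W) to the level set -/

section Descent

variable {V W : Type*} [NormedAddCommGroup V] [NormedSpace ℂ V] [FiniteDimensional ℂ V]
  [NormedAddCommGroup W] [NormedSpace ℂ W] [FiniteDimensional ℂ W]

/-- Block diagonal factors keep a matrix strictly lower triangular. This removes the pairing of D₄
with D₃. -/
theorem trL_diagL_loL (X Y Z : LieH V W) (w : V →L[ℂ] W) :
    trL (V × W) (diagL X * (diagL Y * loL V W w * diagL Z)) = 0 := by
  simp only [diagL, loL_apply]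
  rw [blockMat_mul, blockMat_mul, blockMat_mul, trL_blockMat]
  simp

/-- Upper times lower acts on V and lower times upper on W, so the supertrace is a difference of
ordinary traces; this is the shape in which `trace_reduced` delivers the form. -/
theorem VdB.formL_apply_trL (X : LieH V W) (u v : HomPair V W) : VdB.formL X ![u, v] =
    (1 / 2) * (trL (V × W) (diagL X * (upL V W u.1 * loL V W v.2 - upL V W v.1 * loL V W u.2)) -
      trL (V × W) (diagL X * (loL V W u.2 * upL V W v.1 - loL V W v.2 * upL V W u.1))) := by
  have h1 : ∀ (x : W →L[ℂ] V) (y : V →L[ℂ] W),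
      upL V W x * loL V W y = diagL (x ∘L y, 0) := fun x y => by
    rw [upL_apply, loL_apply, blockMat_mul, diagL, blockMat_inj]
    refine ⟨?_, ?_, ?_, ?_⟩ <;> ext <;> simp
  have h2 : ∀ (x : W →L[ℂ] V) (y : V →L[ℂ] W),
      loL V W y * upL V W x = diagL (0, y ∘L x) := fun x y => by
    rw [upL_apply, loL_apply, blockMat_mul, diagL, blockMat_inj]
    refine ⟨?_, ?_, ?_, ?_⟩ <;> ext <;> simp
  have h3 : ∀ Y : LieH V W, trL (V × W) (diagL Y) = trL V Y.1 + trL W Y.2 := fun Y =>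
    trL_blockMat _ _ _ _
  have h4 : ∀ Y : LieH V W, superTrace V W (diagL Y) = trL V Y.1 - trL W Y.2 := superTrace_diagL
  rw [formL_apply]
  simp only [offDiag_mul_offDiag, h1, h2, ← diagL_sub, ← diagL_mul, h3, h4]
  simp

/-- Product rule for -(R a), with the derivative -R D R of R; this supplies `cu` and `cv` in
`trace_reduced`. -/
theorem hasFDerivAt_entry₃ (p : VdB V W) : ∃ f' : HomPair V W →L[ℂ] (W →L[ℂ] V),
    HasFDerivAt LevelSet.entry₃ f' p.1 ∧ ∀ u, upL V W (f' u) =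
      -(diagL (VdB.resolvent p.1) * upL V W u.1) + diagL (VdB.resolvent p.1) *
        (upL V W u.1 * loL V W p.1.2 + upL V W p.1.1 * loL V W u.2) *
        diagL (VdB.resolvent p.1) * upL V W p.1.1 := by
  obtain ⟨f', hf, hf'⟩ := VdB.hasFDerivAt_resolvent p
  refine ⟨_, (hf.fst.clm_comp hasFDerivAt_fst).neg, fun u => ?_⟩
  simp only [diagL, upL_apply, loL_apply]
  rw [blockMat_mul, blockMat_mul, blockMat_mul, blockMat_add, blockMat_mul, blockMat_mul,
    blockMat_mul, blockMat_neg, blockMat_add, blockMat_inj]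
  have h1 : (f' u).1 = -((VdB.resolvent p.1).1 ∘L (u.1 ∘L p.1.2 + p.1.1 ∘L u.2) ∘L
      (VdB.resolvent p.1).1) := congrArg Prod.fst (hf' u)
  refine ⟨?_, ?_, ?_, ?_⟩
  · ext; simp
  · ext w
    simp [h1, add_comm]
  · ext; simp
  · ext; simp

/-- These are XR = RX and RX² = 1 - R, sorted into strictly upper and lower parts. -/
theorem VdB.resolvent_relations (p : VdB V W) :
    loL V W p.1.2 * diagL (resolvent p.1) = diagL (resolvent p.1) * loL V W p.1.2 ∧
    (∀ x, diagL (resolvent p.1) * (upL V W p.1.1 * (loL V W p.1.2 * upL V W x)) =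
      upL V W x - diagL (resolvent p.1) * upL V W x) ∧
    ∀ y, diagL (resolvent p.1) * (loL V W p.1.2 * (upL V W p.1.1 * loL V W y)) =
      loL V W y - diagL (resolvent p.1) * loL V W y := by
  have h := resolvent_mul_sq p
  rw [offDiag_eq] at h
  have e : (upL V W p.1.1 + loL V W p.1.2) * (upL V W p.1.1 + loL V W p.1.2) =
      upL V W p.1.1 * loL V W p.1.2 + loL V W p.1.2 * upL V W p.1.1 := by
    rw [mul_add, add_mul, add_mul, upL_mul_upL, loL_mul_loL, zero_add, add_zero, add_comm]
  rw [e] at h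
  refine ⟨?_, fun x => ?_, fun y => ?_⟩
  · have h1 := offDiag_mul_resolvent p
    rw [offDiag_mul_diagL, diagL_mul_offDiag] at h1
    have h2 := congrArg Prod.snd (offDiag_injective h1)
    have h3 : ∀ v, p.1.2 ((resolvent p.1).1 v) = (resolvent p.1).2 (p.1.2 v) :=
      DFunLike.congr_fun h2
    rw [loL_apply, diagL, blockMat_mul, blockMat_mul, blockMat_inj]
    refine ⟨?_, ?_, ?_, ?_⟩ <;> ext <;> simp [h3]
  · have := congrArg (· * upL V W x) h
    simpa only [mul_assoc, add_mul, sub_mul, one_mul, upL_mul_upL, mul_zero, add_zero] using this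
  · have := congrArg (· * loL V W y) h
    simpa only [mul_assoc, add_mul, sub_mul, one_mul, loL_mul_loL, mul_zero, zero_add] using this

namespace Fission

theorem form_apply (p : Fission V W) (u v : Model V W) : form V W p ![u, v] = (1 / 2) *
    ((trL (V × W) (rightMC C p u * (p.b * (rightMC C p v * (↑p.b⁻¹ : LieG V W)))) -
        trL (V × W) (rightMC C p v * (p.b * (rightMC C p u * (↑p.b⁻¹ : LieG V W))))) +
      (trL (V × W) (rightMC C p u * rightMC b p v) -
        trL (V × W) (rightMC C p v * rightMC b p u)) +
      (trL (V × W) (rightMC C₄ p u * leftMC (fun q : Fission V W => blockDiag V W q.h) p v) -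
        trL (V × W) (rightMC C₄ p v * leftMC (fun q : Fission V W => blockDiag V W q.h) p u)) -
      ((trL (V × W) (leftMC C₁ p u * leftMC C p v) - trL (V × W) (leftMC C₁ p v * leftMC C p u)) +
        (trL (V × W) (leftMC C₂ p u * leftMC C₁ p v) -
          trL (V × W) (leftMC C₂ p v * leftMC C₁ p u)) +
        (trL (V × W) (leftMC C₃ p u * leftMC C₂ p v) -
          trL (V × W) (leftMC C₃ p v * leftMC C₂ p u)) +
        (trL (V × W) (leftMC C₄ p u * leftMC C₃ p v) -
          trL (V × W) (leftMC C₄ p v * leftMC C₃ p u)))) := rfl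

end Fission

namespace LevelSet

theorem b_incl (z : LevelSet V W) : z.incl.b = 1 := by
  have h : z.incl.C⁻¹ * z.incl.b * z.incl.C = 1 := z.2
  rwa [mul_eq_one_iff_eq_inv, mul_eq_left] at h

variable [ChartedSpace (LieG V W × HomPair V W) (LevelSet V W)]

theorem unitMDifferentiableAt_comp (hζ : IsGlobalChart (LevelSet.coords : LevelSet V W → _))
    {f : Fission V W → GG V W} (hf : ∀ p, UnitMDifferentiableAt (Fission.Model V W) f p)
    (z : LevelSet V W) :
    UnitMDifferentiableAt (LieG V W × HomPair V W) (fun z : LevelSet V W => f z.incl) z :=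
  MDifferentiableAt.comp (g := fun p => (f p : LieG V W)) (f := LevelSet.incl) z
    (hf z.incl)
    ((contMDiff_incl hζ z).mdifferentiableAt (by simp))

/-- For S = 1 + s the form is (1 - s)ds, and the product of two strictly upper triangular matrices
is zero. -/
theorem leftMC_of_upper (hζ : IsGlobalChart (LevelSet.coords : LevelSet V W → _))
    {S : LevelSet V W → UPlus V W} {F : HomPair V W → W →L[ℂ] V}
    {F' : HomPair V W →L[ℂ] W →L[ℂ] V} (hS : ∀ z, upperEntry (S z).1 = F z.toVdB.1)
    {z : LevelSet V W} (hF : HasFDerivAt F F' z.toVdB.1) (u : LieG V W × HomPair V W) :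
    leftMC (fun z => (S z).1) z u = upL V W (F' u.2) := by
  have h1 : HasFDerivAt (fun q : LieG V W × HomPair V W => 1 + upL V W (F q.2))
      ((upL V W).comp (F'.comp (.snd ℂ _ _))) z.coords :=
    ((upL V W).hasFDerivAt.comp z.coords (HasFDerivAt.comp (g := F) z.coords hF
      hasFDerivAt_snd)).const_add 1
  rw [leftMC_apply, show (fun z => ((S z).1 : LieG V W)) = fun z => 1 + upL V W (F z.coords.2) from
    funext fun z => by rw [val_UPlus, hS]; rfl, tangentMapAt_eq (hζ.hasMFDerivAt_comp h1),
    ← upperUnit_upperEntry, val_inv_upperUnit]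
  change _ * upL V W (F' u.2) = _
  rw [sub_mul, upL_mul_upL, one_mul, sub_zero]

theorem leftMC_of_lower (hζ : IsGlobalChart (LevelSet.coords : LevelSet V W → _))
    {S : LevelSet V W → UMinus V W} {F : HomPair V W → V →L[ℂ] W}
    {F' : HomPair V W →L[ℂ] V →L[ℂ] W} (hS : ∀ z, lowerEntry (S z).1 = F z.toVdB.1)
    {z : LevelSet V W} (hF : HasFDerivAt F F' z.toVdB.1) (u : LieG V W × HomPair V W) :
    leftMC (fun z => (S z).1) z u = loL V W (F' u.2) := by
  have h1 : HasFDerivAt (fun q : LieG V W × HomPair V W => 1 + loL V W (F q.2))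
      ((loL V W).comp (F'.comp (.snd ℂ _ _))) z.coords :=
    ((loL V W).hasFDerivAt.comp z.coords (HasFDerivAt.comp (g := F) z.coords hF
      hasFDerivAt_snd)).const_add 1
  rw [leftMC_apply, show (fun z => ((S z).1 : LieG V W)) = fun z => 1 + loL V W (F z.coords.2) from
    funext fun z => by rw [val_UMinus, hS]; rfl, tangentMapAt_eq (hζ.hasMFDerivAt_comp h1),
    ← lowerUnit_lowerEntry, val_inv_lowerUnit]
  change _ * loL V W (F' u.2) = _
  rw [sub_mul, loL_mul_loL, one_mul, sub_zero]

theorem leftMC_h (hζ : IsGlobalChart (LevelSet.coords : LevelSet V W → _)) (z : LevelSet V W)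
    (u : LieG V W × HomPair V W) :
    ∃ X : LieH V W, leftMC (fun z : LevelSet V W => blockDiag V W z.incl.h) z u = diagL X := by
  have h0 : DifferentiableAt ℂ (fun q : LieG V W × HomPair V W => (inclCoords q).2.2) z.coords :=
    (contDiffAt_inclCoords z).snd.snd.differentiableAt (by simp)
  have h1 := (diagCL V W).hasFDerivAt.comp z.coords h0.hasFDerivAt
  have h2 : (fun z : LevelSet V W => (blockDiag V W z.incl.h : LieG V W)) =
      fun z => (diagCL V W ∘ fun q => (inclCoords q).2.2) z.coords :=
    funext fun z => congrArg (diagL (V := V) (W := W)) z.val_h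
  rw [leftMC_apply, h2, tangentMapAt_eq (hζ.hasMFDerivAt_comp h1), ← map_inv]
  refine ⟨(↑z.incl.h⁻¹ : LieH V W) * _, (diagL_mul _ _).symm⟩

end LevelSet

end Descent

/-! ### The restricted two-form is that of ℬ(V, W) -/

section Descent

variable {V W : Type*} [NormedAddCommGroup V] [NormedSpace ℂ V] [FiniteDimensional ℂ V]
  [NormedAddCommGroup W] [NormedSpace ℂ W] [FiniteDimensional ℂ W]

namespace LevelSet

variable [ChartedSpace (LieG V W × HomPair V W) (LevelSet V W)]

/-- The pullback to the level set of the two-form of `𝒜²(V, W)`, in terms of the products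
`D₁ = S₁`, `D₂ = S₂ S₁`, `D₃ = S₃ S₂ S₁` and `D₄ = h⁻¹`. -/
theorem pullback_form_apply (hζ : IsGlobalChart (LevelSet.coords : LevelSet V W → _))
    (z : LevelSet V W) (u v : LieG V W × HomPair V W)
    {D₁ D₂ D₃ D₄ : LevelSet V W → GG V W} (hD₁ : D₁ = fun z => (z.incl.S₁ : GG V W))
    (hD₂ : D₂ = fun z => (z.incl.S₂ : GG V W) * D₁ z)
    (hD₃ : D₃ = fun z => (z.incl.S₃ : GG V W) * D₂ z)
    (hD₄ : D₄ = fun z => (blockDiag V W z.incl.h)⁻¹) :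
    Fission.form V W z.incl ![tangentMapAt LevelSet.incl z u, tangentMapAt LevelSet.incl z v] =
    (1 / 2) * -((trL (V × W) (leftMC D₂ z u * leftMC D₁ z v) -
        trL (V × W) (leftMC D₂ z v * leftMC D₁ z u)) +
      (trL (V × W) (leftMC D₃ z u * leftMC D₂ z v) -
        trL (V × W) (leftMC D₃ z v * leftMC D₂ z u)) +
      (trL (V × W) (leftMC D₄ z u * leftMC D₃ z v) -
        trL (V × W) (leftMC D₄ z v * leftMC D₃ z u))) := by
  have hi : MDifferentiableAt 𝓘(ℂ, LieG V W × HomPair V W) 𝓘(ℂ, Fission.Model V W)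
      (LevelSet.incl : LevelSet V W → Fission V W) z :=
    (contMDiff_incl hζ z).mdifferentiableAt (by simp)
  have hC := unitMDifferentiableAt_comp hζ Fission.unitMDifferentiableAt_C z
  have hS₁ := unitMDifferentiableAt_comp hζ Fission.unitMDifferentiableAt_S₁ z
  have hS₂ := unitMDifferentiableAt_comp hζ Fission.unitMDifferentiableAt_S₂ z
  have hS₃ := unitMDifferentiableAt_comp hζ Fission.unitMDifferentiableAt_S₃ z
  have hh := unitMDifferentiableAt_comp hζ Fission.unitMDifferentiableAt_h z
  have h₁ : UnitMDifferentiableAt (LieG V W × HomPair V W) D₁ z := by rw [hD₁]; exact hS₁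
  have h₂ : UnitMDifferentiableAt (LieG V W × HomPair V W) D₂ z := by rw [hD₂]; exact hS₂.mul h₁
  have h₃ : UnitMDifferentiableAt (LieG V W × HomPair V W) D₃ z := by rw [hD₃]; exact hS₃.mul h₂
  have h₄ : UnitMDifferentiableAt (LieG V W × HomPair V W) D₄ z := by rw [hD₄]; exact hh.inv
  have c₁ : (fun z : LevelSet V W => z.incl.C₁) = fun z => D₁ z * z.incl.C := by rw [hD₁]; rfl
  have c₂ : (fun z : LevelSet V W => z.incl.C₂) = fun z => D₂ z * z.incl.C := by
    rw [hD₂, hD₁]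
    funext z
    exact (mul_assoc _ _ _).symm
  have c₃ : (fun z : LevelSet V W => z.incl.C₃) = fun z => D₃ z * z.incl.C := by
    rw [hD₃]
    funext z
    rw [mul_assoc]
    exact congrArg _ (congrFun c₂ z)
  -- Since b = 1 on the level set, S₄S₃S₂S₁ = h⁻¹.
  have c₄ : (fun z : LevelSet V W => z.incl.C₄) = fun z => D₄ z * z.incl.C := by
    rw [hD₄]
    funext z
    rw [eq_inv_mul_iff_mul_eq, ← one_mul z.incl.C, ← b_incl z]
    simp only [Fission.b, Fission.C₄, Fission.C₃, Fission.C₂, Fission.C₁, mul_assoc]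
  have e : ∀ {f : Fission V W → GG V W} {D : LevelSet V W → GG V W},
      (∀ p, UnitMDifferentiableAt (Fission.Model V W) f p) →
      UnitMDifferentiableAt (LieG V W × HomPair V W) D z →
      ((fun z : LevelSet V W => f z.incl) = fun z => D z * z.incl.C) → ∀ u,
      leftMC f z.incl (tangentMapAt LevelSet.incl z u : Fission.Model V W) =
        (↑z.incl.C⁻¹ : LieG V W) * leftMC D z u * z.incl.C +
          leftMC (fun z : LevelSet V W => z.incl.C) z u := fun hf hD h u => by
    rw [leftMC_comp (hf _) hi, h, leftMC_mul hD hC]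
  have e₀ : ∀ u, leftMC Fission.C z.incl (tangentMapAt LevelSet.incl z u : Fission.Model V W) =
      leftMC (fun z : LevelSet V W => z.incl.C) z u :=
    fun u => leftMC_comp (Fission.unitMDifferentiableAt_C _) hi u
  have e₁ := e Fission.unitMDifferentiableAt_C₁ h₁ c₁
  have e₂ := e Fission.unitMDifferentiableAt_C₂ h₂ c₂
  have e₃ := e Fission.unitMDifferentiableAt_C₃ h₃ c₃
  have e₄ := e Fission.unitMDifferentiableAt_C₄ h₄ c₄
  have eb : ∀ u, rightMC Fission.b z.incl (tangentMapAt LevelSet.incl z u : Fission.Model V W) = 0 :=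
    fun u => by
      rw [rightMC_comp (Fission.unitMDifferentiableAt_b _) hi,
        rightMC_eq_zero_of_const (c := 1) b_incl]
      rfl
  have eh : ∀ u, leftMC (fun q : Fission V W => blockDiag V W q.h) z.incl
      (tangentMapAt LevelSet.incl z u : Fission.Model V W) =
      leftMC (fun z : LevelSet V W => blockDiag V W z.incl.h) z u :=
    fun u => leftMC_comp (Fission.unitMDifferentiableAt_h _) hi u
  have ed : ∀ u : LieG V W × HomPair V W, leftMC D₄ z u = -(blockDiag V W z.incl.h *
      leftMC (fun z : LevelSet V W => blockDiag V W z.incl.h) z u *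
      (↑(blockDiag V W z.incl.h)⁻¹ : LieG V W)) := fun u => by
    rw [hD₄, leftMC_inv hh, rightMC_eq_conj]
  have hC₄ : z.incl.C₄ = (blockDiag V W z.incl.h)⁻¹ * z.incl.C := by
    rw [congrFun c₄ z, hD₄]
  have main := trace_framing_cancel (t := (trL (V × W) : LieG V W →+ ℂ)) trL_mul_comm z.incl.C
    (blockDiag V W z.incl.h) (gu := leftMC (fun z : LevelSet V W => z.incl.C) z u)
    (gv := leftMC (fun z : LevelSet V W => z.incl.C) z v) (d₁u := leftMC D₁ z u)
    (d₁v := leftMC D₁ z v) (d₂u := leftMC D₂ z u) (d₂v := leftMC D₂ z v) (d₃u := leftMC D₃ z u)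
    (d₃v := leftMC D₃ z v) (ed u) (ed v)
  have r₀ : ∀ x : Fission.Model V W, rightMC Fission.C z.incl x =
      z.incl.C * leftMC Fission.C z.incl x * (↑z.incl.C⁻¹ : LieG V W) := rightMC_eq_conj _ _
  have r₄ : ∀ x : Fission.Model V W, rightMC Fission.C₄ z.incl x =
      z.incl.C₄ * leftMC Fission.C₄ z.incl x * (↑z.incl.C₄⁻¹ : LieG V W) := rightMC_eq_conj _ _
  rw [Fission.form_apply]
  simp only [r₀, r₄, e₀, e₁, e₂, e₃, e₄, eb, eh,
    b_incl, mul_zero, map_zero, sub_zero, inv_one, Units.val_one, one_mul, mul_one, add_zero, hC₄]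
  exact congrArg _ main

theorem leftMC_S₁ (hζ : IsGlobalChart (LevelSet.coords : LevelSet V W → _)) (z : LevelSet V W)
    (u : LieG V W × HomPair V W) :
    leftMC (fun z : LevelSet V W => (z.incl.S₁ : GG V W)) z u = upL V W u.2.1 :=
  leftMC_of_upper hζ (S := fun z => z.incl.S₁) (F := fun x => x.1) (fun _ => rfl) hasFDerivAt_fst u

theorem leftMC_S₂ (hζ : IsGlobalChart (LevelSet.coords : LevelSet V W → _)) (z : LevelSet V W)
    (u : LieG V W × HomPair V W) :
    leftMC (fun z : LevelSet V W => (z.incl.S₂ : GG V W)) z u = loL V W u.2.2 :=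
  leftMC_of_lower hζ (S := fun z => z.incl.S₂) (F := fun x => x.2) (fun _ => rfl) hasFDerivAt_snd u

/-- The two-form of `ℬ(V, W)` pulls back to the restriction of the two-form of `𝒜²(V, W)`. -/
theorem form_descends_apply (hζ : IsGlobalChart (LevelSet.coords : LevelSet V W → _))
    (z : LevelSet V W) (u v : LieG V W × HomPair V W) :
    Fission.form V W z.incl ![tangentMapAt LevelSet.incl z u, tangentMapAt LevelSet.incl z v] =
      VdB.form V W z.toVdB ![u.2, v.2] := by
  let D₁ : LevelSet V W → GG V W := fun z => (z.incl.S₁ : GG V W)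
  let D₂ : LevelSet V W → GG V W := fun z => (z.incl.S₂ : GG V W) * D₁ z
  let D₃ : LevelSet V W → GG V W := fun z => (z.incl.S₃ : GG V W) * D₂ z
  let D₄ : LevelSet V W → GG V W := fun z => (blockDiag V W z.incl.h)⁻¹
  have hS₁ := unitMDifferentiableAt_comp hζ Fission.unitMDifferentiableAt_S₁ z
  have hS₂ := unitMDifferentiableAt_comp hζ Fission.unitMDifferentiableAt_S₂ z
  have hS₃ := unitMDifferentiableAt_comp hζ Fission.unitMDifferentiableAt_S₃ z
  have hS₄ := unitMDifferentiableAt_comp hζ Fission.unitMDifferentiableAt_S₄ z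
  have hh := unitMDifferentiableAt_comp hζ Fission.unitMDifferentiableAt_h z
  have v₁ : (D₁ z : LieG V W) = 1 + upL V W z.toVdB.1.1 := val_UPlus _
  have v₂ : ((z.incl.S₂ : GG V W) : LieG V W) = 1 + loL V W z.toVdB.1.2 := val_UMinus _
  have i₁ : (↑(D₁ z)⁻¹ : LieG V W) = 1 - upL V W z.toVdB.1.1 := by
    rw [← val_inv_upperUnit]
    exact congrArg (fun x : GG V W => (↑x⁻¹ : LieG V W)) (upperUnit_upperEntry _).symm
  have i₂ : (↑(z.incl.S₂ : GG V W)⁻¹ : LieG V W) = 1 - loL V W z.toVdB.1.2 := by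
    rw [← val_inv_lowerUnit]
    exact congrArg (fun x : GG V W => (↑x⁻¹ : LieG V W)) (lowerUnit_lowerEntry _).symm
  obtain ⟨f', hf, hf'⟩ := hasFDerivAt_entry₃ z.toVdB
  have d₁ : ∀ u : LieG V W × HomPair V W, leftMC D₁ z u = upL V W u.2.1 := leftMC_S₁ hζ z
  have d₂ : ∀ u : LieG V W × HomPair V W, leftMC D₂ z u = (1 - upL V W z.toVdB.1.1) * loL V W u.2.2 *
      (1 + upL V W z.toVdB.1.1) + upL V W u.2.1 := fun u => by
    rw [leftMC_mul hS₂ hS₁, leftMC_S₂ hζ, i₁, v₁, d₁]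
  have d₃ : ∀ u : LieG V W × HomPair V W, leftMC D₃ z u = (1 - upL V W z.toVdB.1.1) *
      (1 - loL V W z.toVdB.1.2) * upL V W (f' u.2) * ((1 + loL V W z.toVdB.1.2) *
      (1 + upL V W z.toVdB.1.1)) + leftMC D₂ z u := fun u => by
    rw [leftMC_mul hS₃ (hS₂.mul hS₁), leftMC_of_upper hζ (S := fun z => z.incl.S₃)
      upperEntry_S₃ hf, ← i₁, ← i₂, ← v₁, ← v₂, ← Units.val_mul, ← Units.val_mul, ← mul_inv_rev]
  have hD₃ : D₃ = fun z => (z.incl.S₄ : GG V W)⁻¹ * D₄ z := by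
    funext z
    have h := b_incl z
    simp only [Fission.b, mul_assoc] at h
    rw [eq_inv_mul_iff_mul_eq, eq_inv_iff_mul_eq_one, mul_eq_one_comm]
    exact h
  -- From D₃ = S₄⁻¹D₄, the forms of D₃ and D₄ differ by a strictly lower triangular term conjugated
  -- by D₄, which has trace zero against the block diagonal form of D₄. What is left is the
  -- antisymmetrized pairing of the latter with itself.
  have d₄ : ∀ u v : LieG V W × HomPair V W, trL (V × W) (leftMC D₄ z u * leftMC D₃ z v) -
      trL (V × W) (leftMC D₄ z v * leftMC D₃ z u) = 0 := by
    obtain ⟨f₄, hf₄⟩ : ∃ f₄ : HomPair V W →L[ℂ] (V →L[ℂ] W), HasFDerivAt entry₄ f₄ z.toVdB.1 :=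
      ⟨_, (contDiff_entry₄.differentiable (by simp) _).hasFDerivAt⟩
    have r₄ : ∀ u : LieG V W × HomPair V W,
        leftMC (fun z : LevelSet V W => (z.incl.S₄ : GG V W)⁻¹) z u =
        -loL V W (f₄ u.2) := fun u => by
      rw [leftMC_inv hS₄, rightMC_eq_conj, leftMC_of_lower hζ (S := fun z => z.incl.S₄)
        lowerEntry_S₄ hf₄, ← lowerUnit_lowerEntry, val_lowerUnit, val_inv_lowerUnit, mul_sub,
        mul_one, mul_assoc, loL_mul_loL, mul_zero, sub_zero, add_mul, loL_mul_loL, one_mul,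
        add_zero]
    have hX : ∀ u : LieG V W × HomPair V W, ∃ X : LieH V W, leftMC D₄ z u = diagL X := fun u => by
      obtain ⟨X, hX⟩ := leftMC_h hζ z u
      rw [leftMC_inv hh, rightMC_eq_conj, hX, ← map_inv, val_blockDiag, val_blockDiag, ← diagL_mul,
        ← diagL_mul, ← diagL_neg]
      exact ⟨_, rfl⟩
    have e : ∀ u v : LieG V W × HomPair V W, trL (V × W) (leftMC D₄ z u * leftMC D₃ z v) =
        trL (V × W) (leftMC D₄ z u * leftMC D₄ z v) := fun u v => by
      obtain ⟨X, hX⟩ := hX u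
      rw [hD₃, leftMC_mul hS₄.inv hh.inv, r₄, mul_add, map_add, hX, ← map_neg, inv_inv, ← map_inv,
        val_blockDiag, val_blockDiag, trL_diagL_loL, zero_add]
    intro u v
    rw [e, e, trL_mul_comm, sub_self]
  have main := pullback_form_apply hζ z u v (D₁ := D₁) (D₂ := D₂) (D₃ := D₃) (D₄ := D₄)
    rfl rfl rfl rfl
  obtain ⟨hR, hR₁, hR₂⟩ := VdB.resolvent_relations z.toVdB
  have m₁ := trace_stokes (t := (trL (V × W) : LieG V W →+ ℂ)) trL_mul_comm
    (upL_mul_upL _ _) (upL_mul_upL _ _) (upL_mul_upL _ _) (upL_mul_upL _ _) (upL_mul_upL _ _)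
    (upL_mul_upL _ _) (upL_mul_upL _ _) (upL_mul_upL _ _) (upL_mul_upL _ _) (loL_mul_loL _ _)
    (loL_mul_loL _ _) (loL_mul_loL _ _) (loL_mul_loL _ _) (d₁ u) (d₁ v) (d₂ u) (d₂ v) (d₃ u) (d₃ v)
  have m₂ := trace_reduced (t := (trL (V × W) : LieG V W →+ ℂ)) trL_mul_comm hR (hR₁ u.2.1)
    (hR₁ v.2.1) (hR₂ u.2.2) (hR₂ v.2.2) (hf' u.2) (hf' v.2)
  rw [main, d₄, add_zero, VdB.form_eq, VdB.formL_apply_trL]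
  refine congrArg _ ((congrArg Neg.neg (m₁.trans m₂)).trans (neg_neg _))

theorem form_descends [ChartedSpace (HomPair V W) (Reduced V W)]
    (hζ : IsGlobalChart (LevelSet.coords : LevelSet V W → _))
    (hΦ : IsGlobalChart fun r : Reduced V W => (Reduced.homeo r).1) :
    pullbackForm (E := LieG V W × HomPair V W) (LevelSet.proj : LevelSet V W → Reduced V W)
      (fun r => VdB.form V W (Reduced.homeo r) : TwoForm (HomPair V W) (Reduced V W)) =
    pullbackForm LevelSet.incl (Fission.form V W) := by
  funext z
  refine twoForm_ext fun u v => ?_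
  rw [pullbackForm_apply, pullbackForm_apply, tangentMapAt_eq (hasMFDerivAt_proj hζ hΦ z)]
  exact (form_descends_apply hζ z u v).symm

end LevelSet

end Descent

/-! ### Assembling the reduction and the isomorphism -/

section Main

variable {V W : Type*} [NormedAddCommGroup V] [NormedSpace ℂ V] [FiniteDimensional ℂ V]
  [NormedAddCommGroup W] [NormedSpace ℂ W] [FiniteDimensional ℂ W]

theorem isReduction [ChartedSpace (LieG V W × HomPair V W) (LevelSet V W)]
    [ChartedSpace (HomPair V W) (Reduced V W)]
    [IsManifold 𝓘(ℂ, LieG V W × HomPair V W) ω (LevelSet V W)]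
    [IsManifold 𝓘(ℂ, HomPair V W) ω (Reduced V W)]
    (hζ : IsGlobalChart (LevelSet.coords : LevelSet V W → _))
    (hΦ : IsGlobalChart fun r : Reduced V W => (Reduced.homeo r).1) :
    IsReduction (EZ := LieG V W × HomPair V W)
      (fun r => VdB.form V W (Reduced.homeo r) : TwoForm (HomPair V W) (Reduced V W)) where
  levelSet_isManifold := inferInstance
  incl_holomorphic := LevelSet.contMDiff_incl hζ
  incl_immersion := LevelSet.mfderiv_incl_injective hζ
  reduced_isManifold := inferInstance
  proj_holomorphic := LevelSet.contMDiff_proj hζ hΦ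
  proj_submersion := LevelSet.mfderiv_proj_surjective hζ hΦ
  form_descends := LevelSet.form_descends hζ hΦ

/-- Charts and two-form of the reduced space are transported from ℬ(V, W), so the isomorphism is the
identity in coordinates. -/
theorem isQHIso_homeo [ChartedSpace (HomPair V W) (Reduced V W)]
    (hΦ : IsGlobalChart fun r : Reduced V W => (Reduced.homeo r).1) :
    IsQHIso Reduced.moment
      (fun r => VdB.form V W (Reduced.homeo r) : TwoForm (HomPair V W) (Reduced V W))
      VdB.moment (VdB.form V W) (Reduced.homeo (V := V) (W := W)).toEquiv where
  holomorphic := (isGlobalChart_opens (vdbOpens V W)).contMDiff_of_comp hΦ.contMDiff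
  holomorphic_symm := by
    refine hΦ.contMDiff_of_comp ?_
    have h : (fun r : Reduced V W => (Reduced.homeo r).1) ∘ Reduced.homeo.toEquiv.symm =
        (Subtype.val : VdB V W → HomPair V W) :=
      funext fun p => congrArg Subtype.val (Reduced.homeo.apply_symm_apply p)
    rw [h]
    exact (isGlobalChart_opens (vdbOpens V W)).contMDiff
  equivariant := Reduced.homeo_smul
  moment r := (Reduced.moment_eq r).symm
  form := by
    funext r
    refine twoForm_ext fun u v => ?_
    rw [pullbackForm_apply, tangentMapAt_eq
      ((isGlobalChart_opens (vdbOpens V W)).hasMFDerivAt_of_comp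
        (f := Reduced.homeo.toEquiv) (hΦ.hasMFDerivAt r))]
    rfl

end Main

end QuasiHamiltonian

theorem mainTheorem8 (V W : Type*)
    [NormedAddCommGroup V] [NormedSpace ℂ V] [FiniteDimensional ℂ V]
    [NormedAddCommGroup W] [NormedSpace ℂ W] [FiniteDimensional ℂ W] :
    IsQuasiHamiltonian (kappaH V W) VdB.moment (VdB.form V W) ∧
    ∃ (_ : ChartedSpace (LieG V W × HomPair V W) (LevelSet V W))
      (_ : ChartedSpace (HomPair V W) (Reduced V W))
      (Ω : TwoForm (HomPair V W) (Reduced V W)),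
      IsReduction (EZ := LieG V W × HomPair V W) Ω ∧
      IsQuasiHamiltonian (kappaH V W) Reduced.moment Ω ∧
      ∃ Φ : Reduced V W ≃ VdB V W,
        (∀ z : LevelSet V W,
          (Φ z.proj).a = upperEntry (z.incl.S₁ : GG V W) ∧
          (Φ z.proj).b = lowerEntry (z.incl.S₂ : GG V W)) ∧
        IsQHIso Reduced.moment Ω VdB.moment (VdB.form V W) Φ := by
  -- A point is needed because a charted space with a single global chart is built from a nonempty
  -- domain.
  have h0 : (0 : HomPair V W) ∈ vdbOpens V W := (mem_vdbOpens_iff _).2 (by simp)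
  have n1 : Nonempty (LevelSet V W) := ⟨LevelSet.mk 1 ⟨0, h0⟩⟩
  have n2 : Nonempty (Reduced V W) := ⟨(LevelSet.mk 1 ⟨0, h0⟩).proj⟩
  let c1 : ChartedSpace (LieG V W × HomPair V W) (LevelSet V W) :=
    LevelSet.isOpenEmbedding_coords.singletonChartedSpace
  let c2 : ChartedSpace (HomPair V W) (Reduced V W) :=
    Reduced.isOpenEmbedding_coords.singletonChartedSpace
  have m1 : IsManifold 𝓘(ℂ, LieG V W × HomPair V W) ω (LevelSet V W) :=
    LevelSet.isOpenEmbedding_coords.isManifold_singleton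
  have m2 : IsManifold 𝓘(ℂ, HomPair V W) ω (Reduced V W) :=
    Reduced.isOpenEmbedding_coords.isManifold_singleton
  have hζ : IsGlobalChart (LevelSet.coords : LevelSet V W → _) :=
    isGlobalChart_singletonChartedSpace LevelSet.isOpenEmbedding_coords
  have hΦ : IsGlobalChart fun r : Reduced V W => (Reduced.homeo r).1 :=
    isGlobalChart_singletonChartedSpace Reduced.isOpenEmbedding_coords
  refine ⟨VdB.isQuasiHamiltonian (j := id) (isGlobalChart_opens (vdbOpens V W)) fun _ _ => rfl,
    c1, c2, fun r => VdB.form V W (Reduced.homeo r), isReduction hζ hΦ, ?_,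
    Reduced.homeo.toEquiv, fun z => ⟨rfl, rfl⟩, isQHIso_homeo hΦ⟩
  rw [show (Reduced.moment : Reduced V W → HH V W) = fun r => (Reduced.homeo r).moment from
    funext Reduced.moment_eq]
  exact VdB.isQuasiHamiltonian hΦ Reduced.homeo_smul
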